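/- Let $n\ge 1$, let $\varphi:\mathbb C^n\to\mathbb R$ be a plurisubharmonic function of class $\mathcal C^2$, and let $1\le q\le n$. Write $\lambda$ for Lebesgue measure on $\mathbb C^n$. For an integer $p\ge 0$ let $L^2_{(0,p)}(\mathbb C^n,\varphi)$ be the Hilbert space of $(0,p)$-forms $u=\sum_{|J|=p}' u_J\,d\bar z_J$ (sum over strictly increasing multi-indices $J$ of length $p$) with measurable coefficients, identified when equal almost everywhere, and with $$\|u\|_\varphi^2=\sum_{|J|=p}'\int_{\mathbb C^n}|u_J|^2e^{-\varphi}\,d\lambda<\infty .$$ Let $\bar\partial$ be the densely defined closed operator from $L^2_{(0,p)}(\mathbb C^n,\varphi)$ to $L^2_{(0,p+1)}(\mathbb C^n,\varphi)$ given by $$\bar\partial u=\sum_{|J|=p}'\sum_{j=1}^n\frac{\partial u_J}{\partial\bar z_j}\,d\bar z_j\wedge d\bar z_J$$ in the sense of distributions, whose domain consists of all $u\in L^2_{(0,p)}(\mathbb C^n,\varphi)$ with $\bar\partial u\in L^2_{(0,p+1)}(\mathbb C^n,\varphi)$, and let $\bar\partial^*_\varphi$ be its Hilbert space adjoint. Let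 $$\square_\varphi=\bar\partial\,\bar\partial^*_\varphi+\bar\partial^*_\varphi\,\bar\partial$$ be the complex Laplacian on $L^2_{(0,q)}(\mathbb C^n,\varphi)$, with domain consisting of all $u\in\operatorname{dom}(\bar\partial)\cap\operatorname{dom}(\bar\partial^*_\varphi)$ such that $\bar\partial u\in\operatorname{dom}(\bar\partial^*_\varphi)$ and $\bar\partial^*_\varphi u\in\operatorname{dom}(\bar\partial)$. For $z\in\mathbb C^n$ let $s_q(z)$ be the sum of the $q$ smallest eigenvalues, counted with multiplicity, of the Levi matrix $$M_\varphi(z)=\left(\frac{\partial^2\varphi}{\partial z_j\partial\bar z_k}(z)\right)_{j,k=1}^n .$$ Suppose that $$\liminf_{|z|\to\infty}s_q(z)>0,$$ where the value $+\infty$ is allowed. Then there exists exactly one bounded linear operator $$N_{\varphi,q}:L^2_{(0,q)}(\mathbb C^n,\varphi)\to L^2_{(0,q)}(\mathbb C^n,\varphi)$$ such that, for every $u\in L^2_{(0,q)}(\mathbb C^n,\varphi)$, the form $N_{\varphi,q}u$ belongs to $\operatorname{dom}(\square_\varphi)$ and $\square_\varphi N_{\varphi,q}u=u$. -/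

import Mathlib

open MeasureTheory Filter Topology
open scoped ContDiff

namespace WeightedDbar

noncomputable section

/-! ### Wirtinger derivatives on `ℂⁿ`, the Levi matrix, plurisubharmonicity -/

/-- `∂f/∂z_j = (∂f/∂x_j - i ∂f/∂y_j) / 2`, where `z_j = x_j + i y_j`. -/
def dz {n : ℕ} (j : Fin n) (f : (Fin n → ℂ) → ℂ) (z : Fin n → ℂ) : ℂ :=
  (fderiv ℝ f z (Pi.single j 1) - Complex.I * fderiv ℝ f z (Pi.single j Complex.I)) / 2

/-- `∂f/∂z̄_j = (∂f/∂x_j + i ∂f/∂y_j) / 2`, where `z_j = x_j + i y_j`. -/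
def dzbar {n : ℕ} (j : Fin n) (f : (Fin n → ℂ) → ℂ) (z : Fin n → ℂ) : ℂ :=
  (fderiv ℝ f z (Pi.single j 1) + Complex.I * fderiv ℝ f z (Pi.single j Complex.I)) / 2

/-- The Levi matrix `M_φ(z) = (∂²φ/∂z_j∂z̄_k (z))_{jk}`. -/
def levi {n : ℕ} (φ : (Fin n → ℂ) → ℝ) (z : Fin n → ℂ) : Matrix (Fin n) (Fin n) ℂ :=
  Matrix.of fun j k => dz j (dzbar k (fun w => (φ w : ℂ))) z

/-- A (finite-valued) function on `ℂⁿ` is plurisubharmonic if it is upper semicontinuous and has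
the sub-mean value property on every circle in every complex line. -/
def Plurisubharmonic {n : ℕ} (φ : (Fin n → ℂ) → ℝ) : Prop :=
  UpperSemicontinuous φ ∧
    ∀ a b : Fin n → ℂ, φ a ≤ Real.circleAverage (fun ζ : ℂ => φ (a + ζ • b)) 0 1

theorem fderiv_ofReal_comp {n : ℕ} {φ : (Fin n → ℂ) → ℝ} (hφ : ContDiff ℝ 2 φ)
    (z v : Fin n → ℂ) :
    fderiv ℝ (fun w => (φ w : ℂ)) z v = ((fderiv ℝ φ z v : ℝ) : ℂ) := by
  have h : HasFDerivAt φ (fderiv ℝ φ z) z :=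
    (hφ.differentiable (by norm_num) z).hasFDerivAt
  have h2 := (Complex.ofRealCLM.hasFDerivAt (x := φ z)).comp z h
  have h3 : fderiv ℝ (fun w => (φ w : ℂ)) z = Complex.ofRealCLM.comp (fderiv ℝ φ z) := h2.fderiv
  rw [h3]
  rfl

theorem levi_apply {n : ℕ} {φ : (Fin n → ℂ) → ℝ} (hφ : ContDiff ℝ 2 φ)
    (z : Fin n → ℂ) (j k : Fin n) :
    levi φ z j k =
      ((fderiv ℝ (fderiv ℝ φ) z (Pi.single j 1) (Pi.single k 1) : ℝ)
        + Complex.I * (fderiv ℝ (fderiv ℝ φ) z (Pi.single j 1) (Pi.single k Complex.I) : ℝ)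
        - Complex.I * (fderiv ℝ (fderiv ℝ φ) z (Pi.single j Complex.I) (Pi.single k 1) : ℝ)
        + (fderiv ℝ (fderiv ℝ φ) z (Pi.single j Complex.I) (Pi.single k Complex.I) : ℝ)) / 4 := by
  have hd : HasFDerivAt (fderiv ℝ φ) (fderiv ℝ (fderiv ℝ φ) z) z :=
    ((hφ.fderiv_right (m := 1) (by norm_num)).differentiable (by norm_num) z).hasFDerivAt
  have hv : ∀ v : Fin n → ℂ, HasFDerivAt (fun w => ((fderiv ℝ φ w v : ℝ) : ℂ))
      (Complex.ofRealCLM.comp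
        ((ContinuousLinearMap.apply ℝ ℝ v).comp (fderiv ℝ (fderiv ℝ φ) z))) z := fun v =>
    (Complex.ofRealCLM.hasFDerivAt).comp z
      (((ContinuousLinearMap.apply ℝ ℝ v).hasFDerivAt).comp z hd)
  have hfun : dzbar k (fun w => (φ w : ℂ)) = fun w =>
      ((2 : ℂ)⁻¹) * (((fderiv ℝ φ w (Pi.single k 1) : ℝ) : ℂ)
        + Complex.I * ((fderiv ℝ φ w (Pi.single k Complex.I) : ℝ) : ℂ)) := by
    funext w
    simp only [dzbar, fderiv_ofReal_comp hφ]
    ring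
  have hD := ((hv (Pi.single k 1)).add
    ((hv (Pi.single k Complex.I)).const_mul Complex.I)).const_mul ((2 : ℂ)⁻¹)
  have hD' := hD.fderiv
  simp only [Pi.add_apply] at hD'
  simp only [levi, Matrix.of_apply, dz, hfun, hD']
  simp
  ring_nf
  simp only [Complex.I_sq]
  ring

/-- The Levi matrix of a `C²` function is Hermitian. -/
theorem levi_isHermitian {n : ℕ} {φ : (Fin n → ℂ) → ℝ} (hφ : ContDiff ℝ 2 φ) (z : Fin n → ℂ) :
    (levi φ z).IsHermitian := by
  have hs : IsSymmSndFDerivAt ℝ φ z := hφ.contDiffAt.isSymmSndFDerivAt (by simp)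
  ext j k
  rw [Matrix.conjTranspose_apply, levi_apply hφ, levi_apply hφ,
    hs.eq (Pi.single k 1) (Pi.single j 1), hs.eq (Pi.single k 1) (Pi.single j Complex.I),
    hs.eq (Pi.single k Complex.I) (Pi.single j 1),
    hs.eq (Pi.single k Complex.I) (Pi.single j Complex.I)]
  simp
  ring

/-! ### Weighted `L²` forms of type `(0,q)` -/

/-- Strictly increasing multi-indices `J = (j_1 < ⋯ < j_q)` in `{1, …, n}`, recorded as the
`q`-element subsets of `Fin n`. -/
abbrev MultiIdx (n q : ℕ) : Type := {J : Finset (Fin n) // J.card = q}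

/-- `s_q(z)`, the sum of the `q` smallest eigenvalues (with multiplicity) of `M_φ(z)`: the minimum
over all choices of `q` of the `n` eigenvalues of their sum. -/
def sumSmallestEigenvalues {n : ℕ} {φ : (Fin n → ℂ) → ℝ} (hφ : ContDiff ℝ 2 φ) (q : ℕ)
    (z : Fin n → ℂ) : ℝ :=
  ⨅ J : MultiIdx n q, ∑ j ∈ J.1, (levi_isHermitian hφ z).eigenvalues j

/-- The measure `e^{-φ} dλ` on `ℂⁿ`. -/
def weightMeasure {n : ℕ} (φ : (Fin n → ℂ) → ℝ) : Measure (Fin n → ℂ) :=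
  volume.withDensity fun z => ENNReal.ofReal (Real.exp (-φ z))

/-- The Hilbert space `L²_{(0,q)}(ℂⁿ, φ)` of forms `u = ∑'_{|J| = q} u_J dz̄_J` with coefficients
`u_J` in `L²(ℂⁿ, φ)` and `‖u‖² = ∑'_J ∫ |u_J|² e^{-φ} dλ`. -/
abbrev L2Form {n : ℕ} (φ : (Fin n → ℂ) → ℝ) (q : ℕ) : Type :=
  PiLp 2 fun _ : MultiIdx n q => Lp ℂ 2 (weightMeasure φ)

/-! ### The maximal (distributional) `∂̄` operator -/

/-- The multi-index `L \ {j}`, for `j ∈ L`. -/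
def MultiIdx.erase {n p q : ℕ} (h : p + 1 = q) (L : MultiIdx n q) (j : L.1) : MultiIdx n p :=
  ⟨L.1.erase j, by rw [Finset.card_erase_of_mem j.2, L.2]; omega⟩

/-- The sign in `dz̄_j ∧ dz̄_{L \ {j}} = ± dz̄_L`: minus one to the number of elements of `L` that
are smaller than `j`. -/
def MultiIdx.sign {n q : ℕ} (L : MultiIdx n q) (j : L.1) : ℂ :=
  (-1) ^ (L.1.filter (· < j.1)).card

/-- `∂̄u = v` in the sense of distributions, for a `(0,p)`-form `u` and a `(0,p+1)`-form `v`. Since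
`∂̄u = ∑'_J ∑_j ∂u_J/∂z̄_j dz̄_j ∧ dz̄_J`, this says that for every `L` with `|L| = p + 1`
`v_L = ∑_{j ∈ L} ± ∂u_{L \ {j}}/∂z̄_j`, tested against `C_0^∞(ℂⁿ)`. -/
def IsWeakDbar {n : ℕ} (φ : (Fin n → ℂ) → ℝ) {p q : ℕ} (h : p + 1 = q)
    (u : L2Form φ p) (v : L2Form φ q) : Prop :=
  ∀ (L : MultiIdx n q) (χ : (Fin n → ℂ) → ℂ), ContDiff ℝ ∞ χ → HasCompactSupport χ →
    ∫ z, (v L : (Fin n → ℂ) → ℂ) z * χ z =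
      -∑ j : L.1, L.sign j * ∫ z, (u (L.erase h j) : (Fin n → ℂ) → ℂ) z * dzbar j.1 χ z

theorem integrable_mul_of_hasCompactSupport {n : ℕ} {φ : (Fin n → ℂ) → ℝ} (hφ : Continuous φ)
    (f : Lp ℂ 2 (weightMeasure φ)) {χ : (Fin n → ℂ) → ℂ} (hχ : Continuous χ)
    (hs : HasCompactSupport χ) :
    Integrable (fun z => (f : (Fin n → ℂ) → ℂ) z * χ z) := by
  have hm : Measurable fun z => Real.toNNReal (Real.exp (-φ z)) :=
    (Real.continuous_exp.comp hφ.neg).measurable.real_toNNReal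
  have hc : Continuous fun z => Real.toNNReal (Real.exp (-φ z)) :=
    continuous_real_toNNReal.comp (Real.continuous_exp.comp hφ.neg)
  have hw : weightMeasure φ =
      volume.withDensity fun z => ((Real.toNNReal (Real.exp (-φ z)) : NNReal) : ENNReal) := rfl
  have : IsLocallyFiniteMeasure (weightMeasure φ) := by
    rw [hw]; exact IsLocallyFiniteMeasure.withDensity_coe hc
  have hχ' : Continuous fun z => (Real.exp (φ z) : ℂ) * χ z := by fun_prop
  have h1 : MemLp (fun z => (Real.exp (φ z) : ℂ) * χ z) 2 (weightMeasure φ) :=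
    hχ'.memLp_of_hasCompactSupport hs.mul_left
  have h2 : Integrable (fun z => (f : (Fin n → ℂ) → ℂ) z * ((Real.exp (φ z) : ℂ) * χ z))
      (weightMeasure φ) := (Lp.memLp f).integrable_mul h1
  have h3 := (integrable_withDensity_iff_integrable_smul hm).1 h2
  refine h3.congr (Eventually.of_forall fun z => ?_)
  have he : ((Real.exp (-φ z) : ℝ) : ℂ) * ((Real.exp (φ z) : ℝ) : ℂ) = 1 := by
    rw [← Complex.ofReal_mul, ← Real.exp_add]; simp
  simp only [NNReal.smul_def, Real.coe_toNNReal _ (Real.exp_pos _).le, Complex.real_smul]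
  linear_combination (f : (Fin n → ℂ) → ℂ) z * χ z * he

theorem ae_volume_of_ae_weight {n : ℕ} {φ : (Fin n → ℂ) → ℝ} (hφ : Continuous φ)
    {P : (Fin n → ℂ) → Prop} (h : ∀ᵐ z ∂(weightMeasure φ), P z) : ∀ᵐ z, P z := by
  have hm : Measurable fun z => ENNReal.ofReal (Real.exp (-φ z)) :=
    (Real.continuous_exp.comp hφ.neg).measurable.ennreal_ofReal
  rw [weightMeasure, ae_withDensity_iff hm] at h
  filter_upwards [h] with z hz
  exact hz (by simp [Real.exp_pos])

theorem continuous_dzbar {n : ℕ} (j : Fin n) {χ : (Fin n → ℂ) → ℂ} (hχ : ContDiff ℝ ∞ χ) :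
    Continuous (dzbar j χ) := by
  have := hχ.continuous_fderiv (by simp)
  unfold dzbar
  fun_prop

theorem hasCompactSupport_dzbar {n : ℕ} (j : Fin n) {χ : (Fin n → ℂ) → ℂ}
    (hs : HasCompactSupport χ) : HasCompactSupport (dzbar j χ) := by
  refine (hs.fderiv ℝ).mono' (fun z hz => subset_closure ?_)
  intro h0
  apply hz
  simp [dzbar, h0]

theorem integral_zero_mul {n : ℕ} {φ : (Fin n → ℂ) → ℝ} (hφ : Continuous φ)
    (g : (Fin n → ℂ) → ℂ) :
    ∫ z, ((0 : Lp ℂ 2 (weightMeasure φ)) : (Fin n → ℂ) → ℂ) z * g z = 0 := by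
  refine integral_eq_zero_of_ae ?_
  filter_upwards [ae_volume_of_ae_weight hφ (Lp.coeFn_zero ℂ 2 (weightMeasure φ))] with z h
  simp only [h, Pi.zero_apply, zero_mul]

/-- The graph of the maximal `∂̄` operator from `(0,p)`-forms to `(0,p+1)`-forms. -/
def dbarGraph {n : ℕ} {φ : (Fin n → ℂ) → ℝ} (hφ : Continuous φ) {p q : ℕ} (h : p + 1 = q) :
    Submodule ℂ (L2Form φ p × L2Form φ q) where
  carrier := {x | IsWeakDbar φ h x.1 x.2}
  zero_mem' := by
    intro L χ _ _
    simp only [Prod.fst_zero, Prod.snd_zero, PiLp.zero_apply, integral_zero_mul hφ, mul_zero,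
      Finset.sum_const_zero, neg_zero]
  add_mem' := by
    intro x y hx hy L χ hχ hs
    have key : ∀ (f g : Lp ℂ 2 (weightMeasure φ)) {ψ : (Fin n → ℂ) → ℂ}, Continuous ψ →
        HasCompactSupport ψ → ∫ z, ((f + g : Lp ℂ 2 (weightMeasure φ)) : (Fin n → ℂ) → ℂ) z * ψ z
          = (∫ z, (f : (Fin n → ℂ) → ℂ) z * ψ z) + ∫ z, (g : (Fin n → ℂ) → ℂ) z * ψ z := by
      intro f g ψ hψ hψs
      rw [← integral_add (integrable_mul_of_hasCompactSupport hφ f hψ hψs)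
        (integrable_mul_of_hasCompactSupport hφ g hψ hψs)]
      refine integral_congr_ae ?_
      filter_upwards [ae_volume_of_ae_weight hφ (Lp.coeFn_add f g)] with z hz
      rw [hz, Pi.add_apply, add_mul]
    simp only [Prod.fst_add, Prod.snd_add, PiLp.add_apply]
    rw [key _ _ hχ.continuous hs, hx L χ hχ hs, hy L χ hχ hs, ← neg_add,
      ← Finset.sum_add_distrib]
    congr 1
    refine Finset.sum_congr rfl fun j _ => ?_
    rw [key _ _ (continuous_dzbar j.1 hχ) (hasCompactSupport_dzbar j.1 hs), mul_add]
  smul_mem' := by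
    intro c x hx L χ hχ hs
    have key : ∀ (f : Lp ℂ 2 (weightMeasure φ)) (ψ : (Fin n → ℂ) → ℂ),
        ∫ z, ((c • f : Lp ℂ 2 (weightMeasure φ)) : (Fin n → ℂ) → ℂ) z * ψ z
          = c * ∫ z, (f : (Fin n → ℂ) → ℂ) z * ψ z := by
      intro f ψ
      rw [← integral_const_mul]
      refine integral_congr_ae ?_
      filter_upwards [ae_volume_of_ae_weight hφ (Lp.coeFn_smul c f)] with z hz
      rw [hz, Pi.smul_apply, smul_eq_mul, mul_assoc]
    simp only [Prod.smul_fst, Prod.smul_snd, PiLp.smul_apply, key]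
    rw [hx L χ hχ hs, mul_neg, Finset.mul_sum]
    congr 1
    exact Finset.sum_congr rfl fun j _ => by ring

/-- The distributional `∂̄u` is unique, so that `dbarGraph` is the graph of an operator. -/
theorem dbarGraph_functional {n : ℕ} {φ : (Fin n → ℂ) → ℝ} (hφ : Continuous φ) {p q : ℕ}
    (h : p + 1 = q) (x : L2Form φ p × L2Form φ q) (hx : x ∈ dbarGraph hφ h) (hx0 : x.1 = 0) :
    x.2 = 0 := by
  have hx' : ((0 : L2Form φ p), x.2) ∈ dbarGraph hφ h := by rw [← hx0]; exact hx
  ext1 L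
  have hli : LocallyIntegrable (x.2 L : (Fin n → ℂ) → ℂ) volume := by
    rw [locallyIntegrable_iff]
    intro K hK
    obtain ⟨g, hg1, -, hgs, -⟩ := exists_continuous_one_zero_of_isCompact hK isClosed_empty
      (Set.disjoint_empty K)
    have hi := integrable_mul_of_hasCompactSupport hφ (x.2 L)
      (χ := fun z => ((g z : ℝ) : ℂ)) (by fun_prop) (hgs.comp_left (g := Complex.ofReal) (by simp))
    refine (hi.integrableOn (s := K)).congr_fun (fun z hzK => ?_) hK.measurableSet
    have : g z = 1 := hg1 hzK
    simp [this]
  have h0 : ∀ᵐ z, (x.2 L : (Fin n → ℂ) → ℂ) z = 0 := by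
    refine ae_eq_zero_of_integral_contDiff_smul_eq_zero hli fun g hg hgs => ?_
    have hgc : ContDiff ℝ ∞ fun z => ((g z : ℝ) : ℂ) := Complex.ofRealCLM.contDiff.comp hg
    have := hx' L (fun z => ((g z : ℝ) : ℂ)) hgc (hgs.comp_left (g := Complex.ofReal) (by simp))
    simp only [PiLp.zero_apply, integral_zero_mul hφ, mul_zero, Finset.sum_const_zero, neg_zero] at this
    rw [← this]
    refine integral_congr_ae (Eventually.of_forall fun z => ?_)
    simp [mul_comm]
  have hac : weightMeasure φ ≪ volume := withDensity_absolutelyContinuous _ _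
  rw [PiLp.zero_apply]
  exact (Lp.eq_zero_iff_ae_eq_zero).2 (hac.ae_le h0)

/-- The weighted `∂̄` operator `L²_{(0,p)}(ℂⁿ, φ) → L²_{(0,p+1)}(ℂⁿ, φ)`, with the maximal domain
of all `u` for which the distribution `∂̄u` has coefficients in `L²(ℂⁿ, φ)`. -/
def dbar {n : ℕ} {φ : (Fin n → ℂ) → ℝ} (hφ : Continuous φ) {p q : ℕ} (h : p + 1 = q) :
    L2Form φ p →ₗ.[ℂ] L2Form φ q :=
  (dbarGraph hφ h).toLinearPMap

theorem mem_graph_dbar {n : ℕ} {φ : (Fin n → ℂ) → ℝ} (hφ : Continuous φ) {p q : ℕ}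
    (h : p + 1 = q) (u : L2Form φ p) (v : L2Form φ q) :
    (u, v) ∈ (dbar hφ h).graph ↔ IsWeakDbar φ h u v := by
  rw [dbar, Submodule.toLinearPMap_graph_eq _ (dbarGraph_functional hφ h)]
  rfl

/-- The Hilbert space adjoint `∂̄*_φ` of the weighted `∂̄` operator. -/
def dbarStar {n : ℕ} {φ : (Fin n → ℂ) → ℝ} (hφ : Continuous φ) {p q : ℕ} (h : p + 1 = q) :
    L2Form φ q →ₗ.[ℂ] L2Form φ p :=
  (dbar hφ h).adjoint

/-! ### The complex Laplacian -/

/-- The composition `g ∘ f` of unbounded operators with its natural domain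
`{x ∈ dom f | f x ∈ dom g}`. -/
def pcomp {E F G : Type*} [AddCommGroup E] [Module ℂ E] [AddCommGroup F] [Module ℂ F]
    [AddCommGroup G] [Module ℂ G] (g : F →ₗ.[ℂ] G) (f : E →ₗ.[ℂ] F) : E →ₗ.[ℂ] G :=
  g.comp (f.domRestrict ((g.domain.comap f.toFun).map f.domain.subtype)) (by
    rintro ⟨x, hx⟩
    obtain ⟨⟨y, hy, hyx⟩, hxf⟩ := hx
    obtain rfl : y = ⟨x, hxf⟩ := Subtype.ext hyx
    exact hy)

theorem mem_graph_pcomp {E F G : Type*} [AddCommGroup E] [Module ℂ E] [AddCommGroup F]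
    [Module ℂ F] [AddCommGroup G] [Module ℂ G] (g : F →ₗ.[ℂ] G) (f : E →ₗ.[ℂ] F) (x : E) (w : G) :
    (x, w) ∈ (pcomp g f).graph ↔ ∃ y, (x, y) ∈ f.graph ∧ (y, w) ∈ g.graph := by
  simp only [LinearPMap.mem_graph_iff]
  constructor
  · rintro ⟨⟨_, ⟨y, hy, rfl⟩, hf⟩, rfl, rfl⟩
    exact ⟨f y, ⟨y, rfl, rfl⟩, ⟨⟨f y, hy⟩, rfl, rfl⟩⟩
  · rintro ⟨_, ⟨y, rfl, rfl⟩, ⟨t, ht, rfl⟩⟩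
    have hy : f y ∈ g.domain := ht ▸ t.2
    refine ⟨⟨y, ⟨y, hy, rfl⟩, y.2⟩, rfl, ?_⟩
    obtain rfl : t = ⟨f y, hy⟩ := Subtype.ext ht
    rfl

/-- The complex Laplacian `□_φ = ∂̄ ∂̄*_φ + ∂̄*_φ ∂̄` on `(0,q)`-forms, `q ≥ 1`, as an unbounded
operator on `L²_{(0,q)}(ℂⁿ, φ)`. Its domain consists of all `u ∈ dom ∂̄ ∩ dom ∂̄*_φ` such that
`∂̄u ∈ dom ∂̄*_φ` and `∂̄*_φ u ∈ dom ∂̄`. -/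
def box {n : ℕ} {φ : (Fin n → ℂ) → ℝ} (hφ : Continuous φ) {q : ℕ} (hq : 1 ≤ q) :
    L2Form φ q →ₗ.[ℂ] L2Form φ q :=
  pcomp (dbar hφ (Nat.sub_add_cancel hq)) (dbarStar hφ (Nat.sub_add_cancel hq)) +
    pcomp (dbarStar hφ (rfl : q + 1 = q + 1)) (dbar hφ rfl)

end

end WeightedDbar

/-!
The complex Laplacian is `T T* + S* S`, where `T` and `S` are `∂̄` on forms of degree `q - 1` and
`q`: closed, densely defined operators with `S T = 0`. Such an operator has a unique bounded right
inverse as soon as `‖u‖² ≤ C (‖S u‖² + ‖T* u‖²)` on `dom S ∩ dom T*` (`existsUnique_inverse`): the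
Riesz representation theorem on `dom S ∩ dom T*` with the graph norm gives a weak solution, and
splitting test forms along `ker S` shows that it is a strong one. Everything else is the proof of
this a priori estimate.

For smooth forms with compact support the Kohn–Morrey formula (`kohn_morrey`) reads
`∑_{J,j} ‖∂̄_j u_J‖² + ∫ ∑_K ∑_{j,k} φ_{jk̄} u_{jK} ū_{kK} e^{-φ} = ‖∂̄u‖² + ‖∂̄*_φ u‖²`.
It combines the commutator of `∂̄_k` with its formal adjoint, which is an entry of the Levi matrix,
and the relation between wedge products and contractions (`sum_wedgeSum_mul_conj_add`). The Levi
form on `(0,q)`-forms is at least `s_q |u|²` (`sum_eigenvalues_le_form`), and `s_q ≥ 0` because `φ` is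
plurisubharmonic (`levi_posSemidef`). Since `s_q ≥ c > 0` outside some ball, the formula controls `u`
outside the ball, and also all `∂̄_j u_J`. Inside the ball `u_J` is recovered from a single `∂̄_j u_J`
and from `u_J` outside (`exists_interior_estimate`): in the weight `-|z_j|²` the commutator has the
favourable sign, and the weights are comparable on the support of a cutoff function. This avoids any
compactness argument, and gives `exists_smooth_estimate`.

The estimate passes to compactly supported `L²` forms by mollification, where the commutator with
the zeroth order term of `∂̄*_φ` tends to zero (`weak_estimate_of_compact_support`), and then to all
forms by cutoff functions with bounded derivatives (`weak_estimate`). It applies to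
`dom ∂̄ ∩ dom ∂̄*_φ` because the Hilbert space adjoint acts as the formal adjoint in the sense of
distributions (`weakDbarStarEq_coeff`).
-/

namespace WeightedDbar

noncomputable section

/-! ### The abstract inverse of `T T* + S* S` -/

universe u v w

section Abstract

variable {E F G : Type*}
  [NormedAddCommGroup E] [InnerProductSpace ℂ E] [CompleteSpace E]
  [NormedAddCommGroup F] [InnerProductSpace ℂ F] [CompleteSpace F]
  [NormedAddCommGroup G] [InnerProductSpace ℂ G] [CompleteSpace G]

/-- For a densely defined `T`, the graph of the adjoint, in terms of the graph of `T`. -/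
theorem mem_graph_adjoint_iff {F : Type*} [NormedAddCommGroup F] [InnerProductSpace ℂ F]
    {T : E →ₗ.[ℂ] F} (hT : Dense (T.domain : Set E)) (y : F) (x : E) :
    (y, x) ∈ T.adjoint.graph ↔ ∀ a b, (a, b) ∈ T.graph → inner ℂ b y = inner ℂ a x := by
  rw [LinearPMap.adjoint_graph_eq_graph_adjoint hT, Submodule.mem_adjoint_iff]
  simp only [sub_eq_zero]

/-- A closed operator contains its second adjoint. -/
theorem mem_graph_of_forall_adjoint {T : E →ₗ.[ℂ] F} (hT : Dense (T.domain : Set E))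
    (hc : T.IsClosed) {x : E} {y : F}
    (h : ∀ a b, (a, b) ∈ T.adjoint.graph → inner ℂ b x = inner ℂ a y) : (x, y) ∈ T.graph := by
  let e : WithLp 2 (E × F) ≃L[ℂ] E × F := WithLp.prodContinuousLinearEquiv 2 ℂ E F
  let K : Submodule ℂ (WithLp 2 (E × F)) := T.graph.comap (e : WithLp 2 (E × F) →ₗ[ℂ] E × F)
  have hK : _root_.IsClosed (K : Set (WithLp 2 (E × F))) :=
    (show _root_.IsClosed (T.graph : Set (E × F)) from hc).preimage e.continuous
  have hKK : Kᗮᗮ = K := by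
    have : CompleteSpace K := hK.completeSpace_coe
    exact Submodule.orthogonal_orthogonal K
  suffices h' : WithLp.toLp 2 (x, y) ∈ Kᗮᗮ by
    rw [hKK] at h'
    exact h'
  rw [Submodule.mem_orthogonal]
  intro w hw
  rw [Submodule.mem_orthogonal] at hw
  -- The orthogonal complement of the graph of `T` is the rotated graph of `T*`.
  have hg : (w.snd, -w.fst) ∈ T.adjoint.graph := by
    rw [mem_graph_adjoint_iff hT]
    intro a b hab
    have h1 := hw (WithLp.toLp 2 (a, b)) hab
    rw [WithLp.prod_inner_apply] at h1
    rw [inner_neg_right]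
    exact eq_neg_of_add_eq_zero_right h1
  have h2 := h _ _ hg
  rw [WithLp.prod_inner_apply]
  rw [inner_neg_left] at h2
  change inner ℂ w.fst x + inner ℂ w.snd y = 0
  rw [← h2, add_neg_cancel]

/-- The sum of three Hilbert spaces, presented by its coordinate projections. -/
theorem exists_hilbert_sum (E : Type u) (F : Type v) (G : Type w)
    [NormedAddCommGroup E] [InnerProductSpace ℂ E] [CompleteSpace E]
    [NormedAddCommGroup F] [InnerProductSpace ℂ F] [CompleteSpace F]
    [NormedAddCommGroup G] [InnerProductSpace ℂ G] [CompleteSpace G] :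
    ∃ (X : Type (max v w u)) (_ : NormedAddCommGroup X) (_ : InnerProductSpace ℂ X)
      (_ : CompleteSpace X) (p₁ : X →L[ℂ] F) (p₂ : X →L[ℂ] G) (p₃ : X →L[ℂ] E),
      (∀ x, ‖x‖ ^ 2 = ‖p₁ x‖ ^ 2 + (‖p₂ x‖ ^ 2 + ‖p₃ x‖ ^ 2)) ∧
      ∀ a b c, ∃ x, p₁ x = a ∧ p₂ x = b ∧ p₃ x = c := by
  let e := WithLp.prodContinuousLinearEquiv 2 ℂ F (WithLp 2 (G × E))
  let e' := WithLp.prodContinuousLinearEquiv 2 ℂ G E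
  refine ⟨WithLp 2 (F × WithLp 2 (G × E)), inferInstance, inferInstance, inferInstance,
    (ContinuousLinearMap.fst ℂ F (WithLp 2 (G × E))).comp e.toContinuousLinearMap,
    (ContinuousLinearMap.fst ℂ G E).comp (e'.toContinuousLinearMap.comp
      ((ContinuousLinearMap.snd ℂ F (WithLp 2 (G × E))).comp e.toContinuousLinearMap)),
    (ContinuousLinearMap.snd ℂ G E).comp (e'.toContinuousLinearMap.comp
      ((ContinuousLinearMap.snd ℂ F (WithLp 2 (G × E))).comp e.toContinuousLinearMap)),
    fun x => ?_, fun a b c => ⟨WithLp.toLp 2 (a, WithLp.toLp 2 (b, c)), rfl, rfl, rfl⟩⟩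
  rw [WithLp.prod_norm_sq_eq_of_L2, WithLp.prod_norm_sq_eq_of_L2 x.snd]
  rfl

/-- Lax–Milgram for the form `⟨p₂ y, p₂ x⟩ + ⟨p₃ y, p₃ x⟩`, which is coercive for the norm
`‖x‖² = ‖p₁ x‖² + ‖p₂ x‖² + ‖p₃ x‖²`. -/
theorem exists_riesz_operator {V : Type*} [NormedAddCommGroup V] [InnerProductSpace ℂ V]
    [CompleteSpace V] (p₁ : V →L[ℂ] F) (p₂ : V →L[ℂ] G) (p₃ : V →L[ℂ] E) {C : ℝ} (hC : 0 < C)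
    (hn : ∀ x, ‖x‖ ^ 2 = ‖p₁ x‖ ^ 2 + (‖p₂ x‖ ^ 2 + ‖p₃ x‖ ^ 2))
    (hest : ∀ x, ‖p₁ x‖ ^ 2 ≤ C * (‖p₂ x‖ ^ 2 + ‖p₃ x‖ ^ 2)) :
    ∃ N : F →L[ℂ] F, ∀ f, ∃ x : V, p₁ x = N f ∧
      ∀ y : V, inner ℂ (p₂ y) (p₂ x) + inner ℂ (p₃ y) (p₃ x) = inner ℂ (p₁ y) f := by
  have hA : ∀ y x : V, inner ℂ y ((p₂.adjoint.comp p₂ + p₃.adjoint.comp p₃) x) =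
      inner ℂ (p₂ y) (p₂ x) + inner ℂ (p₃ y) (p₃ x) := fun y x => by
    rw [add_apply, inner_add_right, ContinuousLinearMap.comp_apply,
      ContinuousLinearMap.comp_apply, ContinuousLinearMap.adjoint_inner_right,
      ContinuousLinearMap.adjoint_inner_right]
  have hunit : IsUnit (p₂.adjoint.comp p₂ + p₃.adjoint.comp p₃) := by
    have hC1 : 0 < (1 + C)⁻¹ := by positivity
    refine ContinuousLinearMap.isUnit_of_forall_le_norm_inner_map _
      (c := ⟨(1 + C)⁻¹, hC1.le⟩) hC1 fun x => ?_
    rw [norm_inner_symm, hA, inner_self_eq_norm_sq_to_K, inner_self_eq_norm_sq_to_K]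
    have h1 : (((‖p₂ x‖ : ℝ) : ℂ) ^ 2 + ((‖p₃ x‖ : ℝ) : ℂ) ^ 2) =
        ((‖p₂ x‖ ^ 2 + ‖p₃ x‖ ^ 2 : ℝ) : ℂ) := by push_cast; rfl
    simp only [Complex.coe_algebraMap]
    rw [h1, Complex.norm_real, Real.norm_of_nonneg (by positivity)]
    change ‖x‖ ^ 2 * (1 + C)⁻¹ ≤ _
    rw [mul_inv_le_iff₀ (by positivity), hn]
    have := hest x
    linarith
  obtain ⟨B, hB⟩ := hunit.exists_right_inv
  refine ⟨(p₁.comp B).comp p₁.adjoint, fun f => ⟨B (p₁.adjoint f), rfl, fun y => ?_⟩⟩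
  rw [← hA, ← ContinuousLinearMap.adjoint_inner_right]
  congr 1
  exact congrArg (fun A : V →L[ℂ] V => A (p₁.adjoint f)) hB

/-- The weak solution operator, obtained on the Hilbert space `dom S ∩ dom T*` with its graph
norm. -/
theorem exists_weak_solution_operator {T : E →ₗ.[ℂ] F} {S : F →ₗ.[ℂ] G}
    (hT : Dense (T.domain : Set E)) (hSc : S.IsClosed) {C : ℝ} (hC : 0 < C)
    (hest : ∀ u a b, (u, a) ∈ S.graph → (u, b) ∈ T.adjoint.graph →
      ‖u‖ ^ 2 ≤ C * (‖a‖ ^ 2 + ‖b‖ ^ 2)) :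
    ∃ N : F →L[ℂ] F, ∀ f, ∃ a b, (N f, a) ∈ S.graph ∧ (N f, b) ∈ T.adjoint.graph ∧
      ∀ v a' b', (v, a') ∈ S.graph → (v, b') ∈ T.adjoint.graph →
        inner ℂ a' a + inner ℂ b' b = inner ℂ v f := by
  obtain ⟨X, _, _, _, p₁, p₂, p₃, hn, hsurj⟩ := exists_hilbert_sum E F G
  let V : Submodule ℂ X := (S.graph.comap (p₁.prod p₂).toLinearMap) ⊓
    (T.adjoint.graph.comap (p₁.prod p₃).toLinearMap)
  have hV : _root_.IsClosed (V : Set X) := by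
    refine IsClosed.inter ?_ ?_
    · exact (show _root_.IsClosed (S.graph : Set (F × G)) from hSc).preimage
        (p₁.prod p₂).continuous
    · exact (show _root_.IsClosed (T.adjoint.graph : Set (F × E)) from
        LinearPMap.adjoint_isClosed hT).preimage (p₁.prod p₃).continuous
  have : CompleteSpace V := hV.completeSpace_coe
  obtain ⟨N, hN⟩ := exists_riesz_operator (p₁.comp V.subtypeL) (p₂.comp V.subtypeL)
    (p₃.comp V.subtypeL) hC (fun x => hn x) (fun x => hest _ _ _ x.2.1 x.2.2)
  refine ⟨N, fun f => ?_⟩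
  obtain ⟨x, hx, h⟩ := hN f
  rw [← hx]
  refine ⟨p₂ x, p₃ x, x.2.1, x.2.2, fun v a' b' hva hvb => ?_⟩
  obtain ⟨y, rfl, rfl, rfl⟩ := hsurj v a' b'
  exact h ⟨y, hva, hvb⟩

/-- If `T` and `S` are closed and densely defined with `S T = 0`, then the a priori estimate makes
`T T* + S* S` uniquely right invertible by a bounded operator. A weak solution is a strong one
because every `w` splits as `w₁ + w₂` with `w₁ ∈ ker S` and `w₂ ⊥ ker S`, hence `w₂ ∈ ker T*`. -/
theorem existsUnique_inverse {T : E →ₗ.[ℂ] F} {S : F →ₗ.[ℂ] G}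
    (hT : Dense (T.domain : Set E)) (hTc : T.IsClosed)
    (hS : Dense (S.domain : Set F)) (hSc : S.IsClosed)
    (hST : ∀ x y, (x, y) ∈ T.graph → (y, (0 : G)) ∈ S.graph) {C : ℝ} (hC : 0 < C)
    (hest : ∀ u a b, (u, a) ∈ S.graph → (u, b) ∈ T.adjoint.graph →
      ‖u‖ ^ 2 ≤ C * (‖a‖ ^ 2 + ‖b‖ ^ 2)) :
    ∃! N : F →L[ℂ] F, ∀ f, ∃ h : N f ∈ (pcomp T T.adjoint + pcomp S.adjoint S).domain,
      (pcomp T T.adjoint + pcomp S.adjoint S) ⟨N f, h⟩ = f := by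
  have hbox : ∀ u f, (∃ h : u ∈ (pcomp T T.adjoint + pcomp S.adjoint S).domain,
      (pcomp T T.adjoint + pcomp S.adjoint S) ⟨u, h⟩ = f) ↔
      ∃ a b c d, (u, b) ∈ T.adjoint.graph ∧ (b, c) ∈ T.graph ∧ (u, a) ∈ S.graph ∧
        (a, d) ∈ S.adjoint.graph ∧ c + d = f := by
    intro u f
    constructor
    · rintro ⟨h, hf⟩
      have h1 : (u, pcomp T T.adjoint ⟨u, h.1⟩) ∈ (pcomp T T.adjoint).graph :=
        LinearPMap.mem_graph _ ⟨u, h.1⟩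
      have h2 : (u, pcomp S.adjoint S ⟨u, h.2⟩) ∈ (pcomp S.adjoint S).graph :=
        LinearPMap.mem_graph _ ⟨u, h.2⟩
      obtain ⟨b, hb1, hb2⟩ := (mem_graph_pcomp _ _ _ _).1 h1
      obtain ⟨a, ha1, ha2⟩ := (mem_graph_pcomp _ _ _ _).1 h2
      exact ⟨a, b, _, _, hb1, hb2, ha1, ha2, hf⟩
    · rintro ⟨a, b, c, d, hb1, hb2, ha1, ha2, hf⟩
      have h1 : (u, c) ∈ (pcomp T T.adjoint).graph := (mem_graph_pcomp _ _ _ _).2 ⟨b, hb1, hb2⟩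
      have h2 : (u, d) ∈ (pcomp S.adjoint S).graph := (mem_graph_pcomp _ _ _ _).2 ⟨a, ha1, ha2⟩
      rw [LinearPMap.mem_graph_iff] at h1 h2
      obtain ⟨⟨u1, hu1⟩, rfl, rfl⟩ := h1
      obtain ⟨⟨u2, hu2⟩, h21, rfl⟩ := h2
      obtain rfl : u2 = u1 := h21
      exact ⟨⟨hu1, hu2⟩, hf⟩
  simp only [hbox]
  -- `T T* + S* S` is injective.
  have hinj : ∀ u a b c d, (u, b) ∈ T.adjoint.graph → (b, c) ∈ T.graph → (u, a) ∈ S.graph →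
      (a, d) ∈ S.adjoint.graph → c + d = 0 → u = 0 := by
    intro u a b c d hb1 hb2 ha1 ha2 h0
    have h1 := (mem_graph_adjoint_iff hT _ _).1 hb1 _ _ hb2
    have h2 := (mem_graph_adjoint_iff hS _ _).1 ha2 _ _ ha1
    have h3 : inner ℂ u (c + d) = inner ℂ a a + inner ℂ b b := by
      rw [inner_add_right, ← h2, ← inner_conj_symm u c, h1, inner_conj_symm, add_comm]
    rw [h0, inner_zero_right, inner_self_eq_norm_sq_to_K, inner_self_eq_norm_sq_to_K] at h3
    have h4 : ‖a‖ ^ 2 + ‖b‖ ^ 2 = 0 := by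
      have := h3.symm
      simp only [Complex.coe_algebraMap] at this
      exact_mod_cast this
    have h5 := hest u a b ha1 hb1
    rw [h4, mul_zero] at h5
    exact norm_eq_zero.1 (pow_eq_zero_iff (two_ne_zero)|>.1 (le_antisymm h5 (by positivity)))
  refine existsUnique_of_exists_of_unique ?_ ?_
  swap
  · intro N₁ N₂ h₁ h₂
    ext f
    obtain ⟨a, b, c, d, k1, k2, k3, k4, k5⟩ := h₁ f
    obtain ⟨a', b', c', d', l1, l2, l3, l4, l5⟩ := h₂ f
    refine sub_eq_zero.1 (hinj _ (a - a') (b - b') (c - c') (d - d') (Submodule.sub_mem _ k1 l1)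
      (Submodule.sub_mem _ k2 l2) (Submodule.sub_mem _ k3 l3) (Submodule.sub_mem _ k4 l4) ?_)
    rw [sub_add_sub_comm, k5, l5, sub_self]
  obtain ⟨N, hN⟩ := exists_weak_solution_operator hT hSc hC hest
  refine ⟨N, fun f => ?_⟩
  obtain ⟨a, b, hNa, hNb, hw⟩ := hN f
  -- `K = ker S`.
  let K : Submodule ℂ F := S.graph.comap (LinearMap.inl ℂ F G)
  have hKc : _root_.IsClosed (K : Set F) :=
    (show _root_.IsClosed (S.graph : Set (F × G)) from hSc).preimage
      (Continuous.prodMk continuous_id continuous_const)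
  have : CompleteSpace K := hKc.completeSpace_coe
  have hK : ∀ w ∈ K, (w, (0 : G)) ∈ S.graph := fun w h => h
  have hKo : ∀ w ∈ Kᗮ, (w, (0 : E)) ∈ T.adjoint.graph := by
    intro w h
    rw [mem_graph_adjoint_iff hT]
    intro x y hxy
    rw [inner_zero_right]
    exact (Submodule.mem_orthogonal _ _).1 h y (hST x y hxy)
  let P := K.starProjection
  have hP1 : ∀ w, P w ∈ K := fun w => K.starProjection_apply_mem w
  have hP2 : ∀ w, w - P w ∈ Kᗮ := fun w => K.sub_starProjection_mem_orthogonal w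
  have hPs : ∀ w, inner ℂ (P w) f = inner ℂ w (P f) := fun w =>
    Submodule.inner_starProjection_left_eq_right K w f
  refine ⟨a, b, P f, f - P f, hNb, ?_, hNa, ?_, by abel⟩
  · refine mem_graph_of_forall_adjoint hT hTc fun w c hwc => ?_
    have h1 : (P w, c) ∈ T.adjoint.graph := by
      have := Submodule.sub_mem _ hwc (hKo _ (hP2 w))
      simpa using this
    have h2 := hw _ _ _ (hK _ (hP1 w)) h1
    rw [inner_zero_left, zero_add, hPs] at h2
    exact h2
  · rw [mem_graph_adjoint_iff hS]
    intro w c hwc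
    have h1 : (w - P w, c) ∈ S.graph := by
      have := Submodule.sub_mem _ hwc (hK _ (hP1 w))
      simpa using this
    have h2 := hw _ _ _ h1 (hKo _ (hP2 w))
    rw [inner_zero_left, add_zero, inner_sub_left, hPs] at h2
    rw [h2, inner_sub_right]

end Abstract

/-! ### Exterior algebra in coordinates -/

section Combinatorics

open Finset
open scoped ComplexConjugate

variable {ι : Type*} [LinearOrder ι] [Fintype ι]

/-- The sign with `e_j ∧ e_{L \ {j}} = sgn L j • e_L`. It does not depend on whether `j ∈ L`. -/
def sgn (L : Finset ι) (j : ι) : ℂ := (-1) ^ #{i ∈ L | i < j}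

/-- The coefficients of `∑_j e_j ∧ a_j`. A form of mixed degree is recorded by its coefficients,
which are indexed by all finite subsets. -/
def wedgeSum (a : ι → Finset ι → ℂ) (L : Finset ι) : ℂ :=
  ∑ j ∈ L, sgn L j * a j (L.erase j)

/-- The coefficients of `∑_j e_j ⌟ a_j`. -/
def contrSum (a : ι → Finset ι → ℂ) (K : Finset ι) : ℂ :=
  ∑ j ∈ Kᶜ, sgn K j * a j (insert j K)

omit [Fintype ι] in
theorem conj_sgn (L : Finset ι) (j : ι) : conj (sgn L j) = sgn L j := by
  simp [sgn]

omit [Fintype ι] in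
theorem sgn_mul_self (L : Finset ι) (j : ι) : sgn L j * sgn L j = 1 := by
  rw [sgn, ← mul_pow]; simp

omit [Fintype ι] in
theorem norm_sgn (L : Finset ι) (j : ι) : ‖sgn L j‖ = 1 := by simp [sgn]

omit [Fintype ι] in
theorem sgn_insert_self (K : Finset ι) (j : ι) : sgn (insert j K) j = sgn K j := by
  simp [sgn, filter_insert]

omit [Fintype ι] in
theorem sgn_insert_of_lt {K : Finset ι} {i j : ι} (hi : i ∉ K) (h : i < j) :
    sgn (insert i K) j = -sgn K j := by
  rw [sgn, sgn, filter_insert, if_pos h, card_insert_of_notMem (by simp [hi]), pow_succ]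
  ring

omit [Fintype ι] in
theorem sgn_insert_of_gt {K : Finset ι} {i j : ι} (h : j < i) :
    sgn (insert i K) j = sgn K j := by
  rw [sgn, sgn, filter_insert, if_neg h.not_gt]

omit [Fintype ι] in
/-- The sign rule behind `e_j ∧ (e_k ⌟ u) = -e_k ⌟ (e_j ∧ u)` for `j ≠ k`. -/
theorem sgn_insert_insert {K : Finset ι} {j k : ι} (hj : j ∉ K) (hk : k ∉ K) (h : j ≠ k) :
    sgn (insert j (insert k K)) j * sgn (insert j (insert k K)) k = -(sgn K j * sgn K k) := by
  rw [sgn_insert_self, insert_comm, sgn_insert_self]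
  rcases h.lt_or_gt with h | h
  · rw [sgn_insert_of_gt h, sgn_insert_of_lt hj h]; ring
  · rw [sgn_insert_of_lt hk h, sgn_insert_of_gt h]; ring

/-- Reindexing of `(L, j)` with `j ∈ L` as `(K, j)` with `j ∉ K`, where `L = K ∪ {j}`. -/
theorem sum_filter_mem_eq {M : Type*} [AddCommMonoid M] (j : ι) (f : Finset ι → M) :
    ∑ L with j ∈ L, f L = ∑ K with j ∉ K, f (insert j K) := by
  refine sum_nbij' (fun L => L.erase j) (fun K => insert j K) ?_ ?_ ?_ ?_ ?_
  · intro L _; simp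
  · intro K _; simp
  · intro L hL; exact insert_erase (by simpa using hL)
  · intro K hK; exact erase_insert (by simpa using hK)
  · intro L hL; rw [insert_erase (by simpa using hL)]

theorem sum_filter_mem_mem_eq {M : Type*} [AddCommMonoid M] {j k : ι} (hjk : j ≠ k)
    (f : Finset ι → M) :
    ∑ L with j ∈ L ∧ k ∈ L, f L = ∑ K with j ∉ K ∧ k ∉ K, f (insert j (insert k K)) := by
  refine sum_nbij' (fun L => (L.erase j).erase k) (fun K => insert j (insert k K)) ?_ ?_ ?_ ?_ ?_
  · intro L _; simp
  · intro K _; simp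
  · intro L hL
    simp only [mem_filter, mem_univ, true_and] at hL
    rw [insert_erase (mem_erase.2 ⟨hjk.symm, hL.2⟩), insert_erase hL.1]
  · intro K hK
    simp only [mem_filter, mem_univ, true_and] at hK
    rw [erase_insert (by simp [hjk, hK.1]), erase_insert hK.2]
  · intro L hL
    simp only [mem_filter, mem_univ, true_and] at hL
    rw [insert_erase (mem_erase.2 ⟨hjk.symm, hL.2⟩), insert_erase hL.1]

theorem sum_sum_compl_comm {M : Type*} [AddCommMonoid M] (f : ι → Finset ι → M) :
    ∑ K : Finset ι, ∑ j ∈ Kᶜ, f j K = ∑ j, ∑ K with j ∉ K, f j K := by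
  refine sum_comm' fun K j => ?_
  simp

theorem sum_sum_mem_comm {M : Type*} [AddCommMonoid M] (f : ι → Finset ι → M) :
    ∑ L : Finset ι, ∑ j ∈ L, f j L = ∑ j, ∑ L with j ∈ L, f j L := by
  refine sum_comm' fun K j => ?_
  simp

/-- The coordinate form of the commutation relation
`(e_j ∧ ·)(e_k ⌟ ·) + (e_k ⌟ ·)(e_j ∧ ·) = δ_{jk}`. Applied to `a_j = ∂̄_j u` it is the algebra of
the Kohn–Morrey formula; applied to `a_j = w_j u` it is
`|w ∧ u|² + |w̄ ⌟ u|² = |w|² |u|²`. -/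
theorem sum_wedgeSum_mul_conj_add (a : ι → Finset ι → ℂ) :
    ∑ L, wedgeSum a L * conj (wedgeSum a L) +
      ∑ K : Finset ι, ∑ j ∈ Kᶜ, ∑ k ∈ Kᶜ,
        sgn K j * sgn K k * (a k (insert j K) * conj (a j (insert k K))) =
    ∑ J, ∑ j, a j J * conj (a j J) := by
  have h1 : ∑ L, wedgeSum a L * conj (wedgeSum a L) = ∑ j, ∑ k, ∑ L with j ∈ L ∧ k ∈ L,
      sgn L j * sgn L k * (a j (L.erase j) * conj (a k (L.erase k))) := by
    have : ∀ L : Finset ι, wedgeSum a L * conj (wedgeSum a L) = ∑ j ∈ L, ∑ k ∈ L,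
        sgn L j * sgn L k * (a j (L.erase j) * conj (a k (L.erase k))) := by
      intro L
      simp only [wedgeSum, map_sum, sum_mul_sum, map_mul, conj_sgn]
      refine sum_congr rfl fun j _ => sum_congr rfl fun k _ => by ring
    simp only [this]
    rw [sum_sum_mem_comm]
    refine sum_congr rfl fun j _ => ?_
    refine sum_comm' fun K k => ?_
    simp [and_comm]
  have h2 : ∑ K : Finset ι, ∑ j ∈ Kᶜ, ∑ k ∈ Kᶜ,
        sgn K j * sgn K k * (a k (insert j K) * conj (a j (insert k K))) =
      ∑ j, ∑ k, ∑ K with j ∉ K ∧ k ∉ K,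
        sgn K k * sgn K j * (a j (insert k K) * conj (a k (insert j K))) := by
    rw [sum_sum_compl_comm (fun j K => ∑ k ∈ Kᶜ,
        sgn K j * sgn K k * (a k (insert j K) * conj (a j (insert k K)))),
      sum_comm (γ := ι)]
    refine sum_congr rfl fun k _ => sum_comm' fun K j => ?_
    simp [and_comm]
  rw [h1, h2, ← sum_add_distrib, sum_comm (γ := Finset ι)]
  refine sum_congr rfl fun j _ => ?_
  rw [← sum_add_distrib]
  -- For `k ≠ j` the two inner sums cancel; for `k = j` they add up to the sum over all `J`.
  rw [sum_eq_single j]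
  · simp only [and_self]
    rw [sum_filter_mem_eq j, ← sum_filter_add_sum_filter_not univ (fun J => j ∈ J)
      (fun J => a j J * conj (a j J)), sum_filter_mem_eq j (fun J => a j J * conj (a j J)),
      add_comm]
    congr 1
    · refine sum_congr rfl fun K _ => ?_
      rw [sgn_mul_self, one_mul]
    · refine sum_congr rfl fun K hK => ?_
      rw [sgn_mul_self, one_mul, erase_insert (by simpa using hK)]
  · intro k _ hkj
    rw [sum_filter_mem_mem_eq hkj.symm, ← sum_add_distrib]
    refine sum_eq_zero fun K hK => ?_
    simp only [mem_filter, mem_univ, true_and] at hK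
    have e1 : (insert j (insert k K)).erase j = insert k K :=
      erase_insert (by simp [hkj.symm, hK.1])
    have e2 : (insert j (insert k K)).erase k = insert j K := by
      rw [insert_comm]; exact erase_insert (by simp [hkj, hK.2])
    rw [e1, e2, sgn_insert_insert hK.1 hK.2 hkj.symm]
    ring
  · simp

/-- Contraction with a vector `w` has operator norm at most `|w|`. -/
theorem sum_normSq_contrSum_le (w : ι → ℂ) (u : Finset ι → ℂ) :
    ∑ K, ‖contrSum (fun j J => w j * u J) K‖ ^ 2 ≤ (∑ j, ‖w j‖ ^ 2) * ∑ J, ‖u J‖ ^ 2 := by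
  have h := sum_wedgeSum_mul_conj_add (fun j J => conj (w j) * u J)
  have h2 : ∀ K : Finset ι, ∑ j ∈ Kᶜ, ∑ k ∈ Kᶜ, sgn K j * sgn K k *
      (conj (w k) * u (insert j K) * conj (conj (w j) * u (insert k K))) =
      contrSum (fun j J => w j * u J) K * conj (contrSum (fun j J => w j * u J) K) := by
    intro K
    simp only [contrSum, map_sum, sum_mul_sum, map_mul, conj_sgn, Complex.conj_conj]
    refine sum_congr rfl fun j _ => sum_congr rfl fun k _ => by ring
  have h3 : ∑ J : Finset ι, ∑ j, conj (w j) * u J * conj (conj (w j) * u J) =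
      (((∑ j, ‖w j‖ ^ 2) * ∑ J, ‖u J‖ ^ 2 : ℝ) : ℂ) := by
    push_cast
    rw [sum_mul_sum, sum_comm]
    refine sum_congr rfl fun j _ => sum_congr rfl fun J _ => ?_
    rw [Complex.mul_conj']
    simp [mul_pow]
  rw [h3] at h
  simp only [h2, Complex.mul_conj'] at h
  have h4 : ∑ L, ‖wedgeSum (fun j J => conj (w j) * u J) L‖ ^ 2 +
      ∑ K, ‖contrSum (fun j J => w j * u J) K‖ ^ 2 =
      (∑ j, ‖w j‖ ^ 2) * ∑ J, ‖u J‖ ^ 2 := by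
    exact_mod_cast h
  have h5 : 0 ≤ ∑ L, ‖wedgeSum (fun j J => conj (w j) * u J) L‖ ^ 2 :=
    sum_nonneg fun _ _ => by positivity
  linarith

/-- A linear programming bound: a weighted sum with weights in `[0, m]` of total mass `q m` is at
least `m` times the sum of the `q` smallest terms. -/
theorem iInf_sum_mul_le {q : ℕ} (hq : 1 ≤ q) (lam c : ι → ℝ) {m : ℝ} (hc0 : ∀ i, 0 ≤ c i)
    (hcm : ∀ i, c i ≤ m) (hsum : ∑ i, c i = q * m) (hcard : q ≤ Fintype.card ι) :
    (⨅ J : {J : Finset ι // #J = q}, ∑ j ∈ J.1, lam j) * m ≤ ∑ i, lam i * c i := by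
  have hne : Nonempty {J : Finset ι // #J = q} := by
    obtain ⟨J, _, hJ⟩ := exists_subset_card_eq (s := (univ : Finset ι)) (n := q)
      (by rwa [card_univ])
    exact ⟨⟨J, hJ⟩⟩
  obtain ⟨J, hJ⟩ := exists_eq_ciInf_of_finite
    (f := fun J : {J : Finset ι // #J = q} => ∑ j ∈ J.1, lam j)
  have hmin : ∀ J' : Finset ι, #J' = q → ∑ j ∈ J.1, lam j ≤ ∑ j ∈ J', lam j := by
    intro J' hJ'
    rw [hJ]
    exact ciInf_le (Set.finite_range _).bddBelow (⟨J', hJ'⟩ : {J : Finset ι // #J = q})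
  -- `J` consists of `q` smallest values, and `t` is the largest of them.
  have hJne : J.1.Nonempty := by rw [← card_pos, J.2]; omega
  obtain ⟨t, ht, hmax⟩ := J.1.exists_max_image lam hJne
  have hout : ∀ k ∉ J.1, lam t ≤ lam k := by
    intro k hk
    have h1 := hmin (insert k (J.1.erase t)) (by
      rw [card_insert_of_notMem (by simp [hk]), card_erase_of_mem ht, J.2]; omega)
    rw [sum_insert (by simp [hk]), ← add_sum_erase _ _ ht] at h1
    linarith
  rw [← hJ]
  have h2 : ∀ i, lam t * c i + (if i ∈ J.1 then (lam i - lam t) * m else 0) ≤ lam i * c i := by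
    intro i
    split_ifs with hi
    · nlinarith [hmax i hi, hcm i]
    · nlinarith [hout i hi, hc0 i]
  have h3 := sum_le_sum fun i (_ : i ∈ univ) => h2 i
  rw [sum_add_distrib, ← mul_sum, hsum, sum_ite_mem, univ_inter, ← sum_mul, sum_sub_distrib,
    sum_const, J.2, nsmul_eq_mul] at h3
  linarith

/-- The Levi form on `(0,q)`-forms is bounded below by the sum of the `q` smallest eigenvalues.
In an orthonormal eigenbasis `v_i` it is `∑_i λ_i |v_i ⌟ u|²`, where `|v_i ⌟ u|² ≤ |u|²` and
`∑_i |v_i ⌟ u|² = q |u|²`. -/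
theorem sum_eigenvalues_le_form {n q : ℕ} (hq : 1 ≤ q) (hqn : q ≤ n)
    {M : Matrix (Fin n) (Fin n) ℂ} (hM : M.IsHermitian) (u : Finset (Fin n) → ℂ)
    (hu : ∀ J, #J ≠ q → u J = 0) :
    (⨅ J : MultiIdx n q, ∑ j ∈ J.1, hM.eigenvalues j) * ∑ J, ‖u J‖ ^ 2 ≤
      (∑ K : Finset (Fin n), ∑ j ∈ Kᶜ, ∑ k ∈ Kᶜ,
        sgn K j * sgn K k * (M j k * u (insert j K) * conj (u (insert k K)))).re := by
  let U : Matrix (Fin n) (Fin n) ℂ := hM.eigenvectorUnitary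
  have hMU : ∀ j k, M j k = ∑ i, (hM.eigenvalues i : ℂ) * (U j i * conj (U k i)) := by
    intro j k
    have h := hM.spectral_theorem
    rw [Unitary.conjStarAlgAut_apply] at h
    conv_lhs => rw [h]
    rw [Matrix.mul_apply]
    refine sum_congr rfl fun i _ => ?_
    rw [Matrix.mul_diagonal, Matrix.star_apply]
    simp only [Function.comp_apply, U, Complex.coe_algebraMap, Complex.star_def]
    ring
  have hUU : ∀ j k, ∑ i, U j i * conj (U k i) = if j = k then 1 else 0 := by
    intro j k
    have h : U * star U = 1 := Unitary.coe_mul_star_self hM.eigenvectorUnitary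
    have := congrFun (congrFun h j) k
    rw [Matrix.mul_apply, Matrix.one_apply] at this
    exact this
  have hUU' : ∀ i, ∑ j, ‖U j i‖ ^ 2 = 1 := by
    intro i
    have h : star U * U = 1 := Unitary.coe_star_mul_self hM.eigenvectorUnitary
    have := congrFun (congrFun h i) i
    rw [Matrix.mul_apply, Matrix.one_apply_eq] at this
    simp only [Matrix.star_apply, Complex.star_def, Complex.conj_mul'] at this
    exact_mod_cast this
  let c : Fin n → ℝ := fun i => ∑ K, ‖contrSum (fun j J => U j i * u J) K‖ ^ 2
  have hc : ∀ i, (c i : ℂ) = ∑ K : Finset (Fin n), ∑ j ∈ Kᶜ, ∑ k ∈ Kᶜ,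
      sgn K j * sgn K k * (U j i * conj (U k i) * u (insert j K) * conj (u (insert k K))) := by
    intro i
    simp only [c]
    push_cast
    refine sum_congr rfl fun K _ => ?_
    rw [← Complex.mul_conj']
    simp only [contrSum, map_sum, sum_mul_sum, map_mul, conj_sgn]
    refine sum_congr rfl fun j _ => sum_congr rfl fun k _ => by ring
  have hF : ∑ K : Finset (Fin n), ∑ j ∈ Kᶜ, ∑ k ∈ Kᶜ,
        sgn K j * sgn K k * (M j k * u (insert j K) * conj (u (insert k K))) =
      ((∑ i, hM.eigenvalues i * c i : ℝ) : ℂ) := by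
    push_cast
    simp only [hc, mul_sum]
    symm
    rw [sum_comm]
    refine sum_congr rfl fun K _ => ?_
    rw [sum_comm]
    refine sum_congr rfl fun j _ => ?_
    rw [sum_comm]
    refine sum_congr rfl fun k _ => ?_
    rw [hMU, sum_mul, sum_mul, mul_sum]
    refine sum_congr rfl fun i _ => by ring
  have hcs : ∑ i, c i = q * ∑ J, ‖u J‖ ^ 2 := by
    have h1 : ((∑ i, c i : ℝ) : ℂ) =
        ∑ K : Finset (Fin n), ∑ j ∈ Kᶜ, ((‖u (insert j K)‖ ^ 2 : ℝ) : ℂ) := by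
      push_cast
      simp only [hc]
      rw [sum_comm]
      refine sum_congr rfl fun K _ => ?_
      rw [sum_comm]
      refine sum_congr rfl fun j hj => ?_
      rw [sum_comm, sum_eq_single j]
      · simp only [← sum_mul, hUU, if_true, sgn_mul_self, one_mul]
        rw [Complex.mul_conj']
      · intro k _ hkj
        simp only [← mul_sum, ← sum_mul, hUU, if_neg hkj.symm, zero_mul, mul_zero]
      · exact fun h => absurd hj h
    have h2 : ∑ i, c i = ∑ K : Finset (Fin n), ∑ j ∈ Kᶜ, ‖u (insert j K)‖ ^ 2 := by
      exact_mod_cast h1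
    rw [h2, sum_sum_compl_comm (fun j K => ‖u (insert j K)‖ ^ 2)]
    simp only [← sum_filter_mem_eq _ (fun J => ‖u J‖ ^ 2)]
    rw [← sum_sum_mem_comm (fun _ J => ‖u J‖ ^ 2), mul_sum]
    refine sum_congr rfl fun J _ => ?_
    rw [sum_const, nsmul_eq_mul]
    by_cases hJ : #J = q
    · rw [hJ]
    · simp [hu J hJ]
  rw [hF, Complex.ofReal_re]
  refine iInf_sum_mul_le hq _ c (fun i => sum_nonneg fun _ _ => by positivity) (fun i => ?_) hcs
    (by simpa using hqn)
  have := sum_normSq_contrSum_le (fun j => U j i) u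
  rwa [hUU', one_mul] at this

end Combinatorics

/-! ### Wirtinger calculus and integration by parts -/

section Calculus

open scoped ComplexConjugate

variable {n : ℕ}

theorem dz_mul (j : Fin n) {f g : (Fin n → ℂ) → ℂ} {z : Fin n → ℂ}
    (hf : DifferentiableAt ℝ f z) (hg : DifferentiableAt ℝ g z) :
    dz j (fun w => f w * g w) z = dz j f z * g z + f z * dz j g z := by
  simp only [dz, fderiv_fun_mul hf hg, add_apply, smul_apply, smul_eq_mul]
  ring

theorem dzbar_mul (j : Fin n) {f g : (Fin n → ℂ) → ℂ} {z : Fin n → ℂ}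
    (hf : DifferentiableAt ℝ f z) (hg : DifferentiableAt ℝ g z) :
    dzbar j (fun w => f w * g w) z = dzbar j f z * g z + f z * dzbar j g z := by
  simp only [dzbar, fderiv_fun_mul hf hg, add_apply, smul_apply, smul_eq_mul]
  ring

theorem dzbar_add (j : Fin n) {f g : (Fin n → ℂ) → ℂ} {z : Fin n → ℂ}
    (hf : DifferentiableAt ℝ f z) (hg : DifferentiableAt ℝ g z) :
    dzbar j (fun w => f w + g w) z = dzbar j f z + dzbar j g z := by
  simp only [dzbar, fderiv_fun_add hf hg, add_apply]
  ring

theorem dzbar_neg (j : Fin n) (f : (Fin n → ℂ) → ℂ) (z : Fin n → ℂ) :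
    dzbar j (fun w => -f w) z = -dzbar j f z := by
  simp only [dzbar, fderiv_fun_neg, neg_apply]
  ring

theorem fderiv_conj_apply {f : (Fin n → ℂ) → ℂ} (z v : Fin n → ℂ) :
    fderiv ℝ (fun w => conj (f w)) z v = conj (fderiv ℝ f z v) := by
  have h := Complex.conjCLE.comp_fderiv (f := f) (x := z)
  exact congrArg (fun A => A v) h

theorem dz_conj (j : Fin n) (f : (Fin n → ℂ) → ℂ) (z : Fin n → ℂ) :
    dz j (fun w => conj (f w)) z = conj (dzbar j f z) := by
  simp only [dz, dzbar, fderiv_conj_apply]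
  simp [sub_eq_add_neg, Complex.conj_ofNat]

theorem dzbar_conj (j : Fin n) (f : (Fin n → ℂ) → ℂ) (z : Fin n → ℂ) :
    dzbar j (fun w => conj (f w)) z = conj (dz j f z) := by
  simp only [dz, dzbar, fderiv_conj_apply]
  simp [sub_eq_add_neg, Complex.conj_ofNat]

theorem contDiff_dz (j : Fin n) {f : (Fin n → ℂ) → ℂ} {m k : WithTop ℕ∞} (hf : ContDiff ℝ k f)
    (hmk : m + 1 ≤ k) : ContDiff ℝ m (dz j f) := by
  have h := hf.fderiv_right hmk
  unfold dz
  fun_prop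

theorem contDiff_dzbar (j : Fin n) {f : (Fin n → ℂ) → ℂ} {m k : WithTop ℕ∞}
    (hf : ContDiff ℝ k f) (hmk : m + 1 ≤ k) : ContDiff ℝ m (dzbar j f) := by
  have h := hf.fderiv_right hmk
  unfold dzbar
  fun_prop

theorem continuous_dz_of_contDiff (j : Fin n) {f : (Fin n → ℂ) → ℂ} (hf : ContDiff ℝ 1 f) :
    Continuous (dz j f) := (contDiff_dz (m := 0) j hf (by simp)).continuous

theorem continuous_dzbar_of_contDiff (j : Fin n) {f : (Fin n → ℂ) → ℂ} (hf : ContDiff ℝ 1 f) :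
    Continuous (dzbar j f) := (contDiff_dzbar (m := 0) j hf (by simp)).continuous

theorem dz_eq_zero_of_fderiv {j : Fin n} {f : (Fin n → ℂ) → ℂ} {z : Fin n → ℂ}
    (h : fderiv ℝ f z = 0) : dz j f z = 0 := by simp [dz, h]

theorem dzbar_eq_zero_of_fderiv {j : Fin n} {f : (Fin n → ℂ) → ℂ} {z : Fin n → ℂ}
    (h : fderiv ℝ f z = 0) : dzbar j f z = 0 := by simp [dzbar, h]

theorem hasCompactSupport_dz (j : Fin n) {f : (Fin n → ℂ) → ℂ} (hs : HasCompactSupport f) :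
    HasCompactSupport (dz j f) := by
  refine (hs.fderiv ℝ).mono' (fun z hz => subset_closure ?_)
  exact fun h0 => hz (dz_eq_zero_of_fderiv h0)

theorem hasFDerivAt_fderiv_apply {f : (Fin n → ℂ) → ℂ} (hf : ContDiff ℝ 2 f) (z v : Fin n → ℂ) :
    HasFDerivAt (fun w => fderiv ℝ f w v)
      ((ContinuousLinearMap.apply ℝ ℂ v).comp (fderiv ℝ (fderiv ℝ f) z)) z := by
  have hd : HasFDerivAt (fderiv ℝ f) (fderiv ℝ (fderiv ℝ f) z) z :=
    ((hf.fderiv_right (m := 1) (by norm_num)).differentiable (by norm_num) z).hasFDerivAt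
  exact ((ContinuousLinearMap.apply ℝ ℂ v).hasFDerivAt).comp z hd

theorem fderiv_dz_apply (j : Fin n) {f : (Fin n → ℂ) → ℂ} (hf : ContDiff ℝ 2 f)
    (z v : Fin n → ℂ) :
    fderiv ℝ (dz j f) z v = (fderiv ℝ (fderiv ℝ f) z v (Pi.single j 1) -
      Complex.I * fderiv ℝ (fderiv ℝ f) z v (Pi.single j Complex.I)) / 2 := by
  have h := hasFDerivAt_fderiv_apply hf z
  have h' := (((h (Pi.single j 1)).fun_sub ((h (Pi.single j Complex.I)).const_mul
    Complex.I)).mul_const ((2 : ℂ)⁻¹)).fderiv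
  have hf' : dz j f = fun w => (fderiv ℝ f w (Pi.single j 1) -
    Complex.I * fderiv ℝ f w (Pi.single j Complex.I)) * (2 : ℂ)⁻¹ := by
    funext w; rw [dz]; ring
  rw [hf', h']
  simp
  ring

theorem fderiv_dzbar_apply (j : Fin n) {f : (Fin n → ℂ) → ℂ} (hf : ContDiff ℝ 2 f)
    (z v : Fin n → ℂ) :
    fderiv ℝ (dzbar j f) z v = (fderiv ℝ (fderiv ℝ f) z v (Pi.single j 1) +
      Complex.I * fderiv ℝ (fderiv ℝ f) z v (Pi.single j Complex.I)) / 2 := by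
  have h := hasFDerivAt_fderiv_apply hf z
  have h' := (((h (Pi.single j 1)).fun_add ((h (Pi.single j Complex.I)).const_mul
    Complex.I)).mul_const ((2 : ℂ)⁻¹)).fderiv
  have hf' : dzbar j f = fun w => (fderiv ℝ f w (Pi.single j 1) +
    Complex.I * fderiv ℝ f w (Pi.single j Complex.I)) * (2 : ℂ)⁻¹ := by
    funext w; rw [dzbar]; ring
  rw [hf', h']
  simp
  ring

theorem dz_dzbar_comm (j k : Fin n) {f : (Fin n → ℂ) → ℂ} (hf : ContDiff ℝ 2 f) (z : Fin n → ℂ) :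
    dzbar k (dz j f) z = dz j (dzbar k f) z := by
  have hs : IsSymmSndFDerivAt ℝ f z := hf.contDiffAt.isSymmSndFDerivAt (by simp)
  rw [dzbar, dz, fderiv_dz_apply j hf, fderiv_dz_apply j hf, fderiv_dzbar_apply k hf,
    fderiv_dzbar_apply k hf, hs.eq (Pi.single k 1) (Pi.single j 1),
    hs.eq (Pi.single k 1) (Pi.single j Complex.I), hs.eq (Pi.single k Complex.I) (Pi.single j 1),
    hs.eq (Pi.single k Complex.I) (Pi.single j Complex.I)]
  ring

theorem dzbar_dzbar_comm (j k : Fin n) {f : (Fin n → ℂ) → ℂ} (hf : ContDiff ℝ 2 f)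
    (z : Fin n → ℂ) : dzbar k (dzbar j f) z = dzbar j (dzbar k f) z := by
  have hs : IsSymmSndFDerivAt ℝ f z := hf.contDiffAt.isSymmSndFDerivAt (by simp)
  rw [dzbar, dzbar, fderiv_dzbar_apply j hf, fderiv_dzbar_apply j hf, fderiv_dzbar_apply k hf,
    fderiv_dzbar_apply k hf, hs.eq (Pi.single k 1) (Pi.single j 1),
    hs.eq (Pi.single k 1) (Pi.single j Complex.I), hs.eq (Pi.single k Complex.I) (Pi.single j 1),
    hs.eq (Pi.single k Complex.I) (Pi.single j Complex.I)]
  ring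

/-- A line derivative of a compactly supported `C¹` function has integral zero. -/
theorem integral_fderiv_apply_eq_zero {f : (Fin n → ℂ) → ℂ} (hf : ContDiff ℝ 1 f)
    (hs : HasCompactSupport f) (v : Fin n → ℂ) : ∫ z, fderiv ℝ f z v = 0 := by
  have hc : Continuous fun z => fderiv ℝ f z v := by
    have := hf.continuous_fderiv (by simp)
    fun_prop
  have hcs : HasCompactSupport fun z => fderiv ℝ f z v := hs.fderiv_apply ℝ v
  have h := integral_mul_fderiv_eq_neg_fderiv_mul_of_integrable (μ := volume)
    (f := fun _ : Fin n → ℂ => (1 : ℂ)) (g := f) (v := v) (by simp)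
    (by simpa using hc.integrable_of_hasCompactSupport hcs)
    (by simpa using hf.continuous.integrable_of_hasCompactSupport hs) (by simp)
    (fun z _ => hf.differentiable (by simp) z)
  simpa using h

theorem integral_dz_eq_zero (j : Fin n) {f : (Fin n → ℂ) → ℂ} (hf : ContDiff ℝ 1 f)
    (hs : HasCompactSupport f) : ∫ z, dz j f z = 0 := by
  have hi : ∀ v, Integrable fun z => fderiv ℝ f z v := fun v => by
    have hc : Continuous fun z => fderiv ℝ f z v := by
      have := hf.continuous_fderiv (by simp)
      fun_prop
    exact hc.integrable_of_hasCompactSupport (hs.fderiv_apply ℝ v)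
  simp only [dz]
  rw [integral_div, integral_sub (hi _) ((hi _).const_mul _), integral_const_mul,
    integral_fderiv_apply_eq_zero hf hs, integral_fderiv_apply_eq_zero hf hs]
  simp

theorem integral_dzbar_eq_zero (j : Fin n) {f : (Fin n → ℂ) → ℂ} (hf : ContDiff ℝ 1 f)
    (hs : HasCompactSupport f) : ∫ z, dzbar j f z = 0 := by
  have hi : ∀ v, Integrable fun z => fderiv ℝ f z v := fun v => by
    have hc : Continuous fun z => fderiv ℝ f z v := by
      have := hf.continuous_fderiv (by simp)
      fun_prop
    exact hc.integrable_of_hasCompactSupport (hs.fderiv_apply ℝ v)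
  simp only [dzbar]
  rw [integral_div, integral_add (hi _) ((hi _).const_mul _), integral_const_mul,
    integral_fderiv_apply_eq_zero hf hs, integral_fderiv_apply_eq_zero hf hs]
  simp

/-- The density `e^{-φ}`, as a complex number. -/
def wt (φ : (Fin n → ℂ) → ℝ) (z : Fin n → ℂ) : ℂ := (Real.exp (-φ z) : ℂ)

/-- The formal adjoint `δ_j = -e^φ ∂_j e^{-φ}` of `∂̄_j` in `L²(e^{-φ})`. -/
def dstar (φ : (Fin n → ℂ) → ℝ) (j : Fin n) (f : (Fin n → ℂ) → ℂ) (z : Fin n → ℂ) : ℂ :=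
  -dz j f z + dz j (fun w => (φ w : ℂ)) z * f z

theorem contDiff_wt {φ : (Fin n → ℂ) → ℝ} {k : WithTop ℕ∞} (hφ : ContDiff ℝ k φ) :
    ContDiff ℝ k (wt φ) := by
  have h1 : ContDiff ℝ k fun z => Real.exp (-φ z) := by fun_prop
  exact Complex.ofRealCLM.contDiff.comp h1

theorem contDiff_ofReal_comp {φ : (Fin n → ℂ) → ℝ} {k : WithTop ℕ∞} (hφ : ContDiff ℝ k φ) :
    ContDiff ℝ k (fun z => (φ z : ℂ)) := Complex.ofRealCLM.contDiff.comp hφ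

theorem dz_wt {φ : (Fin n → ℂ) → ℝ} (hφ : ContDiff ℝ 2 φ) (j : Fin n) (z : Fin n → ℂ) :
    dz j (wt φ) z = -(dz j (fun w => (φ w : ℂ)) z * wt φ z) := by
  have hd : HasFDerivAt φ (fderiv ℝ φ z) z := (hφ.differentiable (by norm_num) z).hasFDerivAt
  have h1 := (hd.neg.exp)
  have h2 := (Complex.ofRealCLM.hasFDerivAt (x := Real.exp (-φ z))).comp z h1
  have h3 : fderiv ℝ (wt φ) z = _ := h2.fderiv
  simp only [dz, h3, fderiv_ofReal_comp hφ]
  simp [wt]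
  ring

theorem conj_wt (φ : (Fin n → ℂ) → ℝ) (z : Fin n → ℂ) : conj (wt φ z) = wt φ z :=
  Complex.conj_ofReal _

theorem contDiff_conj {f : (Fin n → ℂ) → ℂ} {k : WithTop ℕ∞} (hf : ContDiff ℝ k f) :
    ContDiff ℝ k fun z => conj (f z) := Complex.conjCLE.contDiff.comp hf

theorem contDiff_dstar {φ : (Fin n → ℂ) → ℝ} (hφ : ContDiff ℝ 2 φ) (j : Fin n)
    {f : (Fin n → ℂ) → ℂ} (hf : ContDiff ℝ 2 f) : ContDiff ℝ 1 (dstar φ j f) := by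
  have h1 : ContDiff ℝ 1 (dz j f) := contDiff_dz j hf (by norm_num)
  have h2 : ContDiff ℝ 1 (dz j fun w => (φ w : ℂ)) :=
    contDiff_dz j (contDiff_ofReal_comp hφ) (by norm_num)
  exact h1.neg.add (h2.mul (hf.of_le (by norm_num)))

theorem hasCompactSupport_dstar (φ : (Fin n → ℂ) → ℝ) (j : Fin n) {f : (Fin n → ℂ) → ℂ}
    (hs : HasCompactSupport f) : HasCompactSupport (dstar φ j f) :=
  (hasCompactSupport_dz j hs).neg.add hs.mul_left

/-- `δ_j` is formally adjoint to `∂̄_j`. -/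
theorem integral_dstar_mul_conj {φ : (Fin n → ℂ) → ℝ} (hφ : ContDiff ℝ 2 φ) (j : Fin n)
    {f h : (Fin n → ℂ) → ℂ} (hf : ContDiff ℝ 1 f) (hh : ContDiff ℝ 1 h)
    (hs : HasCompactSupport f) :
    ∫ z, dstar φ j f z * conj (h z) * wt φ z = ∫ z, f z * conj (dzbar j h z) * wt φ z := by
  have hw := contDiff_wt hφ
  have hcw : Continuous (wt φ) := hw.continuous
  have hch := hh.continuous
  have hcf := hf.continuous
  have hch' := continuous_dzbar_of_contDiff j hh
  have hcf' := continuous_dz_of_contDiff j hf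
  have hcφ' := continuous_dz_of_contDiff j ((contDiff_ofReal_comp hφ).of_le one_le_two)
  have hcc : Continuous (starRingEnd ℂ) := Complex.continuous_conj
  have hF : ContDiff ℝ 1 fun z => f z * (conj (h z) * wt φ z) :=
    hf.mul ((contDiff_conj hh).mul (hw.of_le (by norm_num)))
  have h0 := integral_dz_eq_zero j hF hs.mul_right
  have hpt : ∀ z, dz j (fun z => f z * (conj (h z) * wt φ z)) z =
      f z * conj (dzbar j h z) * wt φ z - dstar φ j f z * conj (h z) * wt φ z := by
    intro z
    have d1 : DifferentiableAt ℝ f z := hf.differentiable (by simp) z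
    have d2 : DifferentiableAt ℝ (fun z => conj (h z)) z :=
      (contDiff_conj hh).differentiable (by simp) z
    have d3 : DifferentiableAt ℝ (wt φ) z := hw.differentiable (by norm_num) z
    rw [dz_mul j d1 (d2.fun_mul d3), dz_mul j d2 d3, dz_conj, dz_wt hφ, dstar]
    ring
  simp only [hpt] at h0
  rw [integral_sub] at h0
  · exact (sub_eq_zero.1 h0).symm
  · exact Continuous.integrable_of_hasCompactSupport (by fun_prop) hs.mul_right.mul_right
  · refine Continuous.integrable_of_hasCompactSupport ?_
      (hasCompactSupport_dstar φ j hs).mul_right.mul_right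
    unfold dstar
    fun_prop

theorem conj_dzbar_dz_ofReal {φ : (Fin n → ℂ) → ℝ} (j k : Fin n) (z : Fin n → ℂ) :
    conj (dzbar j (dz k fun w => (φ w : ℂ)) z) = levi φ z j k := by
  rw [← dz_conj, levi, Matrix.of_apply]
  congr 1
  funext w
  rw [← dzbar_conj]
  simp only [Complex.conj_ofReal]

/-- The commutator `[∂̄_j, δ_k]` is multiplication by `∂²φ/∂z̄_j∂z_k`. -/
theorem dzbar_dstar {φ : (Fin n → ℂ) → ℝ} (hφ : ContDiff ℝ 2 φ) (j k : Fin n)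
    {g : (Fin n → ℂ) → ℂ} (hg : ContDiff ℝ 2 g) (z : Fin n → ℂ) :
    dzbar j (dstar φ k g) z = dstar φ k (dzbar j g) z + conj (levi φ z j k) * g z := by
  have h1 : ContDiff ℝ 1 (dz k g) := contDiff_dz k hg (by norm_num)
  have h2 : ContDiff ℝ 1 (dz k fun w => (φ w : ℂ)) :=
    contDiff_dz k (contDiff_ofReal_comp hφ) (by norm_num)
  have d1 := h1.differentiable (by norm_num) z
  have d2 := h2.differentiable (by norm_num) z
  have d3 := hg.differentiable (by norm_num) z
  have e : dstar φ k g = fun w => -dz k g w + dz k (fun w => (φ w : ℂ)) w * g w := rfl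
  rw [e, dzbar_add j (f := fun w => -dz k g w) d1.neg (d2.fun_mul d3), dzbar_neg, dzbar_mul j d2 d3,
    dz_dzbar_comm k j hg, dstar, ← conj_dzbar_dz_ofReal, Complex.conj_conj]
  ring

/-- Commuting `δ_j` past `∂̄_k` under the integral produces the Levi matrix. -/
theorem integral_dstar_mul_conj_dstar {φ : (Fin n → ℂ) → ℝ} (hφ : ContDiff ℝ 2 φ) (j k : Fin n)
    {f g : (Fin n → ℂ) → ℂ} (hf : ContDiff ℝ 2 f) (hg : ContDiff ℝ 2 g)
    (hfs : HasCompactSupport f) (hgs : HasCompactSupport g) :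
    ∫ z, dstar φ j f z * conj (dstar φ k g z) * wt φ z =
      (∫ z, dzbar k f z * conj (dzbar j g z) * wt φ z) +
        ∫ z, levi φ z j k * f z * conj (g z) * wt φ z := by
  have hf1 : ContDiff ℝ 1 f := hf.of_le (by norm_num)
  have hg' : ContDiff ℝ 1 (dzbar j g) := contDiff_dzbar j hg (by norm_num)
  have hgs' := hasCompactSupport_dzbar j hgs
  rw [integral_dstar_mul_conj hφ j hf1 (contDiff_dstar hφ k hg) hfs]
  have hpt : ∀ z, f z * conj (dzbar j (dstar φ k g) z) * wt φ z =
      f z * conj (dstar φ k (dzbar j g) z) * wt φ z + levi φ z j k * f z * conj (g z) * wt φ z := by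
    intro z
    rw [dzbar_dstar hφ j k hg]
    simp only [map_add, map_mul, Complex.conj_conj]
    ring
  have hcw : Continuous (wt φ) := (contDiff_wt hφ).continuous
  have hcc : Continuous (starRingEnd ℂ) := Complex.continuous_conj
  have hcf := hf.continuous
  have hcg := hg.continuous
  have hcg' := hg'.continuous
  have hcg'' := continuous_dz_of_contDiff k hg'
  have hcφ' := continuous_dz_of_contDiff k ((contDiff_ofReal_comp hφ).of_le one_le_two)
  have hcL : Continuous fun z => levi φ z j k :=
    continuous_dz_of_contDiff j (contDiff_dzbar k (contDiff_ofReal_comp hφ) (by norm_num))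
  simp only [hpt]
  rw [integral_add]
  · congr 1
    have h := congrArg conj (integral_dstar_mul_conj hφ k hg' hf1 hgs')
    rw [← integral_conj, ← integral_conj] at h
    simp only [map_mul, Complex.conj_conj, conj_wt] at h
    calc _ = ∫ z, conj (dstar φ k (dzbar j g) z) * f z * wt φ z := by
          refine integral_congr_ae (Eventually.of_forall fun z => ?_)
          simp only; ring
      _ = _ := h
      _ = _ := by
          refine integral_congr_ae (Eventually.of_forall fun z => ?_)
          simp only; ring
  · refine Continuous.integrable_of_hasCompactSupport ?_ hfs.mul_right.mul_right
    unfold dstar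
    fun_prop
  · exact Continuous.integrable_of_hasCompactSupport (by fun_prop) hfs.mul_left.mul_right.mul_right

end Calculus

/-! ### Positivity of the Levi matrix -/

section Psh

open scoped ComplexConjugate

variable {n : ℕ}

/-- Second-order Taylor expansion, as an upper bound with an arbitrarily small quadratic error. -/
theorem exists_taylor_upper_bound {φ : (Fin n → ℂ) → ℝ} (hφ : ContDiff ℝ 2 φ) (a : Fin n → ℂ)
    {ε : ℝ} (hε : 0 < ε) : ∃ δ > 0, ∀ v : Fin n → ℂ, ‖v‖ < δ →
      φ (a + v) ≤ φ a + fderiv ℝ φ a v + fderiv ℝ (fderiv ℝ φ) a v v / 2 + ε * ‖v‖ ^ 2 := by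
  have hs : IsSymmSndFDerivAt ℝ φ a := hφ.contDiffAt.isSymmSndFDerivAt (by simp)
  have hd : HasFDerivAt (fderiv ℝ φ) (fderiv ℝ (fderiv ℝ φ) a) a :=
    ((hφ.fderiv_right (m := 1) (by norm_num)).differentiable (by norm_num) a).hasFDerivAt
  set H := fderiv ℝ (fderiv ℝ φ) a
  have h1 := hd.isLittleO.def hε
  obtain ⟨δ, hδ, hball⟩ := Metric.eventually_nhds_iff.1 h1
  refine ⟨δ, hδ, fun v hv => ?_⟩
  let R : (Fin n → ℂ) → ℝ := fun w => φ (a + w) - fderiv ℝ φ a w - (1 / 2) * H w w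
  have hR : ∀ w, HasFDerivAt R (fderiv ℝ φ (a + w) - fderiv ℝ φ a - H w) w := by
    intro w
    have e1 : HasFDerivAt (fun w => φ (a + w)) (fderiv ℝ φ (a + w)) w := by
      have := (hφ.differentiable (by norm_num) (a + w)).hasFDerivAt
      exact (this.comp w ((hasFDerivAt_id w).const_add a)).congr_fderiv (by ext; simp)
    have e2 : HasFDerivAt (fun w => H w w) (H w + H.flip w) w := by
      have := (H.hasFDerivAt (x := w)).clm_apply (hasFDerivAt_id w)
      exact this.congr_fderiv (by ext; simp)
    have e3 := (e1.sub (fderiv ℝ φ a).hasFDerivAt).sub (e2.const_mul (1 / 2))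
    refine e3.congr_fderiv (ContinuousLinearMap.ext fun x => ?_)
    have : H x w = H w x := hs.eq x w
    simp only [sub_apply, add_apply, smul_apply, ContinuousLinearMap.flip_apply, this, smul_eq_mul]
    ring
  have hmv := Convex.norm_image_sub_le_of_norm_hasFDerivWithin_le (𝕜 := ℝ) (f := R)
    (f' := fun w => fderiv ℝ φ (a + w) - fderiv ℝ φ a - H w) (C := ε * ‖v‖)
    (s := Metric.closedBall 0 ‖v‖) (x := 0) (y := v)
    (fun w _ => (hR w).hasFDerivWithinAt) (fun w hw => ?_) (convex_closedBall _ _) (by simp)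
    (by simp)
  · have h3 := (abs_le.1 hmv).2
    simp only [R, add_zero, map_zero, sub_zero] at h3
    rw [show ε * ‖v‖ * ‖v‖ = ε * ‖v‖ ^ 2 by ring] at h3
    simp at h3
    linarith
  · rw [mem_closedBall_zero_iff] at hw
    have h4 := hball (y := a + w) (by simpa [dist_eq_norm] using hw.trans_lt hv)
    simp only [add_sub_cancel_left] at h4
    exact h4.trans (by gcongr)

/-- The sub-mean value property on small circles makes the second derivative nonnegative on
average over each complex line. -/
theorem Plurisubharmonic.snd_fderiv_nonneg {φ : (Fin n → ℂ) → ℝ} (hφ : ContDiff ℝ 2 φ)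
    (hpsh : Plurisubharmonic φ) (a b : Fin n → ℂ) :
    0 ≤ fderiv ℝ (fderiv ℝ φ) a b b +
      fderiv ℝ (fderiv ℝ φ) a (Complex.I • b) (Complex.I • b) := by
  set H := fderiv ℝ (fderiv ℝ φ) a with hH
  set D := fderiv ℝ φ a with hD
  have key : ∀ ε > 0, 0 ≤ H b b + H (Complex.I • b) (Complex.I • b) + 4 * ε * ‖b‖ ^ 2 := by
    intro ε hε
    obtain ⟨δ, hδ, hT⟩ := exists_taylor_upper_bound hφ a hε
    rw [← hH, ← hD] at hT
    obtain ⟨r, hr, hrb⟩ : ∃ r : ℝ, 0 < r ∧ r * ‖b‖ < δ := by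
      refine ⟨δ / (‖b‖ + 1), by positivity, ?_⟩
      rw [div_mul_eq_mul_div, div_lt_iff₀ (by positivity)]
      nlinarith [norm_nonneg b]
    have h1 := hpsh.2 a ((r : ℂ) • b)
    rw [Real.circleAverage_def, smul_eq_mul] at h1
    have hpi := Real.pi_pos
    have hle : ∀ θ : ℝ, φ (a + circleMap 0 1 θ • ((r : ℂ) • b)) ≤
        (φ a + ε * r ^ 2 * ‖b‖ ^ 2) + (r * D b) * Real.cos θ + (r * D (Complex.I • b)) * Real.sin θ
        + (r ^ 2 * H b b / 2) * Real.cos θ ^ 2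
        + (r ^ 2 * H (Complex.I • b) (Complex.I • b) / 2) * Real.sin θ ^ 2
        + (r ^ 2 * (H b (Complex.I • b) + H (Complex.I • b) b) / 2) *
          (Real.sin θ * Real.cos θ) := by
      intro θ
      have hv : circleMap 0 1 θ • ((r : ℂ) • b) =
          (r * Real.cos θ) • b + (r * Real.sin θ) • (Complex.I • b) := by
        funext i
        simp only [circleMap, zero_add, Complex.ofReal_one, one_mul, Complex.exp_mul_I,
          Pi.smul_apply, Pi.add_apply, smul_eq_mul, Complex.real_smul]
        push_cast
        ring
      have hn : ‖circleMap 0 1 θ • ((r : ℂ) • b)‖ = r * ‖b‖ := by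
        rw [norm_smul, norm_smul]
        simp [circleMap, Complex.norm_exp_ofReal_mul_I, abs_of_pos hr]
      have h2 := hT (circleMap 0 1 θ • ((r : ℂ) • b)) (by rw [hn]; exact hrb)
      refine h2.trans (le_of_eq ?_)
      rw [hn, hv]
      simp only [map_add, map_smul, add_apply, smul_apply, smul_eq_mul]
      ring
    have hcont : Continuous fun θ : ℝ => φ (a + circleMap 0 1 θ • ((r : ℂ) • b)) := by
      have := hφ.continuous
      have hc := continuous_circleMap 0 1
      fun_prop
    have h2 := intervalIntegral.integral_mono_on (μ := volume) (a := 0) (b := 2 * Real.pi)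
      (by positivity) (hcont.intervalIntegrable _ _)
      (Continuous.intervalIntegrable (by fun_prop) _ _) (fun θ _ => hle θ)
    have hi : ∀ g : ℝ → ℝ, Continuous g → IntervalIntegrable g volume 0 (2 * Real.pi) :=
      fun g hg => hg.intervalIntegrable _ _
    rw [intervalIntegral.integral_add (hi _ (by fun_prop)) (hi _ (by fun_prop)),
      intervalIntegral.integral_add (hi _ (by fun_prop)) (hi _ (by fun_prop)),
      intervalIntegral.integral_add (hi _ (by fun_prop)) (hi _ (by fun_prop)),
      intervalIntegral.integral_add (hi _ (by fun_prop)) (hi _ (by fun_prop)),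
      intervalIntegral.integral_add (hi _ (by fun_prop)) (hi _ (by fun_prop))] at h2
    simp only [intervalIntegral.integral_const_mul, intervalIntegral.integral_const, integral_cos,
      integral_sin, integral_cos_sq, integral_sin_sq, integral_sin_mul_cos₁, Real.sin_zero,
      Real.cos_zero, Real.sin_two_pi, Real.cos_two_pi, smul_eq_mul] at h2
    have h3 : 2 * Real.pi * φ a ≤
        ∫ θ in 0..2 * Real.pi, φ (a + circleMap 0 1 θ • ((r : ℂ) • b)) := by
      have := mul_le_mul_of_nonneg_left h1 (show 0 ≤ 2 * Real.pi by positivity)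
      rwa [← mul_assoc, mul_inv_cancel₀ (by positivity), one_mul] at this
    have h4 := h3.trans h2
    have h5 : 0 ≤ (Real.pi * r ^ 2 / 2) *
        (H b b + H (Complex.I • b) (Complex.I • b) + 4 * ε * ‖b‖ ^ 2) := by
      ring_nf at h4 ⊢
      linarith
    exact nonneg_of_mul_nonneg_right h5 (by positivity)
  have hlim : Tendsto (fun ε : ℝ => H b b + H (Complex.I • b) (Complex.I • b) + 4 * ε * ‖b‖ ^ 2)
      (𝓝[>] 0) (𝓝 (H b b + H (Complex.I • b) (Complex.I • b) + 4 * 0 * ‖b‖ ^ 2)) := by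
    refine Tendsto.mono_left (Continuous.tendsto (by fun_prop) 0) nhdsWithin_le_nhds
  have := ge_of_tendsto hlim (eventually_mem_nhdsWithin.mono fun ε hε => key ε hε)
  simpa using this

/-- The complex-linear part of a real-linear map, in coordinates. -/
theorem sum_mul_linear_part (l : (Fin n → ℂ) →ₗ[ℝ] ℂ) (b : Fin n → ℂ) :
    ∑ j, b j * (l (Pi.single j 1) - Complex.I * l (Pi.single j Complex.I)) =
      l b - Complex.I * l (Complex.I • b) := by
  have hb : ∀ c : Fin n → ℂ, l c =
      ∑ j, (((c j).re : ℂ) * l (Pi.single j 1) + ((c j).im : ℂ) * l (Pi.single j Complex.I)) := by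
    intro c
    have hc : c = ∑ j, ((c j).re • (Pi.single j 1 : Fin n → ℂ) +
        (c j).im • (Pi.single j Complex.I : Fin n → ℂ)) := by
      funext i
      rw [Finset.sum_apply, Finset.sum_eq_single i]
      · simp [Complex.re_add_im]
      · intro k _ hk
        simp [Pi.single_eq_of_ne hk.symm]
      · simp
    conv_lhs => rw [hc]
    simp only [map_sum, map_add, map_smul, Complex.real_smul]
  rw [hb b, hb (Complex.I • b), Finset.mul_sum, ← Finset.sum_sub_distrib]
  refine Finset.sum_congr rfl fun j _ => ?_
  simp only [Pi.smul_apply, smul_eq_mul, Complex.I_mul_re, Complex.I_mul_im, Complex.ofReal_neg]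
  conv_lhs => rw [← Complex.re_add_im (b j)]
  linear_combination (b j).im * l (Pi.single j Complex.I) * Complex.I_sq.symm

open scoped ComplexOrder in
theorem levi_posSemidef {φ : (Fin n → ℂ) → ℝ} (hφ : ContDiff ℝ 2 φ) (hpsh : Plurisubharmonic φ)
    (z : Fin n → ℂ) : (levi φ z).PosSemidef := by
  set H := fderiv ℝ (fderiv ℝ φ) z with hH
  refine Matrix.PosSemidef.of_dotProduct_mulVec_nonneg (levi_isHermitian hφ z) fun x => ?_
  set b := star x with hb
  have hsum : b ⬝ᵥ (levi φ z).mulVec x =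
      ((H b b + H (Complex.I • b) (Complex.I • b) : ℝ) : ℂ) / 4 := by
    let G : (Fin n → ℂ) →ₗ[ℝ] ℂ :=
      { toFun := fun v => ((H v b : ℝ) : ℂ) + Complex.I * (H v (Complex.I • b) : ℝ)
        map_add' := fun v w => by simp only [map_add, add_apply]; push_cast; ring
        map_smul' := fun c v => by
          simp only [map_smul, smul_apply, smul_eq_mul, Complex.real_smul, RingHom.id_apply]
          push_cast; ring }
    have hin : ∀ v, ∑ k, conj (b k) * ((H v (Pi.single k 1) : ℝ) +
        Complex.I * (H v (Pi.single k Complex.I) : ℝ)) = G v := by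
      intro v
      have h := congrArg conj
        (sum_mul_linear_part (Complex.ofRealCLM.comp (H v) : (Fin n → ℂ) →ₗ[ℝ] ℂ) b)
      simp only [map_sum, map_mul, map_sub, Complex.conj_I] at h
      simpa [G] using h
    have h2 := sum_mul_linear_part G b
    have hxb : ∀ k, x k = conj (b k) := fun k => by simp [hb]
    simp only [dotProduct, Matrix.mulVec, hxb]
    have h3 : ∀ j, b j * ∑ k, levi φ z j k * conj (b k) =
        b j * (G (Pi.single j 1) - Complex.I * G (Pi.single j Complex.I)) / 4 := by
      intro j
      rw [← hin, ← hin, Finset.mul_sum, Finset.mul_sum, ← Finset.sum_sub_distrib,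
        Finset.mul_sum, Finset.sum_div]
      refine Finset.sum_congr rfl fun k _ => ?_
      rw [levi_apply hφ, ← hH]
      linear_combination (b j * conj (b k) *
        (H (Pi.single j Complex.I) (Pi.single k Complex.I) : ℝ) / 4) * Complex.I_sq
    simp only [h3]
    rw [← Finset.sum_div, h2]
    have hs : H b (Complex.I • b) = H (Complex.I • b) b :=
      (hφ.contDiffAt.isSymmSndFDerivAt (by simp) : IsSymmSndFDerivAt ℝ φ z).eq _ _
    simp only [G, LinearMap.coe_mk, AddHom.coe_mk]
    push_cast
    rw [hs]
    linear_combination (-(H (Complex.I • b) (Complex.I • b) : ℝ) / 4) * Complex.I_sq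
  rw [hsum]
  have := Plurisubharmonic.snd_fderiv_nonneg hφ hpsh z b
  rw [← hH] at this
  rw [show ((H b b + H (Complex.I • b) (Complex.I • b) : ℝ) : ℂ) / 4 =
    (((H b b + H (Complex.I • b) (Complex.I • b)) / 4 : ℝ) : ℂ) by push_cast; ring]
  exact_mod_cast (by positivity : 0 ≤ (H b b + H (Complex.I • b) (Complex.I • b)) / 4)

theorem sumSmallestEigenvalues_nonneg {φ : (Fin n → ℂ) → ℝ} (hφ : ContDiff ℝ 2 φ)
    (hpsh : Plurisubharmonic φ) (q : ℕ) (z : Fin n → ℂ) :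
    0 ≤ sumSmallestEigenvalues hφ q z :=
  Real.iInf_nonneg fun _ => Finset.sum_nonneg fun _ _ =>
    (levi_posSemidef hφ hpsh z).eigenvalues_nonneg _

end Psh

/-! ### The a priori estimate for smooth compactly supported forms -/

section SmoothEstimate

open scoped ComplexConjugate

variable {n : ℕ}

/-- The squared weighted norm `∫ |f|² e^{-φ}`. -/
def energy (φ : (Fin n → ℂ) → ℝ) (f : (Fin n → ℂ) → ℂ) : ℝ :=
  ∫ z, ‖f z‖ ^ 2 * Real.exp (-φ z)

/-- `∂̄u` for a form `u` with differentiable coefficients. -/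
def dbarForm (u : Finset (Fin n) → (Fin n → ℂ) → ℂ) (L : Finset (Fin n)) (z : Fin n → ℂ) : ℂ :=
  wedgeSum (fun j J => dzbar j (u J) z) L

/-- The formal adjoint of `∂̄` in `L²(e^{-φ})`, for a form `u` with differentiable coefficients. -/
def dbarStarForm (φ : (Fin n → ℂ) → ℝ) (u : Finset (Fin n) → (Fin n → ℂ) → ℂ)
    (K : Finset (Fin n)) (z : Fin n → ℂ) : ℂ :=
  contrSum (fun j J => dstar φ j (u J) z) K

theorem energy_nonneg (φ : (Fin n → ℂ) → ℝ) (f : (Fin n → ℂ) → ℂ) : 0 ≤ energy φ f :=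
  integral_nonneg fun _ => by positivity

theorem integral_mul_conj_wt (φ : (Fin n → ℂ) → ℝ) (f : (Fin n → ℂ) → ℂ) :
    ∫ z, f z * conj (f z) * wt φ z = (energy φ f : ℂ) := by
  rw [energy, ← integral_complex_ofReal]
  refine integral_congr_ae (Eventually.of_forall fun z => ?_)
  simp only [wt, Complex.mul_conj']
  push_cast
  rfl

theorem hasCompactSupport_norm_sq_mul {f : (Fin n → ℂ) → ℂ} (hs : HasCompactSupport f)
    (g : (Fin n → ℂ) → ℝ) : HasCompactSupport fun z => ‖f z‖ ^ 2 * g z :=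
  hs.mono' fun z hz => subset_closure fun h => hz (by simp [h])

theorem integrable_norm_sq_mul_exp {φ : (Fin n → ℂ) → ℝ} (hφ : Continuous φ)
    {f : (Fin n → ℂ) → ℂ} (hf : Continuous f) (hs : HasCompactSupport f) :
    Integrable fun z => ‖f z‖ ^ 2 * Real.exp (-φ z) := by
  exact Continuous.integrable_of_hasCompactSupport (by fun_prop)
    (hasCompactSupport_norm_sq_mul hs _)

theorem integrable_mul_conj_wt {φ : (Fin n → ℂ) → ℝ} (hφ : Continuous φ)
    {f g : (Fin n → ℂ) → ℂ} (hf : Continuous f) (hg : Continuous g) (hs : HasCompactSupport f) :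
    Integrable fun z => f z * conj (g z) * wt φ z := by
  have hcc : Continuous (starRingEnd ℂ) := Complex.continuous_conj
  have hw : Continuous (wt φ) := by unfold wt; fun_prop
  exact Continuous.integrable_of_hasCompactSupport (by fun_prop) hs.mul_right.mul_right

/-- The Levi form `∑_K ∑_{j,k} φ_{jk̄} u_{jK} ū_{kK}`. -/
def leviForm (φ : (Fin n → ℂ) → ℝ) (u : Finset (Fin n) → (Fin n → ℂ) → ℂ) (z : Fin n → ℂ) : ℂ :=
  ∑ K : Finset (Fin n), ∑ j ∈ Kᶜ, ∑ k ∈ Kᶜ,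
    sgn K j * sgn K k * (levi φ z j k * u (insert j K) z * conj (u (insert k K) z))

theorem continuous_levi {φ : (Fin n → ℂ) → ℝ} (hφ : ContDiff ℝ 2 φ) (j k : Fin n) :
    Continuous fun z => levi φ z j k :=
  continuous_dz_of_contDiff j (contDiff_dzbar k (contDiff_ofReal_comp hφ) (by norm_num))

theorem integrable_levi_mul {φ : (Fin n → ℂ) → ℝ} (hφ : ContDiff ℝ 2 φ) (j k : Fin n)
    {f g : (Fin n → ℂ) → ℂ} (hf : Continuous f) (hg : Continuous g) (hs : HasCompactSupport f) :
    Integrable fun z => levi φ z j k * f z * conj (g z) * wt φ z :=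
  integrable_mul_conj_wt hφ.continuous ((continuous_levi hφ j k).mul hf) hg hs.mul_left

/-- The Kohn–Morrey formula `∑_{J,j} ‖∂̄_j u_J‖² + ∫ (Levi form) e^{-φ} = ‖∂̄u‖² + ‖∂̄*_φ u‖²`. -/
theorem kohn_morrey {φ : (Fin n → ℂ) → ℝ} (hφ : ContDiff ℝ 2 φ)
    {u : Finset (Fin n) → (Fin n → ℂ) → ℂ} (hu : ∀ J, ContDiff ℝ 2 (u J))
    (hs : ∀ J, HasCompactSupport (u J)) :
    (∑ J, ∑ j, energy φ (dzbar j (u J)) : ℂ) + ∫ z, leviForm φ u z * wt φ z =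
      (∑ L, energy φ (dbarForm u L) : ℂ) + ∑ K, (energy φ (dbarStarForm φ u K) : ℂ) := by
  have hc := hφ.continuous
  have hu0 : ∀ J, Continuous (u J) := fun J => (hu J).continuous
  have hu1 : ∀ J j, Continuous (dzbar j (u J)) := fun J j =>
    continuous_dzbar_of_contDiff j ((hu J).of_le (by norm_num))
  have hs1 : ∀ J j, HasCompactSupport (dzbar j (u J)) := fun J j =>
    hasCompactSupport_dzbar j (hs J)
  have hu2 : ∀ J j, Continuous (dstar φ j (u J)) := fun J j =>
    (contDiff_dstar hφ j (hu J)).continuous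
  have hs2 : ∀ J j, HasCompactSupport (dstar φ j (u J)) := fun J j =>
    hasCompactSupport_dstar φ j (hs J)
  -- The adjoint term, after commuting the operators.
  have h1 : ∀ K, (energy φ (dbarStarForm φ u K) : ℂ) = ∑ j ∈ Kᶜ, ∑ k ∈ Kᶜ, sgn K j * sgn K k *
      ((∫ z, dzbar k (u (insert j K)) z * conj (dzbar j (u (insert k K)) z) * wt φ z) +
        ∫ z, levi φ z j k * u (insert j K) z * conj (u (insert k K) z) * wt φ z) := by
    intro K
    rw [← integral_mul_conj_wt]
    have hpt : ∀ z, dbarStarForm φ u K z * conj (dbarStarForm φ u K z) * wt φ z =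
        ∑ j ∈ Kᶜ, ∑ k ∈ Kᶜ, sgn K j * sgn K k *
          (dstar φ j (u (insert j K)) z * conj (dstar φ k (u (insert k K)) z) * wt φ z) := by
      intro z
      simp only [dbarStarForm, contrSum, map_sum, Finset.sum_mul_sum, map_mul, conj_sgn]
      simp only [Finset.sum_mul]
      refine Finset.sum_congr rfl fun j _ => Finset.sum_congr rfl fun k _ => by ring
    simp only [hpt]
    rw [integral_finsetSum _ fun j _ => integrable_finsetSum _ fun k _ =>
      (integrable_mul_conj_wt hc (hu2 _ _) (hu2 _ _) (hs2 _ _)).const_mul _]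
    refine Finset.sum_congr rfl fun j _ => ?_
    rw [integral_finsetSum _ fun k _ =>
      (integrable_mul_conj_wt hc (hu2 _ _) (hu2 _ _) (hs2 _ _)).const_mul _]
    refine Finset.sum_congr rfl fun k _ => ?_
    rw [integral_const_mul, integral_dstar_mul_conj_dstar hφ j k (hu _) (hu _) (hs _) (hs _)]
  have h2 : ∫ z, leviForm φ u z * wt φ z = ∑ K : Finset (Fin n), ∑ j ∈ Kᶜ, ∑ k ∈ Kᶜ,
      sgn K j * sgn K k *
        ∫ z, levi φ z j k * u (insert j K) z * conj (u (insert k K) z) * wt φ z := by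
    have hi : ∀ K j k, Integrable fun z => sgn K j * sgn K k *
        (levi φ z j k * u (insert j K) z * conj (u (insert k K) z) * wt φ z) := fun K j k =>
      (integrable_levi_mul hφ j k (hu0 _) (hu0 _) (hs _)).const_mul _
    have hpt : ∀ z, leviForm φ u z * wt φ z = ∑ K : Finset (Fin n), ∑ j ∈ Kᶜ, ∑ k ∈ Kᶜ,
        sgn K j * sgn K k *
          (levi φ z j k * u (insert j K) z * conj (u (insert k K) z) * wt φ z) := by
      intro z
      simp only [leviForm, Finset.sum_mul, mul_assoc]
    simp only [hpt]
    rw [integral_finsetSum _ fun K _ => integrable_finsetSum _ fun j _ =>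
      integrable_finsetSum _ fun k _ => hi K j k]
    refine Finset.sum_congr rfl fun K _ => ?_
    rw [integral_finsetSum _ fun j _ => integrable_finsetSum _ fun k _ => hi K j k]
    refine Finset.sum_congr rfl fun j _ => ?_
    rw [integral_finsetSum _ fun k _ => hi K j k]
    simp only [integral_const_mul]
  have h3 : (∑ L, energy φ (dbarForm u L) : ℂ) + (∑ K : Finset (Fin n), ∑ j ∈ Kᶜ, ∑ k ∈ Kᶜ,
      sgn K j * sgn K k *
        ∫ z, dzbar k (u (insert j K)) z * conj (dzbar j (u (insert k K)) z) * wt φ z) =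
      (∑ J, ∑ j, energy φ (dzbar j (u J)) : ℂ) := by
    have hd : ∀ L, Continuous (dbarForm u L) := fun L => by
      unfold dbarForm wedgeSum
      fun_prop
    have hds : ∀ L, HasCompactSupport (dbarForm u L) := fun L => by
      have : ∀ s : Finset (Fin n), HasCompactSupport fun z =>
          ∑ j ∈ s, sgn L j * dzbar j (u (L.erase j)) z := by
        intro s
        induction s using Finset.induction_on with
        | empty => simp only [Finset.sum_empty]; exact HasCompactSupport.zero
        | insert a s ha ih =>
          simp only [Finset.sum_insert ha]
          exact ((hs1 _ a).mul_left).add ih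
      exact this L
    have hi : ∀ K j k, Integrable fun z => sgn K j * sgn K k *
        (dzbar k (u (insert j K)) z * conj (dzbar j (u (insert k K)) z) * wt φ z) := fun K j k =>
      (integrable_mul_conj_wt hc (hu1 _ _) (hu1 _ _) (hs1 _ _)).const_mul _
    simp only [← integral_mul_conj_wt, ← integral_const_mul]
    rw [← integral_finsetSum _ fun L _ => integrable_mul_conj_wt hc (hd L) (hd L) (hds L)]
    simp only [← integral_finsetSum _ fun k _ => hi _ _ k]
    simp only [← integral_finsetSum _ fun j _ => integrable_finsetSum _ fun k _ => hi _ j k]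
    rw [← integral_finsetSum _ fun K _ => integrable_finsetSum _ fun j _ =>
      integrable_finsetSum _ fun k _ => hi K j k]
    simp only [← integral_finsetSum _ fun j _ =>
      integrable_mul_conj_wt hc (hu1 _ j) (hu1 _ j) (hs1 _ j)]
    rw [← integral_finsetSum _ fun J _ => integrable_finsetSum _ fun j _ =>
      integrable_mul_conj_wt hc (hu1 J j) (hu1 J j) (hs1 J j)]
    rw [← integral_add (integrable_finsetSum _ fun L _ =>
        integrable_mul_conj_wt hc (hd L) (hd L) (hds L))
      (integrable_finsetSum _ fun K _ => integrable_finsetSum _ fun j _ =>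
        integrable_finsetSum _ fun k _ => hi K j k)]
    refine integral_congr_ae (Eventually.of_forall fun z => ?_)
    have h := congrArg (· * wt φ z) (sum_wedgeSum_mul_conj_add fun j J => dzbar j (u J) z)
    simp only [add_mul, Finset.sum_mul] at h
    simp only [dbarForm]
    rw [← h]
    simp only [mul_assoc]
  rw [h2, ← h3]
  simp only [h1, mul_add, Finset.sum_add_distrib]
  ring

theorem dzbar_coord (j : Fin n) (z : Fin n → ℂ) : dzbar j (fun w => w j) z = 0 := by
  have h : fderiv ℝ (fun w : Fin n → ℂ => w j) z = ContinuousLinearMap.proj j :=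
    (ContinuousLinearMap.proj (R := ℝ) (φ := fun _ : Fin n => ℂ) j).fderiv
  simp [dzbar, h]

theorem dz_coord (j : Fin n) (z : Fin n → ℂ) : dz j (fun w => w j) z = 1 := by
  have h : fderiv ℝ (fun w : Fin n → ℂ => w j) z = ContinuousLinearMap.proj j :=
    (ContinuousLinearMap.proj (R := ℝ) (φ := fun _ : Fin n => ℂ) j).fderiv
  simp [dz, h]

/-- The weight `-|z_j|²`, whose Levi matrix has the constant entry `-1` at `(j, j)`. -/
def negSq (j : Fin n) (z : Fin n → ℂ) : ℝ := -Complex.normSq (z j)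

theorem contDiff_negSq (j : Fin n) {k : WithTop ℕ∞} : ContDiff ℝ k (negSq j) := by
  have : (negSq j : (Fin n → ℂ) → ℝ) = fun z =>
      -(Complex.reCLM (z j) * Complex.reCLM (z j) + Complex.imCLM (z j) * Complex.imCLM (z j)) := by
    funext z
    simp [negSq, Complex.normSq_apply]
  rw [this]
  fun_prop

theorem levi_negSq (j : Fin n) (z : Fin n → ℂ) : levi (negSq j) z j j = -1 := by
  have hd : Differentiable ℝ fun w : Fin n → ℂ => w j := by fun_prop
  have hd' : Differentiable ℝ fun w : Fin n → ℂ => conj (w j) :=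
    Complex.conjCLE.differentiable.comp hd
  have h1 : dzbar j (fun w => (negSq j w : ℂ)) = fun w => -(w j) := by
    funext w
    have : (fun w : Fin n → ℂ => (negSq j w : ℂ)) = fun w => -(w j * conj (w j)) := by
      funext w
      simp [negSq, Complex.mul_conj]
    rw [this, dzbar_neg j (fun w : Fin n → ℂ => w j * conj (w j)), dzbar_mul j (hd w) (hd' w),
      dzbar_coord, dzbar_conj, dz_coord]
    simp
  rw [levi, Matrix.of_apply, h1, dz, fderiv_fun_neg]
  have := dz_coord j z
  rw [dz] at this
  simp only [neg_apply]
  linear_combination -this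

/-- With the weight `-|z_j|²` the commutator has the sign that bounds `f` by `∂̄_j f`. -/
theorem energy_negSq_le (j : Fin n) {f : (Fin n → ℂ) → ℂ} (hf : ContDiff ℝ 2 f)
    (hs : HasCompactSupport f) : energy (negSq j) f ≤ energy (negSq j) (dzbar j f) := by
  have h := integral_dstar_mul_conj_dstar (contDiff_negSq j) j j hf hf hs hs
  simp only [levi_negSq, neg_mul, one_mul] at h
  rw [integral_neg, integral_mul_conj_wt, integral_mul_conj_wt, integral_mul_conj_wt] at h
  have h' : energy (negSq j) (dstar (negSq j) j f) =
      energy (negSq j) (dzbar j f) + -energy (negSq j) f := by exact_mod_cast h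
  have := energy_nonneg (negSq j) (dstar (negSq j) j f)
  linarith

theorem exists_cutoff {R : ℝ} (hR : 0 < R) : ∃ χ : (Fin n → ℂ) → ℂ, ContDiff ℝ 2 χ ∧
    HasCompactSupport χ ∧ (∀ z ∈ Metric.ball 0 R, χ z = 1) ∧
    ∀ j, ∀ z ∈ Metric.ball 0 R, dzbar j χ z = 0 := by
  let b : ContDiffBump (0 : Fin n → ℂ) := ⟨R, R + 1, hR, by linarith⟩
  have h1 : ∀ z ∈ Metric.ball (0 : Fin n → ℂ) R, (b z : ℂ) = 1 := fun z hz => by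
    rw [b.one_of_mem_closedBall (Metric.ball_subset_closedBall hz), Complex.ofReal_one]
  refine ⟨fun z => (b z : ℂ), contDiff_ofReal_comp b.contDiff,
    b.hasCompactSupport.comp_left (g := Complex.ofReal) (by simp), h1, fun j z hz => ?_⟩
  refine dzbar_eq_zero_of_fderiv ?_
  have : (fun z => (b z : ℂ)) =ᶠ[𝓝 z] fun _ => 1 := by
    filter_upwards [Metric.isOpen_ball.mem_nhds hz] with w hw using h1 w hw
  rw [this.fderiv_eq]
  simp

/-- `∂̄_j (χ f)` in a second weight, where `χ` is a cutoff function which is `1` on a ball. -/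
theorem exists_energy_dzbar_cutoff_le {φ ψ : (Fin n → ℂ) → ℝ} (hφ : Continuous φ)
    (hcψ : Continuous ψ) (j : Fin n) {R : ℝ} {χ : (Fin n → ℂ) → ℂ} (hχ : ContDiff ℝ 2 χ)
    (hχs : HasCompactSupport χ) (hχ' : ∀ z ∈ Metric.ball 0 R, dzbar j χ z = 0) :
    ∃ C ≥ 0, ∀ f : (Fin n → ℂ) → ℂ, ContDiff ℝ 2 f → HasCompactSupport f →
      energy ψ (dzbar j fun z => χ z * f z) ≤
        C * (energy φ (dzbar j f) + ∫ z in (Metric.ball 0 R)ᶜ, ‖f z‖ ^ 2 * Real.exp (-φ z)) := by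
  have hcχ := hχ.continuous
  have hcχ' := continuous_dzbar_of_contDiff j (hχ.of_le one_le_two)
  obtain ⟨B₁, hB₁⟩ := HasCompactSupport.exists_bound_of_continuous
    (f := fun z => ‖dzbar j χ z‖ ^ 2 * Real.exp (φ z - ψ z))
    (hasCompactSupport_norm_sq_mul (hasCompactSupport_dzbar j hχs) _) (by fun_prop)
  obtain ⟨B₂, hB₂⟩ := HasCompactSupport.exists_bound_of_continuous
    (f := fun z => ‖χ z‖ ^ 2 * Real.exp (φ z - ψ z))
    (hasCompactSupport_norm_sq_mul hχs _) (by fun_prop)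
  have hB₁0 : 0 ≤ B₁ := (norm_nonneg _).trans (hB₁ 0)
  have hB₂0 : 0 ≤ B₂ := (norm_nonneg _).trans (hB₂ 0)
  have hexp : ∀ (c B : ℝ) (z : Fin n → ℂ), |c * Real.exp (φ z - ψ z)| ≤ B →
      c * Real.exp (-ψ z) ≤ B * Real.exp (-φ z) := by
    intro c B z h
    have h1 := mul_le_mul_of_nonneg_right ((le_abs_self _).trans h) (Real.exp_pos (-φ z)).le
    rwa [mul_assoc, ← Real.exp_add, show φ z - ψ z + -φ z = -ψ z by ring] at h1
  refine ⟨2 * (B₁ + B₂), by positivity, fun f hf hs => ?_⟩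
  have hcf := hf.continuous
  have hcf' := continuous_dzbar_of_contDiff j (hf.of_le one_le_two)
  have hfs' := hasCompactSupport_dzbar j hs
  have hi := integrable_norm_sq_mul_exp hφ hcf hs
  have hi' := integrable_norm_sq_mul_exp hφ hcf' hfs'
  have hg : ContDiff ℝ 2 fun z => χ z * f z := hχ.mul hf
  have hgs : HasCompactSupport fun z => χ z * f z := hs.mul_left
  rw [energy, energy, ← integral_indicator measurableSet_ball.compl,
    ← integral_add hi' (hi.indicator measurableSet_ball.compl), ← integral_const_mul]
  refine integral_mono (integrable_norm_sq_mul_exp hcψ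
    (continuous_dzbar_of_contDiff j (hg.of_le one_le_two)) (hasCompactSupport_dzbar j hgs))
    ((hi'.add (hi.indicator measurableSet_ball.compl)).const_mul _) fun z => ?_
  simp only
  rw [dzbar_mul j (hχ.differentiable (by norm_num) z) (hf.differentiable (by norm_num) z)]
  have e1 := hexp _ _ _ (hB₁ z)
  have e2 := hexp _ _ _ (hB₂ z)
  have hpos := (Real.exp_pos (-φ z)).le
  have hpos' := (Real.exp_pos (-ψ z)).le
  have htri : ‖dzbar j χ z * f z + χ z * dzbar j f z‖ ^ 2 ≤
      2 * (‖dzbar j χ z‖ ^ 2 * ‖f z‖ ^ 2 + ‖χ z‖ ^ 2 * ‖dzbar j f z‖ ^ 2) := by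
    have h1 := norm_add_le (dzbar j χ z * f z) (χ z * dzbar j f z)
    rw [norm_mul, norm_mul] at h1
    nlinarith [sq_nonneg (‖dzbar j χ z‖ * ‖f z‖ - ‖χ z‖ * ‖dzbar j f z‖), norm_nonneg
      (dzbar j χ z * f z + χ z * dzbar j f z)]
  have e3 : ‖dzbar j χ z‖ ^ 2 * ‖f z‖ ^ 2 * Real.exp (-ψ z) ≤
      B₁ * (Metric.ball 0 R)ᶜ.indicator (fun z => ‖f z‖ ^ 2 * Real.exp (-φ z)) z := by
    by_cases hz : z ∈ Metric.ball (0 : Fin n → ℂ) R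
    · rw [hχ' z hz, Set.indicator_of_notMem (by simpa using hz)]
      simp
    · rw [Set.indicator_of_mem hz]
      calc _ = ‖f z‖ ^ 2 * (‖dzbar j χ z‖ ^ 2 * Real.exp (-ψ z)) := by ring
        _ ≤ ‖f z‖ ^ 2 * (B₁ * Real.exp (-φ z)) := by gcongr
        _ = _ := by ring
  have e4 : ‖χ z‖ ^ 2 * ‖dzbar j f z‖ ^ 2 * Real.exp (-ψ z) ≤
      B₂ * (‖dzbar j f z‖ ^ 2 * Real.exp (-φ z)) := by
    calc _ = ‖dzbar j f z‖ ^ 2 * (‖χ z‖ ^ 2 * Real.exp (-ψ z)) := by ring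
      _ ≤ ‖dzbar j f z‖ ^ 2 * (B₂ * Real.exp (-φ z)) := by gcongr
      _ = _ := by ring
  have e5 : 0 ≤ (Metric.ball 0 R)ᶜ.indicator (fun z => ‖f z‖ ^ 2 * Real.exp (-φ z)) z :=
    Set.indicator_nonneg (fun z _ => by positivity) z
  have e6 : 0 ≤ ‖dzbar j f z‖ ^ 2 * Real.exp (-φ z) := by positivity
  have e7 := mul_le_mul_of_nonneg_right htri hpos'
  nlinarith [mul_nonneg hB₁0 e6, mul_nonneg hB₂0 e5]

/-- On a ball, `f` is controlled by `∂̄_j f` and by `f` outside the ball. -/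
theorem exists_interior_estimate {φ : (Fin n → ℂ) → ℝ} (hφ : Continuous φ) (j : Fin n) {R : ℝ}
    (hR : 0 < R) : ∃ C ≥ 0, ∀ f : (Fin n → ℂ) → ℂ, ContDiff ℝ 2 f → HasCompactSupport f →
      ∫ z in Metric.ball 0 R, ‖f z‖ ^ 2 * Real.exp (-φ z) ≤
        C * (energy φ (dzbar j f) + ∫ z in (Metric.ball 0 R)ᶜ, ‖f z‖ ^ 2 * Real.exp (-φ z)) := by
  obtain ⟨χ, hχ, hχs, hχ1, hχ'⟩ := exists_cutoff (n := n) hR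
  have hcψ : Continuous (negSq j : (Fin n → ℂ) → ℝ) := (contDiff_negSq (k := 0) j).continuous
  obtain ⟨A, hA⟩ := (isCompact_closedBall (0 : Fin n → ℂ) R).exists_bound_of_continuousOn
    (f := fun z => Real.exp (negSq j z - φ z)) (by fun_prop)
  have hA0 : 0 ≤ A := (norm_nonneg _).trans (hA 0 (by simp [hR.le]))
  obtain ⟨B, hB0, hB⟩ := exists_energy_dzbar_cutoff_le hφ hcψ j hχ hχs (hχ' j)
  refine ⟨A * B, by positivity, fun f hf hs => ?_⟩
  have hi := integrable_norm_sq_mul_exp hφ hf.continuous hs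
  have hg : ContDiff ℝ 2 fun z => χ z * f z := hχ.mul hf
  have hgs : HasCompactSupport fun z => χ z * f z := hs.mul_left
  have hgi := integrable_norm_sq_mul_exp hcψ hg.continuous hgs
  have step1 : ∫ z in Metric.ball 0 R, ‖f z‖ ^ 2 * Real.exp (-φ z) ≤
      A * energy (negSq j) fun z => χ z * f z := by
    rw [energy, ← integral_const_mul]
    refine (setIntegral_mono_on hi.integrableOn (hgi.const_mul A).integrableOn
      measurableSet_ball fun z hz => ?_).trans
      (setIntegral_le_integral (hgi.const_mul A) (Eventually.of_forall fun z => by positivity))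
    rw [hχ1 z hz, one_mul]
    have h1 := (le_abs_self _).trans (hA z (Metric.ball_subset_closedBall hz))
    have h2 := mul_le_mul_of_nonneg_right h1 (Real.exp_pos (-negSq j z)).le
    rw [← Real.exp_add, show negSq j z - φ z + -negSq j z = -φ z by ring] at h2
    calc _ ≤ ‖f z‖ ^ 2 * (A * Real.exp (-negSq j z)) := by gcongr
      _ = _ := by ring
  calc _ ≤ A * energy (negSq j) fun z => χ z * f z := step1
    _ ≤ A * (B *
      (energy φ (dzbar j f) + ∫ z in (Metric.ball 0 R)ᶜ, ‖f z‖ ^ 2 * Real.exp (-φ z))) := by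
        gcongr
        exact (energy_negSq_le j hg hgs).trans (hB f hf hs)
    _ = _ := by ring

theorem integrable_leviForm {φ : (Fin n → ℂ) → ℝ} (hφ : ContDiff ℝ 2 φ)
    {u : Finset (Fin n) → (Fin n → ℂ) → ℂ} (hu : ∀ J, Continuous (u J))
    (hs : ∀ J, HasCompactSupport (u J)) : Integrable fun z => leviForm φ u z * wt φ z := by
  have hpt : ∀ z, leviForm φ u z * wt φ z = ∑ K : Finset (Fin n), ∑ j ∈ Kᶜ, ∑ k ∈ Kᶜ,
      sgn K j * sgn K k *
        (levi φ z j k * u (insert j K) z * conj (u (insert k K) z) * wt φ z) := by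
    intro z
    simp only [leviForm, Finset.sum_mul, mul_assoc]
  simp only [hpt]
  exact integrable_finsetSum _ fun K _ => integrable_finsetSum _ fun j _ =>
    integrable_finsetSum _ fun k _ => (integrable_levi_mul hφ j k (hu _) (hu _) (hs _)).const_mul _

/-- The Kohn–Morrey formula with the Levi form estimated from below: it vanishes at worst inside
the ball and is at least `c |u|²` outside. -/
theorem kohn_morrey_lower_bound {φ : (Fin n → ℂ) → ℝ} (hφ : ContDiff ℝ 2 φ)
    (hpsh : Plurisubharmonic φ) {q : ℕ} (hq : 1 ≤ q) (hqn : q ≤ n) {c R : ℝ}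
    (hc : ∀ z, R ≤ ‖z‖ → c ≤ sumSmallestEigenvalues hφ q z)
    {u : Finset (Fin n) → (Fin n → ℂ) → ℂ} (hu : ∀ J, ContDiff ℝ 2 (u J))
    (hs : ∀ J, HasCompactSupport (u J)) (huq : ∀ J, J.card ≠ q → u J = 0) :
    (∑ J, ∑ j, energy φ (dzbar j (u J))) +
      c * ∑ J, ∫ z in (Metric.ball 0 R)ᶜ, ‖u J z‖ ^ 2 * Real.exp (-φ z) ≤
    ∑ L, energy φ (dbarForm u L) + ∑ K, energy φ (dbarStarForm φ u K) := by
  have hkm := congrArg Complex.re (kohn_morrey hφ hu hs)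
  have hu0 : ∀ J, Continuous (u J) := fun J => (hu J).continuous
  have hiL := integrable_leviForm hφ hu0 hs
  have hre : (∫ z, leviForm φ u z * wt φ z).re =
      ∫ z, (leviForm φ u z).re * Real.exp (-φ z) := by
    have := integral_re hiL
    simp only [RCLike.re_to_complex] at this
    rw [← this]
    refine integral_congr_ae (Eventually.of_forall fun z => ?_)
    simp only [wt, Complex.re_mul_ofReal]
  have hi : ∀ J, Integrable fun z => ‖u J z‖ ^ 2 * Real.exp (-φ z) := fun J =>
    integrable_norm_sq_mul_exp hφ.continuous (hu0 J) (hs J)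
  have hlow : c * ∑ J, ∫ z in (Metric.ball 0 R)ᶜ, ‖u J z‖ ^ 2 * Real.exp (-φ z) ≤
      ∫ z, (leviForm φ u z).re * Real.exp (-φ z) := by
    have hiL' : Integrable fun z => (leviForm φ u z).re * Real.exp (-φ z) := by
      refine hiL.re.congr (Eventually.of_forall fun z => ?_)
      simp only [wt, RCLike.re_to_complex, Complex.re_mul_ofReal]
    simp only [← integral_indicator measurableSet_ball.compl]
    rw [← integral_finsetSum _ fun J _ => (hi J).indicator measurableSet_ball.compl,
      ← integral_const_mul]
    refine integral_mono ((integrable_finsetSum _ fun J _ =>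
      (hi J).indicator measurableSet_ball.compl).const_mul c) hiL' fun z => ?_
    have h1 := sum_eigenvalues_le_form hq hqn (levi_isHermitian hφ z) (fun J => u J z)
      (fun J hJ => by rw [huq J hJ]; rfl)
    have h2 : sumSmallestEigenvalues hφ q z * ∑ J, ‖u J z‖ ^ 2 ≤ (leviForm φ u z).re := h1
    have h0 : 0 ≤ ∑ J, ‖u J z‖ ^ 2 := Finset.sum_nonneg fun _ _ => by positivity
    have hs0 := sumSmallestEigenvalues_nonneg hφ hpsh q z
    have hexp := (Real.exp_pos (-φ z)).le
    simp only
    by_cases hz : z ∈ (Metric.ball (0 : Fin n → ℂ) R)ᶜ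
    · simp only [Set.indicator_of_mem hz, ← Finset.sum_mul, ← mul_assoc]
      have hcz : c ≤ sumSmallestEigenvalues hφ q z := hc z (by simpa using hz)
      gcongr
      exact (mul_le_mul_of_nonneg_right hcz h0).trans h2
    · simp only [Set.indicator_of_notMem hz, Finset.sum_const_zero, mul_zero]
      exact mul_nonneg ((mul_nonneg hs0 h0).trans h2) hexp
  have hkm' : (∑ J, ∑ j, energy φ (dzbar j (u J))) +
      (∫ z, leviForm φ u z * wt φ z).re =
      ∑ L, energy φ (dbarForm u L) + ∑ K, energy φ (dbarStarForm φ u K) := by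
    simp only [Complex.add_re, Complex.re_sum, Complex.ofReal_re] at hkm
    exact hkm
  rw [hre] at hkm'
  linarith

/-- The a priori estimate for smooth compactly supported forms: the Kohn–Morrey formula controls `u`
outside a ball, and the interior estimate controls it inside. -/
theorem exists_smooth_estimate {φ : (Fin n → ℂ) → ℝ} (hφ : ContDiff ℝ 2 φ)
    (hpsh : Plurisubharmonic φ) {q : ℕ} (hq : 1 ≤ q) (hqn : q ≤ n)
    (hs : (0 : EReal) < Filter.liminf
      (fun z : Fin n → ℂ => ((sumSmallestEigenvalues hφ q z : ℝ) : EReal))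
      (Filter.cocompact (Fin n → ℂ))) :
    ∃ C > 0, ∀ u : Finset (Fin n) → (Fin n → ℂ) → ℂ, (∀ J, ContDiff ℝ 2 (u J)) →
      (∀ J, HasCompactSupport (u J)) → (∀ J, J.card ≠ q → u J = 0) →
      ∑ J, energy φ (u J) ≤
        C * (∑ L, energy φ (dbarForm u L) + ∑ K, energy φ (dbarStarForm φ u K)) := by
  obtain ⟨c, hc0, hc⟩ := EReal.lt_iff_exists_real_btwn.1 hs
  have hc0 : 0 < c := by exact_mod_cast hc0
  have hev := eventually_lt_of_lt_liminf hc
  rw [← Metric.cobounded_eq_cocompact] at hev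
  obtain ⟨R, hR0, hR⟩ : ∃ R > 0, ∀ z : Fin n → ℂ, R ≤ ‖z‖ →
      c ≤ sumSmallestEigenvalues hφ q z := by
    obtain ⟨R, -, hR⟩ := (hasBasis_cobounded_norm (E := Fin n → ℂ)).eventually_iff.1 hev
    refine ⟨max R 1, by positivity, fun z hz => ?_⟩
    have := hR (show z ∈ {x | R ≤ ‖x‖} from (le_max_left _ _).trans hz)
    exact_mod_cast this.le
  let j₀ : Fin n := ⟨0, by omega⟩
  obtain ⟨C, hC0, hC⟩ := exists_interior_estimate hφ.continuous j₀ hR0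
  -- `C` controls the part inside the ball by one derivative, and `(C + 1) / c` the part outside.
  refine ⟨C + (C + 1) / c, by positivity, fun u hu hus huq => ?_⟩
  have hlow := kohn_morrey_lower_bound hφ hpsh hq hqn hR hu hus huq
  set Q := ∑ L, energy φ (dbarForm u L) + ∑ K, energy φ (dbarStarForm φ u K)
  have hJ : ∀ J, energy φ (u J) ≤ C * energy φ (dzbar j₀ (u J)) +
      (C + 1) * ∫ z in (Metric.ball 0 R)ᶜ, ‖u J z‖ ^ 2 * Real.exp (-φ z) := by
    intro J
    have h1 := integral_add_compl (measurableSet_ball (x := (0 : Fin n → ℂ)) (ε := R))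
      (integrable_norm_sq_mul_exp hφ.continuous (hu J).continuous (hus J))
    have h2 := hC (u J) (hu J) (hus J)
    rw [energy, ← h1]
    linarith
  have hsum := Finset.sum_le_sum fun J (_ : J ∈ Finset.univ) => hJ J
  rw [Finset.sum_add_distrib, ← Finset.mul_sum, ← Finset.mul_sum] at hsum
  have h3 : ∑ J, energy φ (dzbar j₀ (u J)) ≤ ∑ J, ∑ j, energy φ (dzbar j (u J)) :=
    Finset.sum_le_sum fun J _ =>
      Finset.single_le_sum (f := fun j => energy φ (dzbar j (u J)))
        (fun j _ => energy_nonneg _ _) (Finset.mem_univ j₀)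
  set O := ∑ J, ∫ z in (Metric.ball 0 R)ᶜ, ‖u J z‖ ^ 2 * Real.exp (-φ z)
  set D := ∑ J, energy φ (dzbar j₀ (u J))
  have hO : 0 ≤ O := Finset.sum_nonneg fun J _ => integral_nonneg fun _ => by positivity
  have hD : 0 ≤ D := Finset.sum_nonneg fun J _ => energy_nonneg _ _
  have h4 : D ≤ Q := by nlinarith
  have h5 : O ≤ Q / c := by
    rw [le_div_iff₀ hc0]
    nlinarith
  calc _ ≤ C * D + (C + 1) * O := hsum
    _ ≤ C * Q + (C + 1) * (Q / c) := by gcongr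
    _ = _ := by ring

end SmoothEstimate

/-! ### Mollification -/

section Mollification

open scoped Convolution ENNReal

variable {n : ℕ}

/-- The normalized bump function, as a complex-valued function. -/
def mollKernel (b : ContDiffBump (0 : Fin n → ℂ)) (z : Fin n → ℂ) : ℂ := (b.normed volume z : ℂ)

/-- The mollification of `f` by a normalized bump function. -/
def moll (b : ContDiffBump (0 : Fin n → ℂ)) (f : (Fin n → ℂ) → ℂ) : (Fin n → ℂ) → ℂ :=
  f ⋆[ContinuousLinearMap.mul ℝ ℂ, volume] mollKernel b

variable (b : ContDiffBump (0 : Fin n → ℂ))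

theorem contDiff_mollKernel : ContDiff ℝ ∞ (mollKernel b) :=
  contDiff_ofReal_comp b.contDiff_normed

theorem hasCompactSupport_mollKernel : HasCompactSupport (mollKernel b) :=
  b.hasCompactSupport_normed.comp_left (g := Complex.ofReal) (by simp)

theorem moll_apply (f : (Fin n → ℂ) → ℂ) (z : Fin n → ℂ) :
    moll b f z = ∫ t, f t * mollKernel b (z - t) := rfl

theorem moll_congr_ae {f g : (Fin n → ℂ) → ℂ} (h : f =ᵐ[volume] g) : moll b f = moll b g := by
  funext z
  rw [moll_apply, moll_apply]
  refine integral_congr_ae ?_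
  filter_upwards [h] with t ht
  rw [ht]

theorem contDiff_moll {f : (Fin n → ℂ) → ℂ} (hf : LocallyIntegrable f) :
    ContDiff ℝ ∞ (moll b f) :=
  (hasCompactSupport_mollKernel b).contDiff_convolution_right _ hf (contDiff_mollKernel b)

theorem fderiv_moll_apply {f : (Fin n → ℂ) → ℂ} (hf : LocallyIntegrable f) (z v : Fin n → ℂ) :
    fderiv ℝ (moll b f) z v = ∫ t, f t * fderiv ℝ (mollKernel b) (z - t) v := by
  have hk : ContDiff ℝ 1 (mollKernel b) := (contDiff_mollKernel b).of_le (by simp)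
  rw [moll, ((hasCompactSupport_mollKernel b).hasFDerivAt_convolution_right _ hf hk z).fderiv,
    convolution_precompR_apply _ hf ((hasCompactSupport_mollKernel b).fderiv ℝ)
      (hk.continuous_fderiv (by simp))]
  rfl

theorem integrable_mul_shift {f g : (Fin n → ℂ) → ℂ} (hf : LocallyIntegrable f)
    (hg : Continuous g) (hs : HasCompactSupport g) (z : Fin n → ℂ) :
    Integrable fun t => f t * g (z - t) :=
  hs.convolutionExists_right (ContinuousLinearMap.mul ℝ ℂ) hf hg z

theorem fderiv_sub_left_apply {g : (Fin n → ℂ) → ℂ} (hg : Differentiable ℝ g)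
    (z t v : Fin n → ℂ) :
    fderiv ℝ (fun t => g (z - t)) t v = -fderiv ℝ g (z - t) v := by
  have h := (hg (z - t)).hasFDerivAt.comp t ((hasFDerivAt_id t).const_sub z)
  have h' : fderiv ℝ (fun t => g (z - t)) t = _ := h.fderiv
  rw [h']
  simp

/-- Testing `∂̄_j f` against the mollifier gives `∂̄_j` of the mollification. -/
theorem integral_mul_dzbar_mollKernel {f : (Fin n → ℂ) → ℂ} (hf : LocallyIntegrable f)
    (j : Fin n) (z : Fin n → ℂ) :
    ∫ t, f t * dzbar j (fun t => mollKernel b (z - t)) t = -dzbar j (moll b f) z := by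
  have hd : Differentiable ℝ (mollKernel b) := (contDiff_mollKernel b).differentiable (by simp)
  have hi : ∀ v, Integrable fun t => f t * fderiv ℝ (mollKernel b) (z - t) v := fun v => by
    refine integrable_mul_shift hf (g := fun t => fderiv ℝ (mollKernel b) t v) ?_
      ((hasCompactSupport_mollKernel b).fderiv_apply ℝ v) z
    have := (contDiff_mollKernel b).continuous_fderiv (by simp)
    fun_prop
  simp only [dzbar, fderiv_sub_left_apply hd, fderiv_moll_apply b hf]
  rw [← integral_const_mul, ← integral_add (hi _) ((hi _).const_mul _), ← integral_div,
    ← integral_neg]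
  refine integral_congr_ae (Eventually.of_forall fun t => ?_)
  simp only
  ring

theorem integral_mul_dz_mollKernel {f : (Fin n → ℂ) → ℂ} (hf : LocallyIntegrable f)
    (j : Fin n) (z : Fin n → ℂ) :
    ∫ t, f t * dz j (fun t => mollKernel b (z - t)) t = -dz j (moll b f) z := by
  have hd : Differentiable ℝ (mollKernel b) := (contDiff_mollKernel b).differentiable (by simp)
  have hi : ∀ v, Integrable fun t => f t * fderiv ℝ (mollKernel b) (z - t) v := fun v => by
    refine integrable_mul_shift hf (g := fun t => fderiv ℝ (mollKernel b) t v) ?_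
      ((hasCompactSupport_mollKernel b).fderiv_apply ℝ v) z
    have := (contDiff_mollKernel b).continuous_fderiv (by simp)
    fun_prop
  simp only [dz, fderiv_sub_left_apply hd, fderiv_moll_apply b hf]
  rw [← integral_const_mul, ← integral_sub (hi _) ((hi _).const_mul _), ← integral_div,
    ← integral_neg]
  refine integral_congr_ae (Eventually.of_forall fun t => ?_)
  simp only
  ring

theorem moll_eq_zero_of_norm_gt {f : (Fin n → ℂ) → ℂ} {M : ℝ} (hM : ∀ z, M < ‖z‖ → f z = 0)
    {z : Fin n → ℂ} (hz : M + b.rOut < ‖z‖) : moll b f z = 0 := by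
  rw [moll_apply]
  refine integral_eq_zero_of_ae (Eventually.of_forall fun t => ?_)
  by_cases ht : M < ‖t‖
  · simp [hM t ht]
  · have h1 : z - t ∉ Function.support (b.normed volume) := by
      rw [b.support_normed_eq, mem_ball_zero_iff, not_lt]
      have := norm_sub_norm_le z t
      linarith
    simp only [mollKernel, Function.notMem_support.1 h1]
    simp

/-- The probability measure with the mollifier as density. -/
def mollMeasure : Measure (Fin n → ℂ) :=
  volume.withDensity fun t => (Real.toNNReal (b.normed volume t) : ℝ≥0∞)

instance : IsProbabilityMeasure (mollMeasure b) := by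
  refine ⟨?_⟩
  rw [mollMeasure, withDensity_apply _ MeasurableSet.univ, Measure.restrict_univ]
  have h := ofReal_integral_eq_lintegral_ofReal (b.integrable_normed (μ := volume))
    (Eventually.of_forall b.nonneg_normed)
  rw [b.integral_normed, ENNReal.ofReal_one] at h
  exact h.symm

theorem measurable_toNNReal_normed : Measurable fun t => Real.toNNReal (b.normed volume t) :=
  (b.continuous_normed (μ := volume)).measurable.real_toNNReal

theorem moll_eq_integral_mollMeasure (f : (Fin n → ℂ) → ℂ) (z : Fin n → ℂ) :
    moll b f z = ∫ t, f (z - t) ∂(mollMeasure b) := by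
  rw [mollMeasure, integral_withDensity_eq_integral_smul (measurable_toNNReal_normed b),
    moll_apply, ← integral_sub_left_eq_self _ volume z]
  refine integral_congr_ae (Eventually.of_forall fun t => ?_)
  simp only [sub_sub_cancel, mollKernel, NNReal.smul_def, Real.coe_toNNReal _ (b.nonneg_normed _),
    Complex.real_smul]
  ring

theorem ae_mollMeasure_norm_lt : ∀ᵐ t ∂(mollMeasure b), ‖t‖ < b.rOut := by
  rw [mollMeasure, ae_withDensity_iff (measurable_toNNReal_normed b).coe_nnreal_ennreal]
  refine Eventually.of_forall fun t ht => ?_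
  have h : t ∈ Function.support (b.normed volume) := fun h0 => ht (by simp [h0])
  rwa [b.support_normed_eq, mem_ball_zero_iff] at h

/-- Jensen's inequality for the average of `f (z - t) - f z`. -/
theorem enorm_moll_sub_sq_le {f : (Fin n → ℂ) → ℂ} (hf : Measurable f)
    (hfi : LocallyIntegrable f) (z : Fin n → ℂ) :
    ‖moll b f z - f z‖ₑ ^ 2 ≤ ∫⁻ t, ‖f (z - t) - f z‖ₑ ^ 2 ∂(mollMeasure b) := by
  have hi : Integrable (fun t => f (z - t)) (mollMeasure b) := by
    rw [mollMeasure, integrable_withDensity_iff_integrable_smul (measurable_toNNReal_normed b)]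
    have h := (integrable_mul_shift hfi (contDiff_mollKernel b).continuous
      (hasCompactSupport_mollKernel b) z).comp_sub_left z
    refine h.congr (Eventually.of_forall fun t => ?_)
    simp only [sub_sub_cancel, mollKernel, NNReal.smul_def,
      Real.coe_toNNReal _ (b.nonneg_normed _), Complex.real_smul]
    ring
  have h1 : moll b f z - f z = ∫ t, (f (z - t) - f z) ∂(mollMeasure b) := by
    rw [integral_sub hi (integrable_const _), moll_eq_integral_mollMeasure]
    simp
  have hm : AEStronglyMeasurable (fun t => f (z - t) - f z) (mollMeasure b) :=
    (by fun_prop : Measurable fun t => f (z - t) - f z).aestronglyMeasurable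
  rw [h1]
  calc ‖∫ t, (f (z - t) - f z) ∂(mollMeasure b)‖ₑ ^ 2
      ≤ (eLpNorm (fun t => f (z - t) - f z) 1 (mollMeasure b)) ^ 2 := by
        rw [eLpNorm_one_eq_lintegral_enorm]
        gcongr
        exact enorm_integral_le_lintegral_enorm _
    _ ≤ (eLpNorm (fun t => f (z - t) - f z) 2 (mollMeasure b)) ^ 2 := by
        gcongr
        exact eLpNorm_le_eLpNorm_of_exponent_le one_le_two hm
    _ = _ := by
        have := eLpNorm_nnreal_pow_eq_lintegral (p := 2) (μ := mollMeasure b)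
          (f := fun t => f (z - t) - f z) (by norm_num)
        simpa using this

/-- Continuity of translations in `L²`. -/
theorem exists_translation_small {f : (Fin n → ℂ) → ℂ} (hf : MemLp f 2 volume) {ε : ℝ≥0∞}
    (hε : 0 < ε) :
    ∃ δ > 0, ∀ t : Fin n → ℂ, ‖t‖ < δ → eLpNorm (fun z => f (z - t) - f z) 2 volume ≤ ε := by
  let g : C((Fin n → ℂ) × (Fin n → ℂ), Fin n → ℂ) := ⟨fun p => p.2 - p.1, by fun_prop⟩
  have hg : ∀ t, MeasurePreserving (g.curry t) (volume : Measure (Fin n → ℂ)) volume := fun t =>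
    measurePreserving_sub_right volume t
  let F : (Fin n → ℂ) → Lp ℂ 2 (volume : Measure (Fin n → ℂ)) := fun t =>
    Lp.compMeasurePreserving (g.curry t) (hg t) (hf.toLp f)
  have hc : Continuous F :=
    continuous_const.compMeasurePreservingLp g.curry.continuous hg (by norm_num)
  have hF : ∀ t, edist (F t) (hf.toLp f) = eLpNorm (fun z => f (z - t) - f z) 2 volume :=
      fun t => by
    simp only [F]
    rw [Lp.toLp_compMeasurePreserving hf (hg t), Lp.edist_toLp_toLp]
    rfl
  have h0 : edist (F 0) (hf.toLp f) = 0 := by rw [hF]; simp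
  have ht : Tendsto (fun t => edist (F t) (hf.toLp f)) (𝓝 0) (𝓝 0) := by
    have := (hc.tendsto 0).edist (tendsto_const_nhds (x := hf.toLp f))
    rwa [h0] at this
  obtain ⟨δ, hδ, h⟩ := Metric.eventually_nhds_iff.1 (ht.eventually_lt_const hε)
  refine ⟨δ, hδ, fun t htδ => ?_⟩
  rw [← hF]
  exact (h (y := t) (by simpa using htδ)).le

/-- Mollifications converge in `L²`. -/
theorem exists_eLpNorm_moll_sub_le {f : (Fin n → ℂ) → ℂ} (hf : MemLp f 2 volume) {ε : ℝ≥0∞}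
    (hε : 0 < ε) :
    ∃ δ > 0, ∀ b : ContDiffBump (0 : Fin n → ℂ), b.rOut < δ →
      eLpNorm (fun z => moll b f z - f z) 2 volume ≤ ε := by
  -- A measurable representative, for Tonelli's theorem.
  wlog hm : Measurable f generalizing f
  · obtain ⟨g, hg, hfg⟩ := hf.1.aemeasurable
    obtain ⟨δ, hδ, h⟩ := this (hf.ae_eq hfg) hg
    refine ⟨δ, hδ, fun b hb => ?_⟩
    rw [moll_congr_ae b hfg]
    refine le_trans (le_of_eq (eLpNorm_congr_ae ?_)) (h b hb)
    filter_upwards [hfg] with z hz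
    rw [hz]
  have hfi : LocallyIntegrable f := hf.locallyIntegrable one_le_two
  obtain ⟨δ, hδ, h⟩ := exists_translation_small hf hε
  refine ⟨δ, hδ, fun b hb => ?_⟩
  have hsq : ∀ (μ : Measure (Fin n → ℂ)) (g : (Fin n → ℂ) → ℂ),
      eLpNorm g 2 μ ^ 2 = ∫⁻ z, ‖g z‖ₑ ^ 2 ∂μ := fun μ g => by
    have := eLpNorm_nnreal_pow_eq_lintegral (p := 2) (μ := μ) (f := g) (by norm_num)
    simpa using this
  rw [← ENNReal.pow_le_pow_left_iff (n := 2) (by norm_num), hsq]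
  calc ∫⁻ z, ‖moll b f z - f z‖ₑ ^ 2
      ≤ ∫⁻ z, (∫⁻ t, ‖f (z - t) - f z‖ₑ ^ 2 ∂(mollMeasure b)) :=
        lintegral_mono fun z => enorm_moll_sub_sq_le b hm hfi z
    _ = ∫⁻ t, (∫⁻ z, ‖f (z - t) - f z‖ₑ ^ 2) ∂(mollMeasure b) := by
        refine lintegral_lintegral_swap ?_
        have : Measurable fun p : (Fin n → ℂ) × (Fin n → ℂ) => f (p.1 - p.2) - f p.1 := by
          fun_prop
        exact (this.enorm.pow_const 2).aemeasurable
    _ ≤ ∫⁻ _, ε ^ 2 ∂(mollMeasure b) := by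
        refine lintegral_mono_ae ?_
        filter_upwards [ae_mollMeasure_norm_lt b] with t ht
        rw [← hsq]
        gcongr
        exact h t (ht.trans hb)
    _ = ε ^ 2 := by simp

end Mollification

/-! ### Convergence in `L²` and weighted norms -/

section Convergence

open scoped ENNReal

variable {n : ℕ}

/-- Convergence in `L²(μ)`. -/
def ConvL2 (μ : Measure (Fin n → ℂ)) (h : ℕ → (Fin n → ℂ) → ℂ) (f : (Fin n → ℂ) → ℂ) : Prop :=
  (∀ k, MemLp (h k) 2 μ) ∧ MemLp f 2 μ ∧
    Tendsto (fun k => eLpNorm (fun z => h k z - f z) 2 μ) atTop (𝓝 0)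

theorem eLpNorm_two_sq (μ : Measure (Fin n → ℂ)) (g : (Fin n → ℂ) → ℂ) :
    eLpNorm g 2 μ ^ 2 = ∫⁻ z, ‖g z‖ₑ ^ 2 ∂μ := by
  have := eLpNorm_nnreal_pow_eq_lintegral (p := 2) (μ := μ) (f := g) (by norm_num)
  simpa using this

theorem ConvL2.add {μ : Measure (Fin n → ℂ)} {h h' : ℕ → (Fin n → ℂ) → ℂ}
    {f f' : (Fin n → ℂ) → ℂ} (H : ConvL2 μ h f) (H' : ConvL2 μ h' f') :
    ConvL2 μ (fun k z => h k z + h' k z) (fun z => f z + f' z) := by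
  refine ⟨fun k => (H.1 k).add (H'.1 k), H.2.1.add H'.2.1, ?_⟩
  have ht := H.2.2.add H'.2.2
  rw [add_zero] at ht
  refine tendsto_of_tendsto_of_tendsto_of_le_of_le tendsto_const_nhds ht (fun _ => zero_le)
    fun k => ?_
  refine le_trans (le_of_eq ?_) (eLpNorm_add_le ((H.1 k).sub H.2.1).1 ((H'.1 k).sub H'.2.1).1
    one_le_two)
  refine eLpNorm_congr_ae (Eventually.of_forall fun z => ?_)
  simp only [Pi.add_apply]
  ring

theorem ConvL2.const_mul {μ : Measure (Fin n → ℂ)} {h : ℕ → (Fin n → ℂ) → ℂ}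
    {f : (Fin n → ℂ) → ℂ} (H : ConvL2 μ h f) (c : ℂ) :
    ConvL2 μ (fun k z => c * h k z) (fun z => c * f z) := by
  refine ⟨fun k => (H.1 k).const_mul c, H.2.1.const_mul c, ?_⟩
  have ht := ENNReal.Tendsto.const_mul (a := ‖c‖ₑ) H.2.2 (Or.inr enorm_ne_top)
  rw [mul_zero] at ht
  refine ht.congr fun k => ?_
  rw [← eLpNorm_const_smul]
  refine eLpNorm_congr_ae (Eventually.of_forall fun z => ?_)
  simp only [Pi.smul_apply, smul_eq_mul]
  ring

theorem ConvL2.sum {μ : Measure (Fin n → ℂ)} {ι : Type*} (s : Finset ι)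
    {h : ι → ℕ → (Fin n → ℂ) → ℂ} {f : ι → (Fin n → ℂ) → ℂ} (H : ∀ i ∈ s, ConvL2 μ (h i) (f i)) :
    ConvL2 μ (fun k z => ∑ i ∈ s, h i k z) (fun z => ∑ i ∈ s, f i z) := by
  classical
  induction s using Finset.induction_on with
  | empty => simp [ConvL2]
  | insert a s ha ih =>
    simp only [Finset.sum_insert ha]
    exact (H a (Finset.mem_insert_self a s)).add
      (ih fun i hi => H i (Finset.mem_insert_of_mem hi))

theorem weightMeasure_absolutelyContinuous (φ : (Fin n → ℂ) → ℝ) :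
    weightMeasure φ ≪ volume := withDensity_absolutelyContinuous _ _

theorem absolutelyContinuous_weightMeasure {φ : (Fin n → ℂ) → ℝ} (hφ : Continuous φ) :
    (volume : Measure (Fin n → ℂ)) ≪ weightMeasure φ := by
  intro s hs
  rw [← compl_compl s, ← mem_ae_iff] at hs ⊢
  exact ae_volume_of_ae_weight hφ hs

theorem lintegral_weightMeasure {φ : (Fin n → ℂ) → ℝ} (hφ : Continuous φ)
    (g : (Fin n → ℂ) → ℝ≥0∞) :
    ∫⁻ z, g z ∂(weightMeasure φ) = ∫⁻ z, ENNReal.ofReal (Real.exp (-φ z)) * g z := by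
  have hm : Measurable fun z => ENNReal.ofReal (Real.exp (-φ z)) :=
    (Real.continuous_exp.comp hφ.neg).measurable.ennreal_ofReal
  rw [weightMeasure, lintegral_withDensity_eq_lintegral_mul_non_measurable _ hm
    (Eventually.of_forall fun _ => ENNReal.ofReal_lt_top)]
  rfl

/-- On functions supported in a ball, the weighted norm is dominated by the unweighted one. -/
theorem exists_eLpNorm_weight_le {φ : (Fin n → ℂ) → ℝ} (hφ : Continuous φ) (M : ℝ) :
    ∃ A : ℝ≥0∞, A ≠ ⊤ ∧ ∀ g : (Fin n → ℂ) → ℂ, (∀ z, M < ‖z‖ → g z = 0) →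
      eLpNorm g 2 (weightMeasure φ) ≤ A * eLpNorm g 2 volume := by
  obtain ⟨A, hA⟩ := (isCompact_closedBall (0 : Fin n → ℂ) M).exists_bound_of_continuousOn
    (f := fun z => Real.exp (-φ z)) (by fun_prop)
  have hA1 : A ≤ (max A 1) ^ 2 := by nlinarith [le_max_left A 1, le_max_right A 1]
  refine ⟨ENNReal.ofReal (max A 1), ENNReal.ofReal_ne_top, fun g hg => ?_⟩
  rw [← ENNReal.pow_le_pow_left_iff (n := 2) (by norm_num), mul_pow, eLpNorm_two_sq,
    eLpNorm_two_sq, lintegral_weightMeasure hφ, ← ENNReal.ofReal_pow (by positivity),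
    ← lintegral_const_mul' _ _ ENNReal.ofReal_ne_top]
  refine lintegral_mono fun z => ?_
  by_cases hz : M < ‖z‖
  · simp [hg z hz]
  · gcongr
    exact ((le_abs_self _).trans (hA z (by simpa using hz))).trans hA1

/-- On functions supported in a ball, the unweighted norm is dominated by the weighted one. -/
theorem exists_eLpNorm_le_weight {φ : (Fin n → ℂ) → ℝ} (hφ : Continuous φ) (M : ℝ) :
    ∃ A : ℝ≥0∞, A ≠ ⊤ ∧ ∀ g : (Fin n → ℂ) → ℂ, (∀ z, M < ‖z‖ → g z = 0) →
      eLpNorm g 2 volume ≤ A * eLpNorm g 2 (weightMeasure φ) := by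
  obtain ⟨A, hA⟩ := (isCompact_closedBall (0 : Fin n → ℂ) M).exists_bound_of_continuousOn
    (f := fun z => Real.exp (φ z)) (by fun_prop)
  have hA1 : A ≤ (max A 1) ^ 2 := by nlinarith [le_max_left A 1, le_max_right A 1]
  refine ⟨ENNReal.ofReal (max A 1), ENNReal.ofReal_ne_top, fun g hg => ?_⟩
  rw [← ENNReal.pow_le_pow_left_iff (n := 2) (by norm_num), mul_pow, eLpNorm_two_sq,
    eLpNorm_two_sq, lintegral_weightMeasure hφ, ← ENNReal.ofReal_pow (by positivity),
    ← lintegral_const_mul' _ _ ENNReal.ofReal_ne_top]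
  refine lintegral_mono fun z => ?_
  by_cases hz : M < ‖z‖
  · simp [hg z hz]
  · rw [← mul_assoc, ← ENNReal.ofReal_mul (by positivity)]
    refine le_mul_of_one_le_left zero_le ?_
    rw [ENNReal.one_le_ofReal]
    have h1 := ((le_abs_self _).trans (hA z (by simpa using hz))).trans hA1
    have h2 := mul_le_mul_of_nonneg_right h1 (Real.exp_pos (-φ z)).le
    rwa [← Real.exp_add, add_neg_cancel, Real.exp_zero] at h2

theorem memLp_weight_of_memLp {φ : (Fin n → ℂ) → ℝ} (hφ : Continuous φ) {M : ℝ}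
    {g : (Fin n → ℂ) → ℂ} (hg : MemLp g 2 volume) (hM : ∀ z, M < ‖z‖ → g z = 0) :
    MemLp g 2 (weightMeasure φ) := by
  obtain ⟨A, hA, h⟩ := exists_eLpNorm_weight_le hφ M
  exact ⟨hg.1.mono_ac (weightMeasure_absolutelyContinuous φ),
    (h g hM).trans_lt (ENNReal.mul_lt_top hA.lt_top hg.2)⟩

theorem memLp_of_memLp_weight {φ : (Fin n → ℂ) → ℝ} (hφ : Continuous φ) {M : ℝ}
    {g : (Fin n → ℂ) → ℂ} (hg : MemLp g 2 (weightMeasure φ)) (hM : ∀ z, M < ‖z‖ → g z = 0) :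
    MemLp g 2 volume := by
  obtain ⟨A, hA, h⟩ := exists_eLpNorm_le_weight hφ M
  exact ⟨hg.1.mono_ac (absolutelyContinuous_weightMeasure hφ),
    (h g hM).trans_lt (ENNReal.mul_lt_top hA.lt_top hg.2)⟩

theorem ConvL2.weight {φ : (Fin n → ℂ) → ℝ} (hφ : Continuous φ) {h : ℕ → (Fin n → ℂ) → ℂ}
    {f : (Fin n → ℂ) → ℂ} (H : ConvL2 volume h f) {M : ℝ} (hM : ∀ k z, M < ‖z‖ → h k z = 0)
    (hM' : ∀ z, M < ‖z‖ → f z = 0) : ConvL2 (weightMeasure φ) h f := by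
  refine ⟨fun k => memLp_weight_of_memLp hφ (H.1 k) (hM k), memLp_weight_of_memLp hφ H.2.1 hM', ?_⟩
  obtain ⟨A, hA, hle⟩ := exists_eLpNorm_weight_le hφ M
  have ht := ENNReal.Tendsto.const_mul (a := A) H.2.2 (Or.inr hA)
  rw [mul_zero] at ht
  exact tendsto_of_tendsto_of_tendsto_of_le_of_le tendsto_const_nhds ht (fun _ => zero_le)
    fun k => hle _ fun z hz => by rw [hM k z hz, hM' z hz, sub_zero]

theorem memLp_continuous_mul {a g : (Fin n → ℂ) → ℂ} (ha : Continuous a) {M : ℝ}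
    (hg : MemLp g 2 volume) (hM : ∀ z, M < ‖z‖ → g z = 0) :
    MemLp (fun z => a z * g z) 2 volume := by
  obtain ⟨A, hA⟩ := (isCompact_closedBall (0 : Fin n → ℂ) M).exists_bound_of_continuousOn
    ha.continuousOn
  refine hg.of_le_mul (c := A) (ha.aestronglyMeasurable.mul hg.1) (Eventually.of_forall fun z => ?_)
  by_cases hz : M < ‖z‖
  · simp [hM z hz]
  · rw [norm_mul]
    gcongr
    exact hA z (by simpa using hz)

theorem ConvL2.continuous_mul {h : ℕ → (Fin n → ℂ) → ℂ} {a f : (Fin n → ℂ) → ℂ}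
    (ha : Continuous a) (H : ConvL2 volume h f) {M : ℝ} (hM : ∀ k z, M < ‖z‖ → h k z = 0)
    (hM' : ∀ z, M < ‖z‖ → f z = 0) :
    ConvL2 volume (fun k z => a z * h k z) (fun z => a z * f z) := by
  refine ⟨fun k => memLp_continuous_mul ha (H.1 k) (hM k), memLp_continuous_mul ha H.2.1 hM', ?_⟩
  obtain ⟨A, hA⟩ := (isCompact_closedBall (0 : Fin n → ℂ) M).exists_bound_of_continuousOn
    ha.continuousOn
  have ht := ENNReal.Tendsto.const_mul (a := ENNReal.ofReal A) H.2.2 (Or.inr ENNReal.ofReal_ne_top)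
  rw [mul_zero] at ht
  refine tendsto_of_tendsto_of_tendsto_of_le_of_le tendsto_const_nhds ht (fun _ => zero_le)
    fun k => ?_
  refine eLpNorm_le_mul_eLpNorm_of_ae_le_mul (Eventually.of_forall fun z => ?_) 2
  by_cases hz : M < ‖z‖
  · simp [hM k z hz, hM' z hz]
  · rw [← mul_sub, norm_mul]
    gcongr
    exact hA z (by simpa using hz)

theorem energy_eq_integral {φ : (Fin n → ℂ) → ℝ} (hφ : Continuous φ) (f : (Fin n → ℂ) → ℂ) :
    energy φ f = ∫ z, ‖f z‖ ^ 2 ∂(weightMeasure φ) := by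
  have hm : Measurable fun z => Real.toNNReal (Real.exp (-φ z)) :=
    (Real.continuous_exp.comp hφ.neg).measurable.real_toNNReal
  have hw : weightMeasure φ =
      volume.withDensity fun z => ((Real.toNNReal (Real.exp (-φ z)) : NNReal) : ENNReal) := rfl
  rw [hw, integral_withDensity_eq_integral_smul hm, energy]
  refine integral_congr_ae (Eventually.of_forall fun z => ?_)
  simp only [NNReal.smul_def, Real.coe_toNNReal _ (Real.exp_pos _).le, smul_eq_mul]
  ring

theorem energy_eq_eLpNorm {φ : (Fin n → ℂ) → ℝ} (hφ : Continuous φ) {f : (Fin n → ℂ) → ℂ}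
    (hf : AEStronglyMeasurable f (weightMeasure φ)) :
    energy φ f = (eLpNorm f 2 (weightMeasure φ)).toReal ^ 2 := by
  rw [energy_eq_integral hφ, ← ENNReal.toReal_pow, eLpNorm_two_sq,
    integral_eq_lintegral_of_nonneg_ae (Eventually.of_forall fun _ => by positivity)
      (by exact hf.norm.pow 2)]
  congr 1
  refine lintegral_congr fun z => ?_
  rw [ENNReal.ofReal_pow (norm_nonneg _), ofReal_norm]

theorem ConvL2.tendsto_energy {φ : (Fin n → ℂ) → ℝ} (hφ : Continuous φ)
    {h : ℕ → (Fin n → ℂ) → ℂ} {f : (Fin n → ℂ) → ℂ} (H : ConvL2 (weightMeasure φ) h f) :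
    Tendsto (fun k => energy φ (h k)) atTop (𝓝 (energy φ f)) := by
  have h1 := (Lp.tendsto_Lp_iff_tendsto_eLpNorm'' h H.1 f H.2.1).2 H.2.2
  have h2 := h1.norm.pow 2
  simp only [Lp.norm_toLp] at h2
  rw [energy_eq_eLpNorm hφ H.2.1.1]
  exact h2.congr fun k => (energy_eq_eLpNorm hφ (H.1 k).1).symm

/-- A sequence of bump functions whose supports shrink to the origin. -/
def bumpSeq (n k : ℕ) : ContDiffBump (0 : Fin n → ℂ) where
  rIn := 1 / ((k : ℝ) + 2)
  rOut := 1 / ((k : ℝ) + 1)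
  rIn_pos := by positivity
  rIn_lt_rOut := by
    apply one_div_lt_one_div_of_lt <;> first | positivity | linarith

theorem bumpSeq_rOut_le (k : ℕ) : (bumpSeq n k).rOut ≤ 1 := by
  change 1 / ((k : ℝ) + 1) ≤ 1
  rw [div_le_one (by positivity)]
  linarith [(Nat.cast_nonneg k : (0 : ℝ) ≤ k)]

theorem moll_bumpSeq_eq_zero {f : (Fin n → ℂ) → ℂ} {M : ℝ} (hM : ∀ z, M < ‖z‖ → f z = 0) (k : ℕ)
    {z : Fin n → ℂ} (hz : M + 1 < ‖z‖) : moll (bumpSeq n k) f z = 0 :=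
  moll_eq_zero_of_norm_gt _ hM (lt_of_le_of_lt (by linarith [bumpSeq_rOut_le (n := n) k]) hz)

theorem hasCompactSupport_of_norm_gt {f : (Fin n → ℂ) → ℂ} {M : ℝ} (hM : ∀ z, M < ‖z‖ → f z = 0) :
    HasCompactSupport f :=
  HasCompactSupport.intro (isCompact_closedBall 0 M) fun z hz => hM z (by simpa using hz)

theorem convL2_moll {f : (Fin n → ℂ) → ℂ} (hf : MemLp f 2 volume) {M : ℝ}
    (hM : ∀ z, M < ‖z‖ → f z = 0) :
    ConvL2 volume (fun k => moll (bumpSeq n k) f) f := by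
  have hfi : LocallyIntegrable f := hf.locallyIntegrable one_le_two
  refine ⟨fun k => (contDiff_moll _ hfi).continuous.memLp_of_hasCompactSupport
    (hasCompactSupport_of_norm_gt (M := M + 1) fun z hz => moll_bumpSeq_eq_zero hM k hz), hf, ?_⟩
  rw [ENNReal.tendsto_nhds_zero]
  intro ε hε
  obtain ⟨δ, hδ, h⟩ := exists_eLpNorm_moll_sub_le hf hε
  have ht : Tendsto (fun k : ℕ => 1 / ((k : ℝ) + 1)) atTop (𝓝 0) :=
    tendsto_one_div_add_atTop_nhds_zero_nat
  filter_upwards [ht.eventually_lt_const hδ] with k hk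
  exact h _ hk

end Convergence

/-! ### The a priori estimate for weak derivatives -/

section WeakEstimate

variable {n : ℕ}

/-- `∂̄u = v` in the sense of distributions, for forms of mixed degree. -/
def WeakDbarEq (u v : Finset (Fin n) → (Fin n → ℂ) → ℂ) : Prop :=
  ∀ (L : Finset (Fin n)) (ξ : (Fin n → ℂ) → ℂ), ContDiff ℝ ∞ ξ → HasCompactSupport ξ →
    ∫ z, v L z * ξ z = -∑ j ∈ L, sgn L j * ∫ z, u (L.erase j) z * dzbar j ξ z

/-- `∂̄*_φ u = w` in the sense of distributions, where `∂̄*_φ u = ∑_j e_j ⌟ (-∂_j + ∂_jφ) u`. -/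
def WeakDbarStarEq (φ : (Fin n → ℂ) → ℝ) (u w : Finset (Fin n) → (Fin n → ℂ) → ℂ) : Prop :=
  ∀ (K : Finset (Fin n)) (ξ : (Fin n → ℂ) → ℂ), ContDiff ℝ ∞ ξ → HasCompactSupport ξ →
    ∫ z, w K z * ξ z = ∑ j ∈ Kᶜ, sgn K j *
      ∫ z, u (insert j K) z * (dz j ξ z + dz j (fun x => (φ x : ℂ)) z * ξ z)

theorem WeakDbarEq.dbarForm_moll {u v : Finset (Fin n) → (Fin n → ℂ) → ℂ} (h : WeakDbarEq u v)
    (hu : ∀ J, LocallyIntegrable (u J)) (b : ContDiffBump (0 : Fin n → ℂ)) (L : Finset (Fin n)) :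
    dbarForm (fun J => moll b (u J)) L = moll b (v L) := by
  funext z
  have hξ : ContDiff ℝ ∞ fun t => mollKernel b (z - t) :=
    (contDiff_mollKernel b).comp (contDiff_const.sub contDiff_id)
  have hξs : HasCompactSupport fun t => mollKernel b (z - t) :=
    (hasCompactSupport_mollKernel b).comp_homeomorph (Homeomorph.subLeft z)
  have h1 := h L _ hξ hξs
  rw [moll_apply, h1, dbarForm, wedgeSum, ← Finset.sum_neg_distrib]
  refine Finset.sum_congr rfl fun j _ => ?_
  rw [integral_mul_dzbar_mollKernel b (hu _)]
  ring

/-- The commutator of mollification with multiplication by `∂_jφ` is the only error. -/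
theorem WeakDbarStarEq.dbarStarForm_moll {φ : (Fin n → ℂ) → ℝ} (hφ : ContDiff ℝ 2 φ)
    {u w : Finset (Fin n) → (Fin n → ℂ) → ℂ}
    (h : WeakDbarStarEq φ u w) (hu : ∀ J, LocallyIntegrable (u J))
    (b : ContDiffBump (0 : Fin n → ℂ)) (K : Finset (Fin n)) (z : Fin n → ℂ) :
    dbarStarForm φ (fun J => moll b (u J)) K z = moll b (w K) z +
      ∑ j ∈ Kᶜ, sgn K j * (dz j (fun x => (φ x : ℂ)) z * moll b (u (insert j K)) z +
        (-1) * moll b (fun x => dz j (fun x => (φ x : ℂ)) x * u (insert j K) x) z) := by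
  have hξ : ContDiff ℝ ∞ fun t => mollKernel b (z - t) :=
    (contDiff_mollKernel b).comp (contDiff_const.sub contDiff_id)
  have hξs : HasCompactSupport fun t => mollKernel b (z - t) :=
    (hasCompactSupport_mollKernel b).comp_homeomorph (Homeomorph.subLeft z)
  have hφc : ∀ j, Continuous (dz j fun x => (φ x : ℂ)) := fun j =>
    continuous_dz_of_contDiff j ((contDiff_ofReal_comp hφ).of_le one_le_two)
  have h1 := h K _ hξ hξs
  rw [moll_apply b (w K), h1, dbarStarForm, contrSum, ← Finset.sum_add_distrib]
  refine Finset.sum_congr rfl fun j _ => ?_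
  have hi1 : Integrable fun t => u (insert j K) t * dz j (fun t => mollKernel b (z - t)) t := by
    have h2 := (hu (insert j K)).integrable_smul_right_of_hasCompactSupport
      (continuous_dz_of_contDiff j (hξ.of_le (by simp))) (hasCompactSupport_dz j hξs)
    exact h2
  have hi2 : Integrable fun t => u (insert j K) t *
      (dz j (fun x => (φ x : ℂ)) t * mollKernel b (z - t)) := by
    have h2 := (hu (insert j K)).integrable_smul_right_of_hasCompactSupport
      ((hφc j).mul hξ.continuous) hξs.mul_left
    exact h2
  simp only [mul_add]
  rw [integral_add hi1 hi2, integral_mul_dz_mollKernel b (hu _), dstar,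
    moll_apply b (fun x => dz j (fun x => (φ x : ℂ)) x * u (insert j K) x), moll_apply b (u _)]
  have h3 : ∫ t, u (insert j K) t * (dz j (fun x => (φ x : ℂ)) t * mollKernel b (z - t)) =
      ∫ t, dz j (fun x => (φ x : ℂ)) t * u (insert j K) t * mollKernel b (z - t) := by
    refine integral_congr_ae (Eventually.of_forall fun t => ?_)
    simp only
    ring
  rw [h3]
  ring

/-- The a priori estimate passes from smooth forms to compactly supported forms in `L²` by
mollification. -/
theorem weak_estimate_of_compact_support {φ : (Fin n → ℂ) → ℝ} (hφ : ContDiff ℝ 2 φ) {q : ℕ}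
    {C : ℝ} (hC : ∀ u : Finset (Fin n) → (Fin n → ℂ) → ℂ, (∀ J, ContDiff ℝ 2 (u J)) →
      (∀ J, HasCompactSupport (u J)) → (∀ J, J.card ≠ q → u J = 0) →
      ∑ J, energy φ (u J) ≤
        C * (∑ L, energy φ (dbarForm u L) + ∑ K, energy φ (dbarStarForm φ u K)))
    {u v w : Finset (Fin n) → (Fin n → ℂ) → ℂ} (hu : ∀ J, MemLp (u J) 2 volume)
    (hv : ∀ J, MemLp (v J) 2 volume) (hw : ∀ J, MemLp (w J) 2 volume) {M : ℝ}
    (huM : ∀ J z, M < ‖z‖ → u J z = 0) (hvM : ∀ J z, M < ‖z‖ → v J z = 0)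
    (hwM : ∀ J z, M < ‖z‖ → w J z = 0) (huq : ∀ J, J.card ≠ q → u J = 0)
    (huv : WeakDbarEq u v) (huw : WeakDbarStarEq φ u w) :
    ∑ J, energy φ (u J) ≤ C * (∑ L, energy φ (v L) + ∑ K, energy φ (w K)) := by
  have hφc := hφ.continuous
  have hφj : ∀ j, Continuous (dz j fun x => (φ x : ℂ)) := fun j =>
    continuous_dz_of_contDiff j ((contDiff_ofReal_comp hφ).of_le one_le_two)
  have hui : ∀ J, LocallyIntegrable (u J) := fun J => (hu J).locallyIntegrable one_le_two
  let U : ℕ → Finset (Fin n) → (Fin n → ℂ) → ℂ := fun k J => moll (bumpSeq n k) (u J)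
  have huM' : ∀ J z, M + 1 < ‖z‖ → u J z = 0 := fun J z hz => huM J z (by linarith)
  have hUM : ∀ k J z, M + 1 < ‖z‖ → U k J z = 0 := fun k J z hz =>
    moll_bumpSeq_eq_zero (huM J) k hz
  have hUU : ∀ J, ConvL2 volume (fun k => U k J) (u J) := fun J => convL2_moll (hu J) (huM J)
  have h1 : ∀ J, Tendsto (fun k => energy φ (U k J)) atTop (𝓝 (energy φ (u J))) := fun J =>
    ((hUU J).weight hφc (M := M + 1) (fun k z hz => hUM k J z hz) (huM' J)).tendsto_energy hφc
  have h2 : ∀ L, Tendsto (fun k => energy φ (dbarForm (U k) L)) atTop (𝓝 (energy φ (v L))) := by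
    intro L
    have e : ∀ k, dbarForm (U k) L = moll (bumpSeq n k) (v L) := fun k =>
      huv.dbarForm_moll hui _ L
    simp only [e]
    exact ((convL2_moll (hv L) (hvM L)).weight hφc (M := M + 1)
      (fun k z hz => moll_bumpSeq_eq_zero (hvM L) k hz)
      (fun z hz => hvM L z (by linarith))).tendsto_energy hφc
  have h3 : ∀ K, Tendsto (fun k => energy φ (dbarStarForm φ (U k) K)) atTop
      (𝓝 (energy φ (w K))) := by
    intro K
    have hau : ∀ j J z, M < ‖z‖ → dz j (fun x => (φ x : ℂ)) z * u J z = 0 := fun j J z hz => by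
      rw [huM J z hz, mul_zero]
    have hsum := (convL2_moll (hw K) (hwM K)).add (ConvL2.sum Kᶜ fun j _ =>
      (((hUU (insert j K)).continuous_mul (hφj j) (M := M + 1)
        (fun k z hz => hUM k _ z hz) (huM' _)).add
        ((convL2_moll (memLp_continuous_mul (hφj j) (hu (insert j K)) (huM _))
          (hau j (insert j K))).const_mul (-1))).const_mul (sgn K j))
    have hlim : (fun z => w K z + ∑ j ∈ Kᶜ, sgn K j *
        (dz j (fun x => (φ x : ℂ)) z * u (insert j K) z +
          (-1) * (dz j (fun x => (φ x : ℂ)) z * u (insert j K) z))) = w K := by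
      funext z
      simp
    rw [hlim] at hsum
    have e : ∀ k, dbarStarForm φ (U k) K = _ := fun k =>
      funext (huw.dbarStarForm_moll hφ hui (bumpSeq n k) K)
    simp only [e]
    refine (hsum.weight hφc (M := M + 1) (fun k z hz => ?_)
      (fun z hz => hwM K z (by linarith))).tendsto_energy hφc
    rw [moll_bumpSeq_eq_zero (hwM K) k hz, zero_add]
    refine Finset.sum_eq_zero fun j _ => ?_
    rw [hUM k _ z hz, moll_bumpSeq_eq_zero (hau j _) k hz]
    ring
  refine le_of_tendsto_of_tendsto' (tendsto_finsetSum _ fun J _ => h1 J)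
    (((tendsto_finsetSum _ fun L _ => h2 L).add (tendsto_finsetSum _ fun K _ => h3 K)).const_mul C)
    fun k => hC (U k) (fun J => (contDiff_moll _ (hui J)).of_le ENat.LEInfty.out)
      (fun J => hasCompactSupport_of_norm_gt (hUM k J)) fun J hJ => ?_
  funext z
  simp [U, moll_apply, huq J hJ]

end WeakEstimate

/-! ### Removing the support condition by cutoff functions -/

section Cutoff

variable {n : ℕ}

theorem locallyIntegrable_of_memLp_weight {φ : (Fin n → ℂ) → ℝ} (hφ : Continuous φ)
    {g : (Fin n → ℂ) → ℂ} (hg : MemLp g 2 (weightMeasure φ)) : LocallyIntegrable g volume := by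
  rw [locallyIntegrable_iff]
  intro K hK
  obtain ⟨M, hM⟩ := hK.isBounded.subset_closedBall 0
  have h1 : MemLp ((Metric.closedBall 0 M).indicator g) 2 (weightMeasure φ) :=
    hg.indicator measurableSet_closedBall
  have h2 := memLp_of_memLp_weight hφ (M := M) h1 fun z hz =>
    Set.indicator_of_notMem (by simpa using hz) g
  have h3 := (h2.locallyIntegrable one_le_two).integrableOn_isCompact hK
  exact h3.congr_fun (fun z hz => Set.indicator_of_mem (hM hz) g) hK.measurableSet

theorem exists_norm_gt_eq_zero {χ : (Fin n → ℂ) → ℂ} (hs : HasCompactSupport χ) :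
    ∃ M : ℝ, ∀ z, M < ‖z‖ → χ z = 0 ∧ (∀ j, dz j χ z = 0) ∧ ∀ j, dzbar j χ z = 0 := by
  obtain ⟨M, hM⟩ := hs.isCompact.isBounded.subset_closedBall 0
  refine ⟨M, fun z hz => ?_⟩
  have hz' : z ∉ tsupport χ := fun h => by
    have := hM h
    rw [mem_closedBall_zero_iff] at this
    linarith
  have hf : fderiv ℝ χ z = 0 := fderiv_of_notMem_tsupport ℝ hz'
  exact ⟨image_eq_zero_of_notMem_tsupport hz', fun j => dz_eq_zero_of_fderiv hf,
    fun j => dzbar_eq_zero_of_fderiv hf⟩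

/-- Cutoff functions `χ(z / (k + 1))`: bounded, with bounded derivatives, and eventually equal to
`1` near every point. -/
theorem exists_cutoff_seq (n : ℕ) : ∃ (χ : ℕ → (Fin n → ℂ) → ℂ) (A : ℝ), 0 ≤ A ∧
    (∀ k, ContDiff ℝ ∞ (χ k)) ∧ (∀ k, HasCompactSupport (χ k)) ∧ (∀ k z, ‖χ k z‖ ≤ 1) ∧
    (∀ k j z, ‖dz j (χ k) z‖ ≤ A) ∧ (∀ k j z, ‖dzbar j (χ k) z‖ ≤ A) ∧
    ∀ z, ∀ᶠ k in atTop, χ k =ᶠ[𝓝 z] fun _ => 1 := by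
  let b : ContDiffBump (0 : Fin n → ℂ) := ⟨1, 2, one_pos, one_lt_two⟩
  let β : (Fin n → ℂ) → ℂ := fun z => (b z : ℂ)
  have hβ : ContDiff ℝ ∞ β := contDiff_ofReal_comp b.contDiff
  have hβs : HasCompactSupport β := b.hasCompactSupport.comp_left (g := Complex.ofReal) (by simp)
  obtain ⟨B, hB⟩ := (hβs.fderiv ℝ).exists_bound_of_continuous (hβ.continuous_fderiv (by simp))
  have hB0 : 0 ≤ B := (norm_nonneg _).trans (hB 0)
  let c : ℕ → ℝ := fun k => 1 / ((k : ℝ) + 1)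
  have hc0 : ∀ k, 0 < c k := fun k => by positivity
  have hc1 : ∀ k, c k ≤ 1 := fun k => by
    simp only [c]
    rw [div_le_one (by positivity)]
    linarith [(Nat.cast_nonneg k : (0 : ℝ) ≤ k)]
  let χ : ℕ → (Fin n → ℂ) → ℂ := fun k z => β (c k • z)
  have hfd : ∀ k z v, ‖fderiv ℝ (χ k) z v‖ ≤ B * ‖v‖ := by
    intro k z v
    have h1 : HasFDerivAt (fun w : Fin n → ℂ => c k • w)
        (c k • ContinuousLinearMap.id ℝ (Fin n → ℂ)) z := (hasFDerivAt_id z).const_smul (c k)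
    have h2 := ((hβ.differentiable (by simp) (c k • z)).hasFDerivAt).comp z h1
    have h3 : fderiv ℝ (χ k) z = _ := h2.fderiv
    rw [h3]
    simp only [ContinuousLinearMap.comp_apply, smul_apply, ContinuousLinearMap.id_apply, map_smul]
    rw [norm_smul, Real.norm_of_nonneg (hc0 k).le]
    calc c k * ‖fderiv ℝ β (c k • z) v‖ ≤ 1 * (B * ‖v‖) := by
          gcongr
          · exact hc1 k
          · exact (ContinuousLinearMap.le_opNorm _ _).trans (by gcongr; exact hB _)
      _ = B * ‖v‖ := one_mul _
  have hs1 : ∀ j : Fin n, ‖(Pi.single j 1 : Fin n → ℂ)‖ = 1 := fun j => by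
    rw [Pi.norm_single]; simp
  have hsI : ∀ j : Fin n, ‖(Pi.single j Complex.I : Fin n → ℂ)‖ = 1 := fun j => by
    rw [Pi.norm_single]; simp
  refine ⟨χ, B, hB0, fun k => hβ.comp (contDiff_const_smul _), fun k => ?_, fun k z => ?_,
    fun k j z => ?_, fun k j z => ?_, fun z => ?_⟩
  · exact hβs.comp_homeomorph (Homeomorph.smulOfNeZero (c k) (hc0 k).ne')
  · simp only [χ, β, Complex.norm_real, Real.norm_of_nonneg b.nonneg]
    exact b.le_one
  · have h1 := hfd k z (Pi.single j 1)
    have h2 := hfd k z (Pi.single j Complex.I)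
    rw [hs1, mul_one] at h1
    rw [hsI, mul_one] at h2
    rw [dz, norm_div, Complex.norm_two, div_le_iff₀ two_pos]
    refine (norm_sub_le _ _).trans ?_
    rw [norm_mul, Complex.norm_I, one_mul]
    linarith
  · have h1 := hfd k z (Pi.single j 1)
    have h2 := hfd k z (Pi.single j Complex.I)
    rw [hs1, mul_one] at h1
    rw [hsI, mul_one] at h2
    rw [dzbar, norm_div, Complex.norm_two, div_le_iff₀ two_pos]
    refine (norm_add_le _ _).trans ?_
    rw [norm_mul, Complex.norm_I, one_mul]
    linarith
  · obtain ⟨k₀, hk₀⟩ := exists_nat_gt ‖z‖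
    filter_upwards [eventually_ge_atTop k₀] with k hk
    have hz : ‖z‖ < (k : ℝ) + 1 := by
      have : (k₀ : ℝ) ≤ k := by exact_mod_cast hk
      linarith
    filter_upwards [(isOpen_lt continuous_norm continuous_const).mem_nhds hz] with w hw
    have hw' : c k • w ∈ Metric.closedBall (0 : Fin n → ℂ) 1 := by
      rw [mem_closedBall_zero_iff, norm_smul, Real.norm_of_nonneg (hc0 k).le]
      simp only [c]
      rw [div_mul_eq_mul_div, one_mul, div_le_one (by positivity)]
      exact le_of_lt hw
    simp only [χ, β, b.one_of_mem_closedBall hw', Complex.ofReal_one]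

theorem integrable_mul_of_locallyIntegrable {f g : (Fin n → ℂ) → ℂ}
    (hf : LocallyIntegrable f) (hg : Continuous g) (hs : HasCompactSupport g) :
    Integrable fun z => f z * g z :=
  hf.integrable_smul_right_of_hasCompactSupport hg hs

/-- The Leibniz rule `∂̄(χ u) = χ ∂̄u + ∂̄χ ∧ u`. -/
theorem WeakDbarEq.cutoff {u v : Finset (Fin n) → (Fin n → ℂ) → ℂ} (h : WeakDbarEq u v)
    (hu : ∀ J, LocallyIntegrable (u J)) (hv : ∀ J, LocallyIntegrable (v J))
    {χ : (Fin n → ℂ) → ℂ} (hχ : ContDiff ℝ ∞ χ) :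
    WeakDbarEq (fun J z => χ z * u J z)
      (fun L z => χ z * v L z + ∑ j ∈ L, sgn L j * (dzbar j χ z * u (L.erase j) z)) := by
  intro L ξ hξ hξs
  have hcξ := hξ.continuous
  have hcχ := hχ.continuous
  have hcχ' := fun j => continuous_dzbar_of_contDiff j (hχ.of_le (m := 1) (by simp))
  have hcξ' := fun j => continuous_dzbar_of_contDiff j (hξ.of_le (m := 1) (by simp))
  have h1 := h L (fun z => χ z * ξ z) (hχ.mul hξ) hξs.mul_left
  have hi1 : Integrable fun z => v L z * (χ z * ξ z) :=
    integrable_mul_of_locallyIntegrable (hv L) (hcχ.mul hcξ) hξs.mul_left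
  have hi2 : ∀ j J, Integrable fun z => u J z * (dzbar j χ z * ξ z) := fun j J =>
    integrable_mul_of_locallyIntegrable (hu J) ((hcχ' j).mul hcξ) hξs.mul_left
  have hi3 : ∀ j J, Integrable fun z => u J z * (χ z * dzbar j ξ z) := fun j J =>
    integrable_mul_of_locallyIntegrable (hu J) (hcχ.mul (hcξ' j))
      (hasCompactSupport_dzbar j hξs).mul_left
  have hpt : ∀ z, (χ z * v L z + ∑ j ∈ L, sgn L j * (dzbar j χ z * u (L.erase j) z)) * ξ z =
      v L z * (χ z * ξ z) + ∑ j ∈ L, sgn L j * (u (L.erase j) z * (dzbar j χ z * ξ z)) := by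
    intro z
    rw [add_mul, Finset.sum_mul]
    congr 1
    · ring
    · exact Finset.sum_congr rfl fun j _ => by ring
  simp only [hpt]
  rw [integral_add hi1 (integrable_finsetSum _ fun j _ => (hi2 j _).const_mul _), h1,
    integral_finsetSum _ fun j _ => (hi2 j _).const_mul _, ← Finset.sum_neg_distrib,
    ← Finset.sum_neg_distrib, ← Finset.sum_add_distrib]
  refine Finset.sum_congr rfl fun j _ => ?_
  have hpt2 : ∀ z, u (L.erase j) z * dzbar j (fun z => χ z * ξ z) z =
      u (L.erase j) z * (dzbar j χ z * ξ z) + u (L.erase j) z * (χ z * dzbar j ξ z) := by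
    intro z
    rw [dzbar_mul j (hχ.differentiable (by simp) z) (hξ.differentiable (by simp) z)]
    ring
  simp only [hpt2]
  rw [integral_add (hi2 j _) (hi3 j _), integral_const_mul]
  have e : ∀ z, χ z * u (L.erase j) z * dzbar j ξ z = u (L.erase j) z * (χ z * dzbar j ξ z) :=
    fun z => by ring
  simp only [e]
  ring

/-- The Leibniz rule for `∂̄*_φ (χ u)`. -/
theorem WeakDbarStarEq.cutoff {φ : (Fin n → ℂ) → ℝ} (hφ : ContDiff ℝ 2 φ)
    {u w : Finset (Fin n) → (Fin n → ℂ) → ℂ} (h : WeakDbarStarEq φ u w)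
    (hu : ∀ J, LocallyIntegrable (u J)) (hw : ∀ J, LocallyIntegrable (w J))
    {χ : (Fin n → ℂ) → ℂ} (hχ : ContDiff ℝ ∞ χ) :
    WeakDbarStarEq φ (fun J z => χ z * u J z)
      (fun K z => χ z * w K z + ∑ j ∈ Kᶜ, -sgn K j * (dz j χ z * u (insert j K) z)) := by
  intro K ξ hξ hξs
  have hcξ := hξ.continuous
  have hcχ := hχ.continuous
  have hcχ' := fun j => continuous_dz_of_contDiff j (hχ.of_le (m := 1) (by simp))
  have hcξ' := fun j => continuous_dz_of_contDiff j (hξ.of_le (m := 1) (by simp))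
  have hφc : ∀ j, Continuous (dz j fun x => (φ x : ℂ)) := fun j =>
    continuous_dz_of_contDiff j ((contDiff_ofReal_comp hφ).of_le one_le_two)
  have h1 := h K (fun z => χ z * ξ z) (hχ.mul hξ) hξs.mul_left
  have hi1 : Integrable fun z => w K z * (χ z * ξ z) :=
    integrable_mul_of_locallyIntegrable (hw K) (hcχ.mul hcξ) hξs.mul_left
  have hi2 : ∀ j J, Integrable fun z => u J z * (dz j χ z * ξ z) := fun j J =>
    integrable_mul_of_locallyIntegrable (hu J) ((hcχ' j).mul hcξ) hξs.mul_left
  have hi3 : ∀ j J, Integrable fun z =>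
      u J z * (χ z * dz j ξ z + χ z * (dz j (fun x => (φ x : ℂ)) z * ξ z)) := fun j J =>
    integrable_mul_of_locallyIntegrable (hu J)
      ((hcχ.mul (hcξ' j)).add (hcχ.mul ((hφc j).mul hcξ)))
      ((hasCompactSupport_dz j hξs).mul_left.add hξs.mul_left.mul_left)
  have hpt : ∀ z, (χ z * w K z + ∑ j ∈ Kᶜ, -sgn K j * (dz j χ z * u (insert j K) z)) * ξ z =
      w K z * (χ z * ξ z) + ∑ j ∈ Kᶜ, -sgn K j * (u (insert j K) z * (dz j χ z * ξ z)) := by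
    intro z
    rw [add_mul, Finset.sum_mul]
    congr 1
    · ring
    · exact Finset.sum_congr rfl fun j _ => by ring
  simp only [hpt]
  rw [integral_add hi1 (integrable_finsetSum _ fun j _ => (hi2 j _).const_mul _), h1,
    integral_finsetSum _ fun j _ => (hi2 j _).const_mul _, ← Finset.sum_add_distrib]
  refine Finset.sum_congr rfl fun j _ => ?_
  have hpt2 : ∀ z, u (insert j K) z * (dz j (fun z => χ z * ξ z) z +
      dz j (fun x => (φ x : ℂ)) z * (χ z * ξ z)) =
      u (insert j K) z * (dz j χ z * ξ z) +
        u (insert j K) z * (χ z * dz j ξ z + χ z * (dz j (fun x => (φ x : ℂ)) z * ξ z)) := by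
    intro z
    rw [dz_mul j (hχ.differentiable (by simp) z) (hξ.differentiable (by simp) z)]
    ring
  simp only [hpt2]
  rw [integral_add (hi2 j _) (hi3 j _), integral_const_mul]
  have e : ∀ z, χ z * u (insert j K) z * (dz j ξ z + dz j (fun x => (φ x : ℂ)) z * ξ z) =
      u (insert j K) z * (χ z * dz j ξ z + χ z * (dz j (fun x => (φ x : ℂ)) z * ξ z)) :=
    fun z => by ring
  simp only [e]
  ring

theorem tendsto_energy_of_dominated {φ : (Fin n → ℂ) → ℝ} (hφ : Continuous φ)
    {h : ℕ → (Fin n → ℂ) → ℂ} {f : (Fin n → ℂ) → ℂ} {G : (Fin n → ℂ) → ℝ}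
    (hm : ∀ k, AEStronglyMeasurable (h k) (weightMeasure φ)) (hG : MemLp G 2 (weightMeasure φ))
    (hb : ∀ k z, ‖h k z‖ ≤ G z) (hev : ∀ z, ∀ᶠ k in atTop, h k z = f z) :
    Tendsto (fun k => energy φ (h k)) atTop (𝓝 (energy φ f)) := by
  simp only [energy_eq_integral hφ]
  refine tendsto_integral_of_dominated_convergence (fun z => G z ^ 2)
    (fun k => by exact (hm k).norm.pow 2) hG.integrable_sq
    (fun k => Eventually.of_forall fun z => ?_) (Eventually.of_forall fun z => ?_)
  · rw [Real.norm_of_nonneg (by positivity)]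
    gcongr
    exact hb k z
  · exact tendsto_const_nhds.congr' ((hev z).mono fun k hk => by simp only [hk])

/-- The coefficients of a cut-off derivative converge in norm, by dominated convergence. -/
theorem tendsto_energy_cutoff_add {φ : (Fin n → ℂ) → ℝ} (hφ : Continuous φ) {A : ℝ}
    {χ : ℕ → (Fin n → ℂ) → ℂ} (hχ : ∀ k, Continuous (χ k)) (hχ1 : ∀ k z, ‖χ k z‖ ≤ 1)
    {ι : Type*} (s : Finset ι) {d : ι → ℕ → (Fin n → ℂ) → ℂ} (hd : ∀ i k, Continuous (d i k))
    (hdA : ∀ i k z, ‖d i k z‖ ≤ A) {c : ι → ℂ} (hc : ∀ i, ‖c i‖ = 1)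
    (hev : ∀ z, ∀ᶠ k in atTop, χ k z = 1 ∧ ∀ i, d i k z = 0) {v : (Fin n → ℂ) → ℂ}
    (hv : MemLp v 2 (weightMeasure φ)) {u : ι → (Fin n → ℂ) → ℂ}
    (hu : ∀ i, MemLp (u i) 2 (weightMeasure φ)) :
    Tendsto (fun k => energy φ fun z => χ k z * v z + ∑ i ∈ s, c i * (d i k z * u i z)) atTop
      (𝓝 (energy φ v)) := by
  refine tendsto_energy_of_dominated hφ (G := fun z => ‖v z‖ + ∑ i ∈ s, A * ‖u i z‖)
    (fun k => ?_) ?_ (fun k z => ?_) fun z => ?_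
  · exact ((hχ k).aestronglyMeasurable.mul hv.1).add (Finset.aestronglyMeasurable_fun_sum _
      fun i _ => ((hd i k).aestronglyMeasurable.mul (hu i).1).const_mul (c i))
  · exact hv.norm.add (memLp_finsetSum _ fun i _ => (hu i).norm.const_mul A)
  · refine (norm_add_le _ _).trans (add_le_add ?_ ((norm_sum_le _ _).trans
      (Finset.sum_le_sum fun i _ => ?_)))
    · rw [norm_mul]
      exact mul_le_of_le_one_left (norm_nonneg _) (hχ1 k z)
    · rw [norm_mul, norm_mul, hc, one_mul]
      gcongr
      exact hdA i k z
  · filter_upwards [hev z] with k hk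
    simp [hk.1, hk.2]

/-- The a priori estimate for all forms with `∂̄u` and `∂̄*_φ u` in `L²` in the sense of
distributions, by cutoff functions with bounded derivatives. -/
theorem weak_estimate {φ : (Fin n → ℂ) → ℝ} (hφ : ContDiff ℝ 2 φ) {q : ℕ} {C : ℝ}
    (hC : ∀ u : Finset (Fin n) → (Fin n → ℂ) → ℂ, (∀ J, ContDiff ℝ 2 (u J)) →
      (∀ J, HasCompactSupport (u J)) → (∀ J, J.card ≠ q → u J = 0) →
      ∑ J, energy φ (u J) ≤
        C * (∑ L, energy φ (dbarForm u L) + ∑ K, energy φ (dbarStarForm φ u K)))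
    {u v w : Finset (Fin n) → (Fin n → ℂ) → ℂ} (hu : ∀ J, MemLp (u J) 2 (weightMeasure φ))
    (hv : ∀ J, MemLp (v J) 2 (weightMeasure φ)) (hw : ∀ J, MemLp (w J) 2 (weightMeasure φ))
    (huq : ∀ J, J.card ≠ q → u J = 0) (huv : WeakDbarEq u v) (huw : WeakDbarStarEq φ u w) :
    ∑ J, energy φ (u J) ≤ C * (∑ L, energy φ (v L) + ∑ K, energy φ (w K)) := by
  have hφc := hφ.continuous
  obtain ⟨χ, A, hA, hχ, hχs, hχ1, hχz, hχb, hχe⟩ := exists_cutoff_seq n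
  have hcχ : ∀ k, Continuous (χ k) := fun k => (hχ k).continuous
  have hcz : ∀ j k, Continuous (dz j (χ k)) := fun j k =>
    continuous_dz_of_contDiff j ((hχ k).of_le (by simp))
  have hcb : ∀ j k, Continuous (dzbar j (χ k)) := fun j k =>
    continuous_dzbar_of_contDiff j ((hχ k).of_le (by simp))
  have hui := fun J => locallyIntegrable_of_memLp_weight hφc (hu J)
  have hvi := fun J => locallyIntegrable_of_memLp_weight hφc (hv J)
  have hwi := fun J => locallyIntegrable_of_memLp_weight hφc (hw J)
  have hev1 : ∀ z, ∀ᶠ k in atTop, χ k z = 1 ∧ ∀ j, dz j (χ k) z = 0 := fun z => by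
    filter_upwards [hχe z] with k hk
    exact ⟨hk.eq_of_nhds, fun j => dz_eq_zero_of_fderiv (by rw [hk.fderiv_eq]; simp)⟩
  have hev2 : ∀ z, ∀ᶠ k in atTop, χ k z = 1 ∧ ∀ j, dzbar j (χ k) z = 0 := fun z => by
    filter_upwards [hχe z] with k hk
    exact ⟨hk.eq_of_nhds, fun j => dzbar_eq_zero_of_fderiv (by rw [hk.fderiv_eq]; simp)⟩
  let U : ℕ → Finset (Fin n) → (Fin n → ℂ) → ℂ := fun k J z => χ k z * u J z
  let V : ℕ → Finset (Fin n) → (Fin n → ℂ) → ℂ := fun k L z =>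
    χ k z * v L z + ∑ j ∈ L, sgn L j * (dzbar j (χ k) z * u (L.erase j) z)
  let W : ℕ → Finset (Fin n) → (Fin n → ℂ) → ℂ := fun k K z =>
    χ k z * w K z + ∑ j ∈ Kᶜ, -sgn K j * (dz j (χ k) z * u (insert j K) z)
  have h1 : ∀ J, Tendsto (fun k => energy φ (U k J)) atTop (𝓝 (energy φ (u J))) := fun J => by
    have := tendsto_energy_cutoff_add hφc hcχ hχ1 (∅ : Finset (Fin n)) hcz
      (fun j k z => hχz k j z) (c := fun _ => 1) (by simp) hev1 (hu J) (u := fun _ => u J)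
      (fun _ => hu J)
    simpa using this
  have h2 : ∀ L, Tendsto (fun k => energy φ (V k L)) atTop (𝓝 (energy φ (v L))) := fun L =>
    tendsto_energy_cutoff_add hφc hcχ hχ1 L hcb (fun j k z => hχb k j z) (c := sgn L)
      (fun j => norm_sgn L j) hev2 (hv L) fun _ => hu _
  have h3 : ∀ K, Tendsto (fun k => energy φ (W k K)) atTop (𝓝 (energy φ (w K))) := fun K =>
    tendsto_energy_cutoff_add hφc hcχ hχ1 Kᶜ hcz (fun j k z => hχz k j z) (c := fun j => -sgn K j)
      (fun j => by rw [norm_neg, norm_sgn]) hev1 (hw K) fun _ => hu _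
  refine le_of_tendsto_of_tendsto' (tendsto_finsetSum _ fun J _ => h1 J)
    (((tendsto_finsetSum _ fun L _ => h2 L).add (tendsto_finsetSum _ fun K _ => h3 K)).const_mul C)
    fun k => ?_
  obtain ⟨M, hM⟩ := exists_norm_gt_eq_zero (hχs k)
  have hUM : ∀ J z, M < ‖z‖ → U k J z = 0 := fun J z hz => by simp [U, (hM z hz).1]
  have hVM : ∀ J z, M < ‖z‖ → V k J z = 0 := fun J z hz => by
    simp [V, (hM z hz).1, (hM z hz).2.2]
  have hWM : ∀ J z, M < ‖z‖ → W k J z = 0 := fun J z hz => by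
    simp [W, (hM z hz).1, (hM z hz).2.1]
  have hbd : ∀ {a f : (Fin n → ℂ) → ℂ} {B : ℝ}, Continuous a → (∀ z, ‖a z‖ ≤ B) →
      MemLp f 2 (weightMeasure φ) → MemLp (fun z => a z * f z) 2 (weightMeasure φ) := by
    intro a f B ha hB hf
    refine hf.of_le_mul (c := B) (ha.aestronglyMeasurable.mul hf.1)
      (Eventually.of_forall fun z => ?_)
    rw [norm_mul]
    gcongr
    exact hB z
  have hUL : ∀ J, MemLp (U k J) 2 (weightMeasure φ) := fun J => hbd (hcχ k) (hχ1 k) (hu J)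
  have hVL : ∀ J, MemLp (V k J) 2 (weightMeasure φ) := fun J =>
    (hbd (hcχ k) (hχ1 k) (hv J)).add (memLp_finsetSum _ fun j _ =>
      (hbd (hcb j k) (hχb k j) (hu _)).const_mul _)
  have hWL : ∀ J, MemLp (W k J) 2 (weightMeasure φ) := fun J =>
    (hbd (hcχ k) (hχ1 k) (hw J)).add (memLp_finsetSum _ fun j _ =>
      (hbd (hcz j k) (hχz k j) (hu _)).const_mul _)
  refine weak_estimate_of_compact_support hφ hC
    (fun J => memLp_of_memLp_weight hφc (hUL J) (hUM J))
    (fun J => memLp_of_memLp_weight hφc (hVL J) (hVM J))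
    (fun J => memLp_of_memLp_weight hφc (hWL J) (hWM J)) hUM hVM hWM (fun J hJ => ?_)
    (huv.cutoff hui hvi (hχ k)) (huw.cutoff hφ hui hwi (hχ k))
  funext z
  simp [U, huq J hJ]

end Cutoff

/-! ### The operator `∂̄` on the weighted `L²` spaces -/

section Operator

open scoped ComplexConjugate

variable {n : ℕ} {φ : (Fin n → ℂ) → ℝ}

/-- The coefficient functions of a form of degree `q`, extended by zero to multi-indices of other
degrees. -/
def coeff {q : ℕ} (u : L2Form φ q) (J : Finset (Fin n)) : (Fin n → ℂ) → ℂ :=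
  if h : J.card = q then (u ⟨J, h⟩ : (Fin n → ℂ) → ℂ) else 0

theorem coeff_coe {q : ℕ} (u : L2Form φ q) (J : MultiIdx n q) : coeff u J.1 = u J :=
  dif_pos J.2

theorem coeff_eq_zero {q : ℕ} (u : L2Form φ q) {J : Finset (Fin n)} (hJ : J.card ≠ q) :
    coeff u J = 0 := dif_neg hJ

theorem memLp_coeff {q : ℕ} (u : L2Form φ q) (J : Finset (Fin n)) :
    MemLp (coeff u J) 2 (weightMeasure φ) := by
  unfold coeff
  split_ifs with h
  · exact Lp.memLp _
  · exact MemLp.zero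

theorem sum_multiIdx {M : Type*} [AddCommMonoid M] {q : ℕ} (f : Finset (Fin n) → M)
    (hf : ∀ J, J.card ≠ q → f J = 0) : ∑ J : MultiIdx n q, f J.1 = ∑ J, f J := by
  rw [← Finset.sum_subtype (Finset.univ.filter fun J : Finset (Fin n) => J.card = q) (by simp) f]
  refine Finset.sum_filter_of_ne fun J _ h => ?_
  by_contra hJ
  exact h (hf J hJ)

theorem sum_energy_coeff (hφ : Continuous φ) {q : ℕ} (u : L2Form φ q) :
    ∑ J, energy φ (coeff u J) = ‖u‖ ^ 2 := by
  rw [← sum_multiIdx (q := q) _ fun J hJ => by simp [coeff_eq_zero u hJ, energy],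
    PiLp.norm_sq_eq_of_L2]
  refine Finset.sum_congr rfl fun J _ => ?_
  rw [coeff_coe, energy_eq_eLpNorm hφ (Lp.aestronglyMeasurable _), ← Lp.norm_def]

theorem weakDbarEq_coeff_iff {p q : ℕ} (h : p + 1 = q) (u : L2Form φ p) (v : L2Form φ q) :
    WeakDbarEq (coeff u) (coeff v) ↔ IsWeakDbar φ h u v := by
  have key : ∀ (L : MultiIdx n q) (χ : (Fin n → ℂ) → ℂ),
      ∑ j : L.1, L.sign j * ∫ z, (u (L.erase h j) : (Fin n → ℂ) → ℂ) z * dzbar j.1 χ z =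
        ∑ j ∈ L.1, sgn L.1 j * ∫ z, coeff u (L.1.erase j) z * dzbar j χ z := by
    intro L χ
    rw [← Finset.sum_coe_sort L.1]
    refine Finset.sum_congr rfl fun j _ => ?_
    rw [← coeff_coe u (L.erase h j)]
    rfl
  constructor
  · intro H L χ hχ hs
    rw [key, ← coeff_coe v L]
    exact H L.1 χ hχ hs
  · intro H L χ hχ hs
    by_cases hL : L.card = q
    · have := H ⟨L, hL⟩ χ hχ hs
      rwa [key, ← coeff_coe v ⟨L, hL⟩] at this
    · rw [coeff_eq_zero v hL, Finset.sum_eq_zero]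
      · simp
      · intro j hj
        have hj' : (L.erase j).card ≠ p := by
          rw [Finset.card_erase_of_mem hj]
          have := Finset.card_pos.2 ⟨j, hj⟩
          omega
        simp [coeff_eq_zero u hj']

theorem sgn_mul_sgn_erase {L : Finset (Fin n)} {j k : Fin n} (hj : j ∈ L) (hk : k ∈ L)
    (h : j ≠ k) : sgn L j * sgn (L.erase j) k = -(sgn L k * sgn (L.erase k) j) := by
  obtain ⟨K, hjK, hkK, rfl⟩ : ∃ K, j ∉ K ∧ k ∉ K ∧ L = insert j (insert k K) :=
    ⟨(L.erase j).erase k, by simp, by simp, by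
      rw [Finset.insert_erase (Finset.mem_erase.2 ⟨h.symm, hk⟩), Finset.insert_erase hj]⟩
  have e1 : (insert j (insert k K)).erase j = insert k K :=
    Finset.erase_insert (by simp [h, hjK])
  have e2 : (insert j (insert k K)).erase k = insert j K := by
    rw [Finset.insert_comm]; exact Finset.erase_insert (by simp [h.symm, hkK])
  have h0 := sgn_insert_insert hjK hkK h
  have h1 := sgn_mul_self (insert j (insert k K)) k
  have h2 := sgn_mul_self K k
  rw [e1, e2, sgn_insert_self K k, sgn_insert_self K j]
  linear_combination sgn (insert j (insert k K)) k * sgn K k * h0 -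
    sgn (insert j (insert k K)) j * sgn K k * h1 - sgn (insert j (insert k K)) k * sgn K j * h2

/-- `∂̄ ∘ ∂̄ = 0`, because mixed derivatives of test functions commute. -/
theorem WeakDbarEq.dbar_dbar {u v : Finset (Fin n) → (Fin n → ℂ) → ℂ} (h : WeakDbarEq u v) :
    WeakDbarEq v 0 := by
  intro L ξ hξ hξs
  have hc : ∀ j, ContDiff ℝ ∞ (dzbar j ξ) := fun j => contDiff_dzbar j hξ (by simp)
  let a : Fin n → Fin n → ℂ := fun j k => if j ≠ k then sgn L j * (sgn (L.erase j) k *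
    ∫ z, u ((L.erase j).erase k) z * dzbar k (dzbar j ξ) z) else 0
  have ha : ∀ j ∈ L, ∀ k ∈ L, a j k = -a k j := by
    intro j hj k hk
    by_cases hjk : j = k
    · simp [a, hjk]
    · have e : dzbar k (dzbar j ξ) = dzbar j (dzbar k ξ) :=
        funext fun z => dzbar_dzbar_comm j k (hξ.of_le (WithTop.coe_le_coe.2 le_top)) z
      simp only [a, if_pos hjk, if_pos (Ne.symm hjk), Finset.erase_right_comm (a := j) (b := k), e]
      rw [← mul_assoc, sgn_mul_sgn_erase hj hk hjk]
      ring
  have h0 : ∑ j ∈ L, ∑ k ∈ L, a j k = 0 := by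
    have h1 : ∑ j ∈ L, ∑ k ∈ L, a j k = -∑ j ∈ L, ∑ k ∈ L, a j k := by
      conv_lhs => rw [Finset.sum_comm]
      rw [← Finset.sum_neg_distrib]
      refine Finset.sum_congr rfl fun j hj => ?_
      rw [← Finset.sum_neg_distrib]
      exact Finset.sum_congr rfl fun k hk => ha k hk j hj
    exact self_eq_neg.1 h1
  have h2 : ∀ j ∈ L, sgn L j * ∫ z, v (L.erase j) z * dzbar j ξ z = -∑ k ∈ L, a j k := by
    intro j _
    rw [h (L.erase j) _ (hc j) (hasCompactSupport_dzbar j hξs), mul_neg, Finset.mul_sum]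
    congr 1
    have : L.erase j = L.filter fun k => j ≠ k := by ext k; simp [and_comm, eq_comm]
    conv_lhs => enter [1]; rw [this]
    rw [Finset.sum_filter]
  rw [Finset.sum_congr rfl h2, Finset.sum_neg_distrib, h0]
  simp

theorem dbar_dbar (hφ : Continuous φ) {p q r : ℕ} (h : p + 1 = q) (h' : q + 1 = r)
    (u : L2Form φ p) (v : L2Form φ q) (huv : (u, v) ∈ (dbar hφ h).graph) :
    (v, (0 : L2Form φ r)) ∈ (dbar hφ h').graph := by
  rw [mem_graph_dbar] at huv ⊢
  have H := ((weakDbarEq_coeff_iff h u v).2 huv).dbar_dbar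
  intro L χ hχ hs
  have H' := (weakDbarEq_coeff_iff h u v).2 huv
  have h1 := H L.1 χ hχ hs
  simp only [Pi.zero_apply, zero_mul, integral_zero] at h1
  rw [PiLp.zero_apply, integral_zero_mul hφ, h1, ← Finset.sum_coe_sort L.1]
  congr 1
  refine Finset.sum_congr rfl fun j _ => ?_
  rw [← coeff_coe v (L.erase h' j)]
  rfl

theorem wt_mul_wt_neg (φ : (Fin n → ℂ) → ℝ) (z : Fin n → ℂ) :
    wt φ z * wt (fun w => -φ w) z = 1 := by
  rw [wt, wt, ← Complex.ofReal_mul, ← Real.exp_add]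
  simp

theorem integral_weightMeasure (hφ : Continuous φ) (g : (Fin n → ℂ) → ℂ) :
    ∫ z, g z ∂(weightMeasure φ) = ∫ z, g z * wt φ z := by
  have hm : Measurable fun z => Real.toNNReal (Real.exp (-φ z)) :=
    (Real.continuous_exp.comp hφ.neg).measurable.real_toNNReal
  have hw : weightMeasure φ =
      volume.withDensity fun z => ((Real.toNNReal (Real.exp (-φ z)) : NNReal) : ENNReal) := rfl
  rw [hw, integral_withDensity_eq_integral_smul hm]
  refine integral_congr_ae (Eventually.of_forall fun z => ?_)
  simp only [NNReal.smul_def, Real.coe_toNNReal _ (Real.exp_pos _).le, Complex.real_smul, wt]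
  ring

theorem memLp_weight_of_continuous (hφ : Continuous φ) {g : (Fin n → ℂ) → ℂ} (hg : Continuous g)
    (hs : HasCompactSupport g) : MemLp g 2 (weightMeasure φ) := by
  obtain ⟨M, hM⟩ := hs.isCompact.isBounded.subset_closedBall 0
  refine memLp_weight_of_memLp hφ (M := M) (hg.memLp_of_hasCompactSupport hs) fun z hz => ?_
  refine image_eq_zero_of_notMem_tsupport fun h => ?_
  have := mem_closedBall_zero_iff.1 (hM h)
  linarith

theorem inner_toLp (hφ : Continuous φ) {g : (Fin n → ℂ) → ℂ} (hg : MemLp g 2 (weightMeasure φ))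
    (f : Lp ℂ 2 (weightMeasure φ)) :
    inner ℂ (hg.toLp g) f = ∫ z, (f : (Fin n → ℂ) → ℂ) z * (conj (g z) * wt φ z) := by
  rw [L2.inner_def, integral_weightMeasure hφ]
  refine integral_congr_ae ?_
  filter_upwards [ae_volume_of_ae_weight hφ hg.coeFn_toLp] with z hz
  rw [hz, RCLike.inner_apply, mul_assoc]

theorem continuous_integral_mul (hφ : Continuous φ) {χ : (Fin n → ℂ) → ℂ} (hχ : Continuous χ)
    (hs : HasCompactSupport χ) :
    Continuous fun f : Lp ℂ 2 (weightMeasure φ) => ∫ z, (f : (Fin n → ℂ) → ℂ) z * χ z := by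
  have hcc : Continuous (starRingEnd ℂ) := Complex.continuous_conj
  have hw : Continuous (wt fun w => -φ w) := by unfold wt; fun_prop
  have hm := memLp_weight_of_continuous hφ (g := fun z => conj (χ z) * wt (fun w => -φ w) z)
    (by fun_prop) (hs.comp_left (g := conj) (by simp)).mul_right
  have : (fun f : Lp ℂ 2 (weightMeasure φ) => ∫ z, (f : (Fin n → ℂ) → ℂ) z * χ z) =
      fun f => inner ℂ (hm.toLp _) f := by
    funext f
    rw [inner_toLp hφ hm]
    congr 1
    funext z
    rw [map_mul, Complex.conj_conj, conj_wt]
    linear_combination -(f : (Fin n → ℂ) → ℂ) z * χ z * wt_mul_wt_neg φ z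
  rw [this]
  fun_prop

theorem continuous_integral_coeff_mul (hφ : Continuous φ) {q : ℕ} (J : MultiIdx n q)
    {χ : (Fin n → ℂ) → ℂ} (hχ : Continuous χ) (hs : HasCompactSupport χ) :
    Continuous fun u : L2Form φ q => ∫ z, (u J : (Fin n → ℂ) → ℂ) z * χ z := by
  have h : Continuous fun u : L2Form φ q => u J := PiLp.continuous_apply 2 _ J
  exact (continuous_integral_mul hφ hχ hs).comp h

/-- The maximal operator is closed: its graph is defined by continuous linear equations. -/
theorem isClosed_dbar (hφ : Continuous φ) {p q : ℕ} (h : p + 1 = q) :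
    (dbar hφ h).IsClosed := by
  have hset : ((dbar hφ h).graph : Set (L2Form φ p × L2Form φ q)) =
      ⋂ (L : MultiIdx n q) (χ : (Fin n → ℂ) → ℂ) (_ : ContDiff ℝ ∞ χ) (_ : HasCompactSupport χ),
        {x | ∫ z, (x.2 L : (Fin n → ℂ) → ℂ) z * χ z =
          -∑ j : L.1, L.sign j * ∫ z, (x.1 (L.erase h j) : (Fin n → ℂ) → ℂ) z * dzbar j.1 χ z} := by
    ext ⟨u, v⟩
    simp only [SetLike.mem_coe, mem_graph_dbar, IsWeakDbar, Set.mem_iInter, Set.mem_ofPred_eq]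
  rw [LinearPMap.IsClosed, hset]
  refine isClosed_iInter fun L => isClosed_iInter fun χ => isClosed_iInter fun hχ =>
    isClosed_iInter fun hs => isClosed_eq ?_ ?_
  · exact (continuous_integral_coeff_mul hφ L hχ.continuous hs).comp continuous_snd
  · refine (continuous_finsetSum _ fun j _ => continuous_const.mul ?_).neg
    exact (continuous_integral_coeff_mul hφ (L.erase h j) (continuous_dzbar j.1 hχ)
      (hasCompactSupport_dzbar j.1 hs)).comp continuous_fst

/-- The form of degree `q` with the given continuous, compactly supported coefficients. -/
def formOf (hφ : Continuous φ) (q : ℕ) (G : Finset (Fin n) → (Fin n → ℂ) → ℂ)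
    (hG : ∀ J, Continuous (G J)) (hs : ∀ J, HasCompactSupport (G J)) : L2Form φ q :=
  WithLp.toLp 2 fun J => (memLp_weight_of_continuous hφ (hG J.1) (hs J.1)).toLp (G J.1)

theorem inner_formOf (hφ : Continuous φ) {q : ℕ} {G : Finset (Fin n) → (Fin n → ℂ) → ℂ}
    (hG : ∀ J, Continuous (G J)) (hs : ∀ J, HasCompactSupport (G J)) (u : L2Form φ q) :
    inner ℂ (formOf hφ q G hG hs) u =
      ∑ J, ∫ z, coeff u J z * (conj (G J z) * wt φ z) := by
  rw [← sum_multiIdx (q := q) _ fun J hJ => by simp [coeff_eq_zero u hJ], PiLp.inner_apply]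
  refine Finset.sum_congr rfl fun J _ => ?_
  rw [coeff_coe]
  exact inner_toLp hφ (memLp_weight_of_continuous hφ (hG J.1) (hs J.1)) _

theorem integral_dzbar_mul (j : Fin n) {f g : (Fin n → ℂ) → ℂ} (hf : ContDiff ℝ 1 f)
    (hg : ContDiff ℝ 1 g) (hs : HasCompactSupport g) :
    ∫ z, dzbar j f z * g z = -∫ z, f z * dzbar j g z := by
  have hcf := continuous_dzbar_of_contDiff j hf
  have hcg := continuous_dzbar_of_contDiff j hg
  have h0 := integral_dzbar_eq_zero j (hf.mul hg) hs.mul_left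
  have h1 : ∀ z, dzbar j (fun w => f w * g w) z = dzbar j f z * g z + f z * dzbar j g z :=
    fun z => dzbar_mul j (hf.differentiable one_ne_zero z) (hg.differentiable one_ne_zero z)
  simp only [h1] at h0
  have hi1 : Integrable fun z => dzbar j f z * g z :=
    (hcf.mul hg.continuous).integrable_of_hasCompactSupport hs.mul_left
  have hi2 : Integrable fun z => f z * dzbar j g z :=
    (hf.continuous.mul hcg).integrable_of_hasCompactSupport (hasCompactSupport_dzbar j hs).mul_left
  rw [integral_add hi1 hi2] at h0
  exact eq_neg_of_add_eq_zero_left h0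

theorem continuous_dbarForm {G : Finset (Fin n) → (Fin n → ℂ) → ℂ}
    (hG : ∀ J, ContDiff ℝ 1 (G J)) (L : Finset (Fin n)) : Continuous (dbarForm G L) := by
  unfold dbarForm wedgeSum
  have := fun j => continuous_dzbar_of_contDiff j (hG (L.erase j))
  fun_prop

theorem hasCompactSupport_dbarForm {G : Finset (Fin n) → (Fin n → ℂ) → ℂ}
    (hs : ∀ J, HasCompactSupport (G J)) (L : Finset (Fin n)) :
    HasCompactSupport (dbarForm G L) := by
  refine HasCompactSupport.intro (K := ⋃ J, tsupport (G J))
    (isCompact_iUnion fun J => (hs J).isCompact) fun z hz => ?_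
  rw [Set.mem_iUnion, not_exists] at hz
  refine Finset.sum_eq_zero fun j _ => ?_
  simp [dzbar_eq_zero_of_fderiv (fderiv_of_notMem_tsupport ℝ (hz (L.erase j)))]

/-- Test forms lie in the domain of `∂̄`, where it acts by differentiation. -/
theorem formOf_mem_graph (hφ : Continuous φ) {p q : ℕ} (h : p + 1 = q)
    {G : Finset (Fin n) → (Fin n → ℂ) → ℂ} (hG : ∀ J, ContDiff ℝ 1 (G J))
    (hs : ∀ J, HasCompactSupport (G J)) :
    (formOf hφ p G (fun J => (hG J).continuous) hs,
      formOf hφ q (dbarForm G) (continuous_dbarForm hG) (hasCompactSupport_dbarForm hs)) ∈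
      (dbar hφ h).graph := by
  rw [mem_graph_dbar]
  intro L χ hχ hχs
  have hval : ∀ {r : ℕ} (F : Finset (Fin n) → (Fin n → ℂ) → ℂ) (hF : ∀ J, Continuous (F J))
      (hFs : ∀ J, HasCompactSupport (F J)) (J : MultiIdx n r) (η : (Fin n → ℂ) → ℂ),
      ∫ z, (formOf hφ r F hF hFs J : (Fin n → ℂ) → ℂ) z * η z = ∫ z, F J.1 z * η z := by
    intro r F hF hFs J η
    refine integral_congr_ae ?_
    filter_upwards [ae_volume_of_ae_weight hφ
      (memLp_weight_of_continuous hφ (hF J.1) (hFs J.1)).coeFn_toLp] with z hz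
    change ((memLp_weight_of_continuous hφ (hF J.1) (hFs J.1)).toLp (F J.1) :
      (Fin n → ℂ) → ℂ) z * η z = _
    rw [hz]
  simp only [hval]
  have e : ∀ z, dbarForm G L.1 z * χ z =
      ∑ j : L.1, L.sign j * (dzbar j.1 (G (L.1.erase j.1)) z * χ z) := by
    intro z
    rw [dbarForm, wedgeSum, Finset.sum_mul, ← Finset.sum_coe_sort L.1]
    exact Finset.sum_congr rfl fun j _ => mul_assoc _ _ _
  simp only [e]
  rw [integral_finsetSum, ← Finset.sum_neg_distrib]
  · refine Finset.sum_congr rfl fun j _ => ?_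
    rw [integral_const_mul, integral_dzbar_mul j.1 (hG _) (hχ.of_le (by simp)) hχs, mul_neg]
    rfl
  · intro j _
    exact (((continuous_dzbar_of_contDiff j.1 (hG _)).mul
      hχ.continuous).integrable_of_hasCompactSupport hχs.mul_left).const_mul _

/-- The coefficients of `g dz̄_K`. -/
def monomialForm (K : Finset (Fin n)) (g : (Fin n → ℂ) → ℂ) : Finset (Fin n) →
    (Fin n → ℂ) → ℂ :=
  Pi.single K g

theorem contDiff_monomialForm (K : Finset (Fin n)) {g : (Fin n → ℂ) → ℂ} {k : WithTop ℕ∞}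
    (hg : ContDiff ℝ k g) (J : Finset (Fin n)) : ContDiff ℝ k (monomialForm K g J) := by
  unfold monomialForm
  rcases eq_or_ne J K with rfl | h
  · rwa [Pi.single_eq_same]
  · rw [Pi.single_eq_of_ne h]
    exact contDiff_const

theorem hasCompactSupport_monomialForm (K : Finset (Fin n)) {g : (Fin n → ℂ) → ℂ}
    (hg : HasCompactSupport g) (J : Finset (Fin n)) : HasCompactSupport (monomialForm K g J) := by
  unfold monomialForm
  rcases eq_or_ne J K with rfl | h
  · rwa [Pi.single_eq_same]
  · rw [Pi.single_eq_of_ne h]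
    exact HasCompactSupport.zero

theorem inner_formOf_monomialForm (hφ : Continuous φ) {q : ℕ} (K : Finset (Fin n))
    {g : (Fin n → ℂ) → ℂ} (hG : ∀ J, Continuous (monomialForm K g J))
    (hs : ∀ J, HasCompactSupport (monomialForm K g J)) (u : L2Form φ q) :
    inner ℂ (formOf hφ q (monomialForm K g) hG hs) u =
      ∫ z, coeff u K z * (conj (g z) * wt φ z) := by
  rw [inner_formOf, Finset.sum_eq_single K]
  · simp [monomialForm]
  · intro J _ hJ
    simp [monomialForm, Pi.single_eq_of_ne hJ]
  · simp

/-- A form orthogonal to all test forms vanishes. -/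
theorem dense_dbar_domain (hφ : Continuous φ) {p q : ℕ} (h : p + 1 = q) :
    Dense ((dbar hφ h).domain : Set (L2Form φ p)) := by
  rw [Submodule.dense_iff_topologicalClosure_eq_top, Submodule.topologicalClosure_eq_top_iff,
    Submodule.eq_bot_iff]
  intro u hu
  rw [Submodule.mem_orthogonal] at hu
  have hw : Continuous (wt φ) := by unfold wt; fun_prop
  ext1 K
  have hli : LocallyIntegrable (fun z => wt φ z * coeff u K.1 z) volume :=
    (locallyIntegrable_of_memLp_weight hφ (memLp_coeff u K.1)).continuous_mul hw
  have h0 : ∀ᵐ z, wt φ z * coeff u K.1 z = 0 := by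
    refine ae_eq_zero_of_integral_contDiff_smul_eq_zero hli fun g hg hgs => ?_
    have hgc : ContDiff ℝ 1 fun z => ((g z : ℝ) : ℂ) :=
      contDiff_ofReal_comp (hg.of_le (by simp))
    have hgs' : HasCompactSupport fun z => ((g z : ℝ) : ℂ) :=
      hgs.comp_left (g := Complex.ofReal) (by simp)
    have h1 := hu _ (LinearPMap.mem_domain_of_mem_graph (formOf_mem_graph hφ h
      (contDiff_monomialForm K.1 hgc) (hasCompactSupport_monomialForm K.1 hgs')))
    rw [inner_formOf_monomialForm] at h1
    rw [← h1]
    congr 1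
    funext z
    rw [Complex.conj_ofReal, Complex.real_smul]
    ring
  rw [PiLp.zero_apply]
  refine (Lp.eq_zero_iff_ae_eq_zero).2 ((weightMeasure_absolutelyContinuous φ).ae_le ?_)
  filter_upwards [h0] with z hz
  rw [coeff_coe] at hz
  exact (mul_eq_zero.1 hz).resolve_left (left_ne_zero_of_mul_eq_one (wt_mul_wt_neg φ z))

/-- On its domain, the Hilbert space adjoint of `∂̄` is the formal adjoint, in the sense of
distributions: it is tested against `ξ̄ e^φ dz̄_K`. -/
theorem weakDbarStarEq_coeff (hφ : ContDiff ℝ 2 φ) {p q : ℕ} (h : p + 1 = q) (u : L2Form φ q)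
    (w : L2Form φ p) (huw : (u, w) ∈ (dbar hφ.continuous h).adjoint.graph) :
    WeakDbarStarEq φ (coeff u) (coeff w) := by
  rw [mem_graph_adjoint_iff (dense_dbar_domain hφ.continuous h)] at huw
  intro K ξ hξ hξs
  let g : (Fin n → ℂ) → ℂ := fun z => conj (ξ z) * wt (fun w => -φ w) z
  have hg : ContDiff ℝ 2 g :=
    (contDiff_conj (hξ.of_le (WithTop.coe_le_coe.2 le_top))).mul (contDiff_wt hφ.neg)
  have hgs : HasCompactSupport g := (hξs.comp_left (g := conj) (by simp)).mul_right
  have hgw : ∀ z, conj (g z) * wt φ z = ξ z := by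
    intro z
    simp only [g, map_mul, Complex.conj_conj, conj_wt]
    linear_combination ξ z * wt_mul_wt_neg φ z
  have hdg : ∀ j z, conj (dzbar j g z) * wt φ z =
      dz j ξ z + dz j (fun x => (φ x : ℂ)) z * ξ z := by
    intro j z
    have h1 := dz_mul j (f := fun w => conj (g w)) (g := wt φ) (z := z)
      ((contDiff_conj hg).differentiable two_ne_zero z)
      ((contDiff_wt hφ).differentiable two_ne_zero z)
    simp only [hgw] at h1
    rw [dz_conj, dz_wt hφ] at h1
    rw [h1, ← hgw z]
    ring
  have h1 := huw _ _ (formOf_mem_graph hφ.continuous h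
    (contDiff_monomialForm K (hg.of_le one_le_two)) (hasCompactSupport_monomialForm K hgs))
  rw [inner_formOf_monomialForm, inner_formOf] at h1
  simp only [hgw] at h1
  rw [← h1]
  have hint : ∀ j J, Integrable fun z => coeff u J z *
      (dz j ξ z + dz j (fun x => (φ x : ℂ)) z * ξ z) := by
    intro j J
    have hc1 := continuous_dz_of_contDiff j (hξ.of_le (m := 1) (by simp))
    have hc2 := continuous_dz_of_contDiff j ((contDiff_ofReal_comp hφ).of_le one_le_two)
    exact integrable_mul_of_locallyIntegrable
      (locallyIntegrable_of_memLp_weight hφ.continuous (memLp_coeff u J))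
      (hc1.add (hc2.mul hξ.continuous)) ((hasCompactSupport_dz j hξs).add hξs.mul_left)
  have hterm : ∀ L : Finset (Fin n),
      ∫ z, coeff u L z * (conj (dbarForm (monomialForm K g) L z) * wt φ z) =
        ∑ j ∈ L, if L.erase j = K then sgn K j * ∫ z, coeff u L z *
          (dz j ξ z + dz j (fun x => (φ x : ℂ)) z * ξ z) else 0 := by
    intro L
    have e : ∀ z, coeff u L z * (conj (dbarForm (monomialForm K g) L z) * wt φ z) =
        ∑ j ∈ L, (if L.erase j = K then sgn K j else 0) *
          (coeff u L z * (dz j ξ z + dz j (fun x => (φ x : ℂ)) z * ξ z)) := by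
      intro z
      simp only [dbarForm, wedgeSum, map_sum, map_mul, conj_sgn, Finset.sum_mul, Finset.mul_sum]
      refine Finset.sum_congr rfl fun j hj => ?_
      split_ifs with hK
      · have hs : sgn L j = sgn K j := by
          rw [← hK, ← sgn_insert_self (L.erase j) j, Finset.insert_erase hj]
        rw [hK, hs, monomialForm, Pi.single_eq_same, ← hdg]
        ring
      · simp [monomialForm, Pi.single_eq_of_ne hK, dzbar]
    simp only [e]
    rw [integral_finsetSum _ fun j _ => (hint j L).const_mul _]
    refine Finset.sum_congr rfl fun j _ => ?_
    rw [integral_const_mul, ite_mul, zero_mul]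
  simp only [hterm]
  rw [sum_sum_mem_comm fun j L => if L.erase j = K then sgn K j * ∫ z, coeff u L z *
    (dz j ξ z + dz j (fun x => (φ x : ℂ)) z * ξ z) else 0]
  simp only [sum_filter_mem_eq]
  rw [← Finset.sum_subset (Finset.subset_univ Kᶜ)]
  · refine Finset.sum_congr rfl fun j hj => ?_
    have hj' : j ∉ K := Finset.mem_compl.1 hj
    rw [Finset.sum_eq_single_of_mem K (by simp [hj']), if_pos (Finset.erase_insert hj')]
    intro L hL hLK
    rw [Finset.erase_insert (by simpa using hL), if_neg hLK]
  · intro j _ hj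
    refine Finset.sum_eq_zero fun L hL => if_neg ?_
    rw [Finset.erase_insert (by simpa using hL)]
    rintro rfl
    exact hj (by simpa using hL)

/-- The a priori estimate `‖u‖² ≤ C (‖∂̄u‖² + ‖∂̄*_φ u‖²)` on `dom ∂̄ ∩ dom ∂̄*_φ`. -/
theorem exists_basic_estimate (hφ : ContDiff ℝ 2 φ) (hpsh : Plurisubharmonic φ) {p q r : ℕ}
    (hp : p + 1 = q) (hr : q + 1 = r) (hqn : q ≤ n)
    (hs : (0 : EReal) < Filter.liminf
      (fun z : Fin n → ℂ => ((sumSmallestEigenvalues hφ q z : ℝ) : EReal))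
      (Filter.cocompact (Fin n → ℂ))) :
    ∃ C > 0, ∀ (u : L2Form φ q) (v : L2Form φ r) (w : L2Form φ p),
      (u, v) ∈ (dbar hφ.continuous hr).graph → (u, w) ∈ (dbar hφ.continuous hp).adjoint.graph →
      ‖u‖ ^ 2 ≤ C * (‖v‖ ^ 2 + ‖w‖ ^ 2) := by
  obtain ⟨C, hC0, hC⟩ := exists_smooth_estimate hφ hpsh (by omega) hqn hs
  refine ⟨C, hC0, fun u v w huv huw => ?_⟩
  rw [mem_graph_dbar, ← weakDbarEq_coeff_iff] at huv
  have := weak_estimate hφ hC (memLp_coeff u) (memLp_coeff v) (memLp_coeff w)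
    (fun J => coeff_eq_zero u) huv (weakDbarStarEq_coeff hφ hp u w huw)
  rwa [sum_energy_coeff hφ.continuous, sum_energy_coeff hφ.continuous,
    sum_energy_coeff hφ.continuous] at this

end Operator

end

end WeightedDbar

open WeightedDbar in
theorem proposition2p1 (n q : ℕ) (hq : 1 ≤ q) (hqn : q ≤ n) (φ : (Fin n → ℂ) → ℝ)
    (hφ : ContDiff ℝ 2 φ) (hpsh : Plurisubharmonic φ)
    (hs : (0 : EReal) < Filter.liminf
      (fun z : Fin n → ℂ => ((sumSmallestEigenvalues hφ q z : ℝ) : EReal))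
      (Filter.cocompact (Fin n → ℂ))) :
    ∃! N : L2Form φ q →L[ℂ] L2Form φ q,
      ∀ u : L2Form φ q, ∃ h : N u ∈ (box hφ.continuous hq).domain,
        box hφ.continuous hq ⟨N u, h⟩ = u := by
  obtain ⟨C, hC0, hC⟩ := exists_basic_estimate hφ hpsh (Nat.sub_add_cancel hq) rfl hqn hs
  exact existsUnique_inverse (dense_dbar_domain _ _) (isClosed_dbar _ _) (dense_dbar_domain _ _)
    (isClosed_dbar _ _) (dbar_dbar _ _ _) hC0 hC
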